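/- Let $\mathbb H=\{(x,y)\in\mathbb Z^2: x+y\in 2\mathbb Z,\ y\ge 0\}$ and $\partial\mathbb H=\{(x,0):x\in2\mathbb Z\}$. Every $v=(x,y)\in\mathbb H$ has two outgoing directed edges, to $v_l=(x-1,y+1)$ and to $v_r=(x+1,y+1)$. The height of a vertex is $h(x,y)=y$, and the height $h(e)$ of an edge $e$ is the larger height of its two endpoints. A monotone path is a finite (possibly empty) directed path. (1) First passage percolation. Let $(\omega(e))_e$ be independent random variables, indexed by the edges of $\mathbb H$, where $\omega(e)$ has the exponential distribution of rate $2^{-h(e)}$ (mean $2^{h(e)}$). The length of a monotone path is $\lambda(\gamma)=\sum_{e\in\gamma}\omega(e)$, and $d_\omega(y,\partial\mathbb H)$ is the minimal length of a monotone path from a vertex of $\partial\mathbb H$ to $y$. For $x\in\partial\mathbb H$ let $\hat T(x)$ be the tree with root $x$ that is the union, over all $y\in\mathbb H$, of the monotone paths $\gamma$ from $x$ to $y$ with $\lambda(\gamma)=d_\omega(y,\partial\mathbb H)$. Then $$P\big(|\hat T(0)|<\infty\big)=1,$$ and almost surely $|\hat T(x)|<\infty$ for all $x\in\partial\mathbb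 H$ simultaneously. (2) Stretch IDLA. Put independent Poisson clocks of rate $1$ at the vertices of $\partial\mathbb H$. Let $T(x,t)$ be the tree rooted at $x\in\partial\mathbb H$ at time $t\ge0$; at time $0$ it is the single vertex $x$. Whenever the clock at $x$ rings, a particle starts at $x$ and moves instantaneously: from its current vertex $v$ it chooses $a\in\{v_l,v_r\}$ with probability $\frac12$ each, independently of everything else. If $a$ belongs to none of the trees just before the ring, then the edge $(v,a)$ and the vertex $a$ are added to the tree of $x$ and the particle stops. If the edge $(v,a)$ belongs to the tree of $x$, the particle moves to $a$ and continues. In all other cases it vanishes. The trees change in no other way. Then almost surely this evolution $(T(x,t))_{x\in\partial\mathbb H,\,t\ge0}$ is well defined (the clocks and choices determine exactly one such evolution), and all its final trees $T(x)=\bigcup_{t\ge0}T(x,t)$, $x\in\partial\mathbb H$, are finite. -/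

import Mathlib

open MeasureTheory ProbabilityTheory
open scoped NNReal

namespace StretchIDLA

/-- The vertices of the rotated upper half-lattice `ℍ = {(x, y) : x + y ∈ 2ℤ, y ≥ 0}`. -/
abbrev Site : Type := {p : ℤ × ℤ // Even (p.1 + p.2) ∧ 0 ≤ p.2}

/-- The height `h(v) = y` of a vertex `v = (x, y)`. -/
def Site.height (v : Site) : ℤ := v.1.2

/-- The upper neighbour `v_r = v + (1, 1)` (for `true`) or `v_l = v + (-1, 1)` (for `false`). -/
def Site.up (v : Site) (right : Bool) : Site :=
  ⟨(if right then v.1.1 + 1 else v.1.1 - 1, v.1.2 + 1), by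
    obtain ⟨⟨a, b⟩, h, hb⟩ := v
    refine ⟨?_, by simp only at hb ⊢; omega⟩
    rw [Int.even_iff] at h ⊢
    cases right <;> simp only [if_true, Bool.false_eq_true, if_false] at h ⊢ <;> omega⟩

/-- The vertices `∂ℍ` of height zero, which are the roots of the trees. -/
abbrev Root : Type := {v : Site // v.height = 0}

/-- The origin. -/
def origin : Root := ⟨⟨(0, 0), by simp⟩, rfl⟩

/-- The directed edges of `ℍ`: the pair `(v, true)` stands for the edge `e_r(v) = (v, v_r)`, and
`(v, false)` for the edge `e_l(v) = (v, v_l)`. -/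
abbrev Edge : Type := Site × Bool

/-- The lower endpoint of an edge. -/
def Edge.src (e : Edge) : Site := e.1

/-- The upper endpoint of an edge. -/
def Edge.tgt (e : Edge) : Site := e.1.up e.2

/-- The height of an edge: the larger of the heights of its endpoints. -/
def Edge.height (e : Edge) : ℤ := max (Edge.src e).height (Edge.tgt e).height

/-- The vertex set of a tree that is given by its root and its set of edges. -/
def treeVertices (x : Root) (E : Set Edge) : Set Site :=
  {v | v = x.1 ∨ ∃ e ∈ E, v = Edge.src e ∨ v = Edge.tgt e}

/-! ### First passage percolation -/

/-- `IsPath x y γ`: the list of edges `γ` is a (possibly empty) monotone path from `x` up to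
`y`. -/
inductive IsPath : Site → Site → List Edge → Prop
  | nil (x : Site) : IsPath x x []
  | cons (e : Edge) {y : Site} {γ : List Edge} (h : IsPath (Edge.tgt e) y γ) :
      IsPath (Edge.src e) y (e :: γ)

/-- The length of a path: the sum of the weights of its edges. -/
def pathLength (ω : Edge → ℝ) (γ : List Edge) : ℝ := (γ.map ω).sum

/-- The passage time between two vertices: the minimum of the lengths of the monotone paths that
connect them (`⊤` if there is none). -/
noncomputable def passageTime (ω : Edge → ℝ) (x y : Site) : EReal :=
  ⨅ (γ : List Edge) (_ : IsPath x y γ ∨ IsPath y x γ), (pathLength ω γ : EReal)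

/-- The passage time `d_ω(y, ∂ℍ)` between a vertex and the boundary. -/
noncomputable def distBoundary (ω : Edge → ℝ) (y : Site) : EReal :=
  ⨅ x : Root, passageTime ω y x.1

/-- The edges of the geodesic tree `T̂(x)`: the union of all monotone paths `γ` that start at `x`
and, `y` being the endpoint of `γ`, realize the distance from `y` to `∂ℍ`. -/
def geodesicTree (ω : Edge → ℝ) (x : Root) : Set Edge :=
  {e | ∃ (y : Site) (γ : List Edge),
    IsPath x.1 y γ ∧ (pathLength ω γ : EReal) = distBoundary ω y ∧ e ∈ γ}

/-- The random weights `ω` are independent, and `ω e` has the exponential distribution of rate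
`2 ^ (-h(e))` (that is, of mean `2 ^ h(e)`). -/
structure IsFPP {Ω : Type*} [MeasurableSpace Ω] (P : Measure Ω) (ω : Edge → Ω → ℝ) : Prop where
  measurable : ∀ e, Measurable (ω e)
  law : ∀ e, P.map (ω e) = expMeasure ((2 : ℝ) ^ (-Edge.height e))
  indep : iIndepFun ω P

/-! ### Stretch IDLA -/

/-- The position after `n` steps of the particle that starts at `x` and goes up according to the
choices `c 0, c 1, …`. -/
def walk (x : Site) (c : ℕ → Bool) : ℕ → Site
  | 0 => x
  | n + 1 => (walk x c n).up (c n)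

/-- The edge that this particle wants to cross in its step number `n` (counted from zero). -/
def walkEdge (x : Site) (c : ℕ → Bool) (n : ℕ) : Edge := (walk x c n, c n)

/-- In the forest `F` (`F x'` is the set of edges of the tree rooted at `x'`), the particle that
starts at the root `x` and makes the choices `c` adjoins the edge `e` to the tree of `x`: it first
crosses edges of this tree only, and then `e` leads it to a vertex outside all trees. In all
other cases the particle vanishes. -/
def Adjoins (F : Root → Set Edge) (x : Root) (c : ℕ → Bool) (e : Edge) : Prop :=
  ∃ n : ℕ, e = walkEdge x.1 c n ∧ (∀ j < n, walkEdge x.1 c j ∈ F x) ∧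
    ∀ x' : Root, Edge.tgt e ∉ treeVertices x' (F x')

/-- The forest just before time `t`. -/
def before (T : Root → ℝ≥0 → Set Edge) (t : ℝ≥0) (x : Root) : Set Edge :=
  ⋃ (s : ℝ≥0) (_ : s < t), T x s

/-- `T` is the Stretch IDLA evolution driven by the clock rings `ring x 0, ring x 1, …` of the
roots `x` and the choices `coin x k 0, coin x k 1, …` of the particle that ring number `k` at `x`
creates. Here `T x t` is the set of edges of the tree of `x` at time `t`. At time zero this tree
is the single vertex `x`; it does not change between rings of the clock at `x`; at a ring it
changes by the edge, if any, that the particle adjoins. -/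
structure IsEvolution (ring : Root → ℕ → ℝ) (coin : Root → ℕ → ℕ → Bool)
    (T : Root → ℝ≥0 → Set Edge) : Prop where
  init : ∀ x, T x 0 = ∅
  const : ∀ (x : Root) (s t : ℝ≥0), s ≤ t →
    (∀ k, ¬ ((s : ℝ) < ring x k ∧ ring x k ≤ (t : ℝ))) → T x t = T x s
  jump : ∀ (x : Root) (k : ℕ) (t : ℝ≥0), (t : ℝ) = ring x k →
    T x t = before T t x ∪ {e | Adjoins (before T t) x (coin x k) e}

/-- The tree `T(x) = T(x, ∞)` that a root has built in the end. -/
def finalTree (T : Root → ℝ≥0 → Set Edge) (x : Root) : Set Edge := ⋃ t : ℝ≥0, T x t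

/-- The ring times of a clock with given waiting times. -/
noncomputable def ringTime (τ : ℕ → ℝ) (k : ℕ) : ℝ := ∑ j ∈ Finset.range (k + 1), τ j

/-- The randomness of Stretch IDLA: `τ (x, k)`, `k ∈ ℕ`, are the waiting times of a Poisson clock
of rate one at the root `x`, and `ξ (x, k, n)` is the choice that the particle created by ring
number `k` of this clock makes in step number `n`. All clocks and all choices are independent, and
the choices are fair. -/
structure IsDriving {Ω : Type*} [MeasurableSpace Ω] (P : Measure Ω)
    (τ : Root × ℕ → Ω → ℝ) (ξ : Root × ℕ × ℕ → Ω → Bool) : Prop where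
  measurable_clock : ∀ i, Measurable (τ i)
  measurable_coin : ∀ i, Measurable (ξ i)
  law_clock : ∀ i, P.map (τ i) = expMeasure 1
  law_coin : ∀ i b, P {w | ξ i w = b} = 1 / 2
  indep_clock : iIndepFun τ P
  indep_coin : iIndepFun ξ P
  indep_clock_coin : IndepFun (fun w i => τ i w) (fun w i => ξ i w) P

end StretchIDLA

/-! Stretch IDLA is first passage percolation in disguise, so a single extinction estimate settles
both parts.

Extinction. Geodesics do not cross, so every tree meets every level in an interval. Distances to
level n have mean at most 2·2^n, a geometric sum, which is the order of the weights just above level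
n. Hence, with a probability bounded below uniformly in n, the weights of the next K levels let the
two neighbours of a tree with at most K vertices close up over it (`extinct_of_kill`,
`exists_le_prod_killSet`). By translation invariance, the probability that a given root survives to
level n is the probability that some tree has its left end at a fixed position of that level
(`gridMeasure_transport`). Trees wider than K account for at most 1/(K+1) of this probability
(`gridMeasure_wide_le`), and Markov's inequality controls the distances. If the survival probability
had a positive limit, a fixed amount of it would be lost every K levels (`survival_add_le`,
`tendsto_survival`). Almost surely there are no ties, so a geodesic keeps one label along its way,
and extinction of the label makes the geodesic tree finite.

Coupling. Suppose that the particles arriving at a vertex of height n after its occupation form a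
Poisson process of rate 2^(-n) with fresh fair choices. Sorting them by the next choice gives
independent Poisson processes of half the rate on the two outgoing edges
(`measurePreserving_splitOff`). Let the weight of an edge be the waiting time for its first
crossing: it is exponential of mean 2^(n+1). The upper endpoint is occupied by the earlier of the
first crossings of its two incoming edges, that is, at its distance from the boundary. Particles on
the losing edge vanish; the later ones on the winning edge form the stream at the new vertex and are
independent of all weights revealed so far. So the weights have the law of first passage percolation
(`measurePreserving_exploredWeights`), and the geodesic trees, revealed according to distance,
satisfy the rules of the evolution (`isEvolution_gridForest`). The evolution is unique by induction
on height (`IsEvolution.unique`). -/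

namespace StretchIDLA

/-! ### The lattice in the coordinates level and index -/

/-- Edge weights in the coordinates `(n, i) ↦ (2 i + n, n)`: the edge `(n, i, true)` leads from
`(n, i)` to `(n + 1, i)`, and `(n, i, false)` to `(n + 1, i - 1)`. -/
abbrev Weights : Type := ℕ × ℤ × Bool → ℝ

/-- The distance from level zero. -/
noncomputable def gridDist (w : Weights) : ℕ → ℤ → ℝ
  | 0, _ => 0
  | n + 1, i => min (gridDist w n i + w (n, i, true)) (gridDist w n (i + 1) + w (n, i + 1, false))

/-- The edge from `(n, i)` is the last edge of a geodesic to `(n + 1, i)`. -/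
def RightWins (w : Weights) (n : ℕ) (i : ℤ) : Prop :=
  gridDist w n i + w (n, i, true) ≤ gridDist w n (i + 1) + w (n, i + 1, false)

open Classical in
/-- The index of the starting point of a geodesic to `(n, i)`. -/
noncomputable def gridLabel (w : Weights) : ℕ → ℤ → ℤ
  | 0, i => i
  | n + 1, i => if RightWins w n i then gridLabel w n i else gridLabel w n (i + 1)

lemma gridLabel_succ_of_rightWins {w : Weights} {n : ℕ} {i : ℤ} (h : RightWins w n i) :
    gridLabel w (n + 1) i = gridLabel w n i := by simp [gridLabel, h]

lemma gridLabel_succ_of_not_rightWins {w : Weights} {n : ℕ} {i : ℤ} (h : ¬ RightWins w n i) :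
    gridLabel w (n + 1) i = gridLabel w n (i + 1) := by simp [gridLabel, h]

lemma gridLabel_succ_eq_or (w : Weights) (n : ℕ) (i : ℤ) :
    gridLabel w (n + 1) i = gridLabel w n i ∨ gridLabel w (n + 1) i = gridLabel w n (i + 1) := by
  by_cases h : RightWins w n i
  · exact .inl (gridLabel_succ_of_rightWins h)
  · exact .inr (gridLabel_succ_of_not_rightWins h)

/-- Planarity: the neighbours `i` and `i + 1` inherit from `{i, i + 1}` and from `{i + 1, i + 2}`,
so geodesics cannot cross. It follows that a tree occupies an interval of indices at each level. -/
lemma gridLabel_mono (w : Weights) (n : ℕ) : Monotone (gridLabel w n) := by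
  induction n with
  | zero => exact fun i j h => h
  | succ n ih =>
    refine monotone_int_of_le_succ fun i => ?_
    rcases gridLabel_succ_eq_or w n i with h | h <;>
    rcases gridLabel_succ_eq_or w n (i + 1) with h' | h' <;>
    rw [h, h'] <;> exact ih (by omega)

lemma le_gridLabel (w : Weights) (n : ℕ) (i : ℤ) : i ≤ gridLabel w n i := by
  induction n generalizing i with
  | zero => exact le_rfl
  | succ n ih =>
    have h₁ := ih i
    have h₂ := ih (i + 1)
    rcases gridLabel_succ_eq_or w n i with h | h <;> omega

lemma gridLabel_le (w : Weights) (n : ℕ) (i : ℤ) : gridLabel w n i ≤ i + n := by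
  induction n generalizing i with
  | zero => simp [gridLabel]
  | succ n ih =>
    have h₁ := ih i
    have h₂ := ih (i + 1)
    rcases gridLabel_succ_eq_or w n i with h | h <;> push_cast <;> omega

lemma exists_gridLabel_eq_of_le {w : Weights} {m n : ℕ} (hmn : m ≤ n) {j : ℤ}
    (h : ∃ i, gridLabel w n i = j) : ∃ i, gridLabel w m i = j := by
  induction n, hmn using Nat.le_induction with
  | base => exact h
  | succ n _ ih =>
    obtain ⟨i, rfl⟩ := h
    rcases gridLabel_succ_eq_or w n i with h | h <;> exact ih ⟨_, h.symm⟩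

lemma gridDist_succ_le_left (w : Weights) (n : ℕ) (i : ℤ) :
    gridDist w (n + 1) i ≤ gridDist w n i + w (n, i, true) := min_le_left _ _

lemma gridDist_succ_le_right (w : Weights) (n : ℕ) (i : ℤ) :
    gridDist w (n + 1) i ≤ gridDist w n (i + 1) + w (n, i + 1, false) := min_le_right _ _

lemma gridDist_nonneg {w : Weights} (hw : ∀ e, 0 ≤ w e) (n : ℕ) (i : ℤ) : 0 ≤ gridDist w n i := by
  induction n generalizing i with
  | zero => exact le_rfl
  | succ n ih => exact le_min (add_nonneg (ih _) (hw _)) (add_nonneg (ih _) (hw _))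

lemma gridDist_le_sum (w : Weights) (n : ℕ) (i : ℤ) :
    gridDist w n i ≤ ∑ m ∈ Finset.range n, w (m, i, true) := by
  induction n with
  | zero => simp [gridDist]
  | succ n ih =>
    rw [Finset.sum_range_succ]
    exact (gridDist_succ_le_left w n i).trans (by gcongr)

/-- The distance to level `n` only depends on the weights below this level. -/
lemma gridDist_congr {w w' : Weights} {n : ℕ} (h : ∀ m < n, ∀ i b, w (m, i, b) = w' (m, i, b))
    (i : ℤ) : gridDist w n i = gridDist w' n i := by
  induction n generalizing i with
  | zero => rfl
  | succ n ih =>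
    have ih' := ih fun m hm => h m (by omega)
    simp only [gridDist, ih', h n (by omega)]

lemma gridLabel_congr {w w' : Weights} {n : ℕ} (h : ∀ m < n, ∀ i b, w (m, i, b) = w' (m, i, b))
    (i : ℤ) : gridLabel w n i = gridLabel w' n i := by
  induction n generalizing i with
  | zero => rfl
  | succ n ih =>
    have ih' := ih fun m hm => h m (by omega)
    have hd := gridDist_congr (n := n) fun m hm => h m (by omega)
    have hr : RightWins w n i ↔ RightWins w' n i := by
      simp only [RightWins, hd, h n (by omega)]
    by_cases hc : RightWins w' n i
    · rw [gridLabel_succ_of_rightWins hc, gridLabel_succ_of_rightWins (hr.2 hc), ih']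
    · rw [gridLabel_succ_of_not_rightWins hc, gridLabel_succ_of_not_rightWins (mt hr.1 hc), ih']

/-- The translate of the weights by `a` steps to the left. -/
def shiftWeights (a : ℤ) (w : Weights) : Weights := fun e => w (e.1, e.2.1 + a, e.2.2)

lemma gridDist_shiftWeights (a : ℤ) (w : Weights) (n : ℕ) (i : ℤ) :
    gridDist (shiftWeights a w) n i = gridDist w n (i + a) := by
  induction n generalizing i with
  | zero => rfl
  | succ n ih => simp only [gridDist, ih, shiftWeights, add_right_comm i a 1]

/-- A label is itself an index of level zero, so it must be translated back; this is the correction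
`- a`. -/
lemma gridLabel_shiftWeights (a : ℤ) (w : Weights) (n : ℕ) (i : ℤ) :
    gridLabel (shiftWeights a w) n i = gridLabel w n (i + a) - a := by
  induction n generalizing i with
  | zero => simp [gridLabel]
  | succ n ih =>
    have : RightWins (shiftWeights a w) n i ↔ RightWins w n (i + a) := by
      simp only [RightWins, gridDist_shiftWeights, shiftWeights, add_right_comm i a 1]
    by_cases h : RightWins w n (i + a)
    · rw [gridLabel_succ_of_rightWins (this.2 h), gridLabel_succ_of_rightWins h, ih]
    · rw [gridLabel_succ_of_not_rightWins (mt this.1 h), gridLabel_succ_of_not_rightWins h, ih,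
        add_right_comm]

@[fun_prop]
lemma measurable_gridDist (n : ℕ) (i : ℤ) : Measurable fun w : Weights => gridDist w n i := by
  induction n generalizing i with
  | zero => exact measurable_const
  | succ n ih => exact ((ih i).add (measurable_pi_apply _)).min ((ih _).add (measurable_pi_apply _))

lemma measurableSet_rightWins (n : ℕ) (i : ℤ) : MeasurableSet {w : Weights | RightWins w n i} :=
  measurableSet_le (by fun_prop) (by fun_prop)

@[fun_prop]
lemma measurable_gridLabel (n : ℕ) (i : ℤ) : Measurable fun w : Weights => gridLabel w n i := by
  induction n generalizing i with
  | zero => exact measurable_const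
  | succ n ih => exact Measurable.ite (measurableSet_rightWins n i) (ih _) (ih _)

/-! ### Extinction, and weights that force it -/

/-- The tree of the root with index `j` does not reach level `n`. -/
def Extinct (w : Weights) (n : ℕ) (j : ℤ) : Prop := ∀ i, gridLabel w n i ≠ j

lemma Extinct.mono {w : Weights} {m n : ℕ} (hmn : m ≤ n) {j : ℤ} (h : Extinct w m j) :
    Extinct w n j := fun i hi => by
  obtain ⟨i', hi'⟩ := exists_gridLabel_eq_of_le hmn ⟨i, hi⟩
  exact h i' hi'

lemma measurableSet_extinct (n : ℕ) (j : ℤ) : MeasurableSet {w : Weights | Extinct w n j} := by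
  have : {w : Weights | Extinct w n j} = ⋂ i, (fun w => gridLabel w n i) ⁻¹' {j}ᶜ := by
    ext w; simp [Extinct]
  rw [this]
  exact .iInter fun i => measurable_gridLabel n i (.of_discrete)

lemma extinct_shiftWeights (a : ℤ) (w : Weights) (n : ℕ) (j : ℤ) :
    Extinct (shiftWeights a w) n (j - a) ↔ Extinct w n j := by
  simp only [Extinct, gridLabel_shiftWeights, ne_eq, sub_left_inj]
  exact ⟨fun h i => by simpa using h (i - a), fun h i => h _⟩

/-- The edges along which the two neighbours of a tree approach each other. -/
def Fast (n K : ℕ) (e : ℕ × ℤ × Bool) : Prop :=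
  (e.2.2 = true ∧ e.2.1 = -1) ∨ (e.2.2 = false ∧ e.2.1 = K - (e.1 - n : ℤ))

/-- The edges whose weights can put an end to a tree. -/
noncomputable def killBox (n K : ℕ) : Finset (ℕ × ℤ × Bool) :=
  Finset.Ico n (n + K) ×ˢ Finset.Icc (-1 : ℤ) K ×ˢ Finset.univ

lemma card_killBox (n K : ℕ) : (killBox n K).card = K * ((K + 2) * 2) := by
  simp [killBox]
  ring_nf
  omega

open Classical in
/-- The values of the weights that put an end to a tree. -/
noncomputable def killSet (n K : ℕ) (C : ℝ) (e : ℕ × ℤ × Bool) : Set ℝ :=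
  if Fast n K e then Set.Iic (2 ^ n) else Set.Ioi ((C + K + 1) * 2 ^ n)

/-- If a tree has at most `K` vertices at level `n`, its neighbours are not too far from the
boundary, and the weights above are as prescribed, then the tree does not reach level `n + K`. -/
lemma extinct_of_kill {w : Weights} {n K : ℕ} {C : ℝ} (hw : ∀ e, 0 ≤ w e)
    (h0 : gridLabel w n (-1) ≠ gridLabel w n 0) (hK : gridLabel w n K ≠ gridLabel w n 0)
    (hd0 : gridDist w n (-1) ≤ C * 2 ^ n) (hdK : gridDist w n K ≤ C * 2 ^ n)
    (hkill : ∀ e ∈ killBox n K, w e ∈ killSet n K C e) :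
    Extinct w (n + K) (gridLabel w n 0) := by
  have h2 : (0 : ℝ) < 2 ^ n := by positivity
  have hfast : ∀ s < K, ∀ (i : ℤ) (b : Bool), -1 ≤ i → i ≤ K → Fast n K (n + s, i, b) →
      w (n + s, i, b) ≤ 2 ^ n := fun s hs i b h1 h2 hf => by
    have := hkill (n + s, i, b) (by simp [killBox]; omega)
    simpa [killSet, hf] using this
  have hslow : ∀ s < K, ∀ (i : ℤ) (b : Bool), -1 ≤ i → i ≤ K → ¬ Fast n K (n + s, i, b) →
      (C + K + 1) * 2 ^ n < w (n + s, i, b) := fun s hs i b h1 h2 hf => by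
    have := hkill (n + s, i, b) (by simp [killBox]; omega)
    simpa [killSet, hf] using this
  -- Invariant: after `s` levels the left neighbour still has index `-1`, the right one has moved
  -- from `K` to `K - s`, and both distances have grown by at most 2^n per level. They stay at most
  -- (C + K) 2^n, less than the weight of any competing edge.
  have key : ∀ s ≤ K, gridLabel w (n + s) (-1) = gridLabel w n (-1) ∧
      gridLabel w (n + s) (K - s) = gridLabel w n K ∧
      gridDist w (n + s) (-1) ≤ (C + s) * 2 ^ n ∧
      gridDist w (n + s) (K - s) ≤ (C + s) * 2 ^ n := by
    intro s
    induction s with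
    | zero => intro _; simp [hd0, hdK]
    | succ s ih =>
      intro hs
      obtain ⟨h1, h2', h3, h4⟩ := ih (by omega)
      have hsK : (s : ℝ) + 1 ≤ K := by exact_mod_cast hs
      have f1 := hfast s (by omega) (-1) true (by omega) (by omega) (by simp [Fast])
      have f2 := hfast s (by omega) (K - s) false (by omega) (by omega) (by simp [Fast])
      have s1 := hslow s (by omega) 0 false (by omega) (by omega) (by simp [Fast]; omega)
      have s2 := hslow s (by omega) (K - s - 1) true (by omega) (by omega) (by simp [Fast]; omega)
      have e1 : (-1 : ℤ) + 1 = 0 := rfl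
      have e2 : (K : ℤ) - (s + 1 : ℕ) = K - s - 1 := by push_cast; ring
      have e3 : (K : ℤ) - s - 1 + 1 = K - s := by ring
      have n0 := gridDist_nonneg hw (n + s) 0
      have n1 := gridDist_nonneg hw (n + s) (K - s - 1)
      have r1 : RightWins w (n + s) (-1) := by
        rw [RightWins, e1]
        nlinarith
      have r2 : ¬ RightWins w (n + s) (K - s - 1) := by
        rw [RightWins, e3, not_le]
        nlinarith
      have d1 := gridDist_succ_le_left w (n + s) (-1)
      have d2 := gridDist_succ_le_right w (n + s) (K - s - 1)
      rw [e3] at d2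
      rw [← add_assoc n s 1, e2]
      refine ⟨(gridLabel_succ_of_rightWins r1).trans h1, ?_, ?_, ?_⟩
      · rw [gridLabel_succ_of_not_rightWins r2, e3, h2']
      · push_cast; nlinarith
      · push_cast; nlinarith
  -- For `s = K` the two neighbours sit side by side at `-1` and `0`, and monotonicity of the labels
  -- leaves no place for a label between theirs.
  obtain ⟨k1, k2, -, -⟩ := key K le_rfl
  intro i hi
  rw [sub_self] at k2
  have l1 := gridLabel_mono w n (show (-1 : ℤ) ≤ 0 by omega)
  have l2 := gridLabel_mono w n (show (0 : ℤ) ≤ K by omega)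
  rcases lt_or_ge i 0 with h | h
  · have := gridLabel_mono w (n + K) (show i ≤ -1 by omega)
    omega
  · have := gridLabel_mono w (n + K) h
    omega

/-! ### Exponential distributions -/

lemma expMeasure_Iic {r x : ℝ} (hr : 0 < r) (hx : 0 ≤ x) :
    expMeasure r (Set.Iic x) = ENNReal.ofReal (1 - Real.exp (-(r * x))) := by
  have := isProbabilityMeasure_expMeasure hr
  rw [← ofReal_cdf, cdf_expMeasure_eq hr, if_pos hx]

lemma expMeasure_Ioi {r x : ℝ} (hr : 0 < r) (hx : 0 ≤ x) :
    expMeasure r (Set.Ioi x) = ENNReal.ofReal (Real.exp (-(r * x))) := by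
  have := isProbabilityMeasure_expMeasure hr
  rw [← Set.compl_Iic, prob_compl_eq_one_sub measurableSet_Iic, expMeasure_Iic hr hx,
    ← ENNReal.ofReal_one, ← ENNReal.ofReal_sub _ (by simp; positivity), sub_sub_cancel]

lemma ae_pos_expMeasure {r : ℝ} (hr : 0 < r) : ∀ᵐ x ∂expMeasure r, 0 < x := by
  rw [ae_iff]
  simp only [not_lt]
  exact (expMeasure_Iic hr le_rfl).trans (by simp)

lemma expMeasure_eq_withDensity (r : ℝ) :
    expMeasure r = volume.withDensity (exponentialPDF r) := rfl

instance (r : ℝ) : NullSingletonClass (expMeasure r) := by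
  rw [expMeasure_eq_withDensity]
  infer_instance

/-- Layer cake formula: the mean is the integral of the tail exp(-r t). -/
lemma lintegral_ofReal_expMeasure {r : ℝ} (hr : 0 < r) :
    ∫⁻ x, ENNReal.ofReal x ∂expMeasure r = ENNReal.ofReal r⁻¹ := by
  rw [lintegral_eq_lintegral_meas_lt (f := fun x => x) _
    ((ae_pos_expMeasure hr).mono fun x hx => hx.le) aemeasurable_id]
  have h1 : ∀ t ∈ Set.Ioi (0 : ℝ), expMeasure r {a | t < a}
      = ENNReal.ofReal (Real.exp (-r * t)) := fun t ht => by
    rw [neg_mul]; exact expMeasure_Ioi hr (le_of_lt ht)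
  rw [setLIntegral_congr_fun measurableSet_Ioi h1, ← ofReal_integral_eq_lintegral_ofReal
    (exp_neg_integrableOn_Ioi 0 hr) (Filter.Eventually.of_forall fun _ => (Real.exp_pos _).le),
    integral_exp_mul_Ioi (neg_neg_of_pos hr)]
  simp [neg_div_neg_eq]

/-- The exponential distribution of mean `2 ^ n`. -/
noncomputable def levelExp (n : ℕ) : Measure ℝ := expMeasure ((2 : ℝ) ^ n)⁻¹

instance (n : ℕ) : IsProbabilityMeasure (levelExp n) :=
  isProbabilityMeasure_expMeasure (by positivity)

instance (n : ℕ) : NullSingletonClass (levelExp n) := inferInstanceAs (NullSingletonClass (expMeasure _))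

lemma ae_pos_levelExp (n : ℕ) : ∀ᵐ x ∂levelExp n, 0 < x := ae_pos_expMeasure (by positivity)

/-! ### Finiteness of the trees of first passage percolation in grid coordinates -/

/-- The law of the weights. -/
noncomputable def gridMeasure : Measure Weights := Measure.infinitePi fun e => levelExp (e.1 + 1)

instance : IsProbabilityMeasure gridMeasure := inferInstanceAs (IsProbabilityMeasure (Measure.infinitePi _))

lemma measurePreserving_eval_gridMeasure (e : ℕ × ℤ × Bool) :
    MeasurePreserving (fun w : Weights => w e) gridMeasure (levelExp (e.1 + 1)) :=
  measurePreserving_eval_infinitePi _ e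

lemma ae_pos_gridMeasure : ∀ᵐ w ∂gridMeasure, ∀ e, 0 < w e := by
  refine ae_all_iff.2 fun e => ?_
  exact (measurePreserving_eval_gridMeasure e).quasiMeasurePreserving.ae (ae_pos_levelExp _)

lemma measurable_shiftWeights (a : ℤ) : Measurable (shiftWeights a) :=
  measurable_pi_iff.2 fun _ => measurable_pi_apply _

/-- The law of a weight depends on its level only, and a horizontal translation permutes the edges
of each level. -/
lemma measurePreserving_shiftWeights (a : ℤ) :
    MeasurePreserving (shiftWeights a) gridMeasure gridMeasure := by
  refine ⟨measurable_shiftWeights a, ?_⟩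
  refine Measure.map_infinitePi_infinitePi_of_inj (P := fun e : ℕ × ℤ × Bool => levelExp (e.1 + 1))
    (f := fun e : ℕ × ℤ × Bool => (e.1, e.2.1 + a, e.2.2)) ?_
  rintro ⟨n, i, b⟩ ⟨m, j, c⟩ h
  simpa using h

/-- Membership in the set `A` only depends on the weights of the edges in `S`. -/
def DependsOnEdges (S : Set (ℕ × ℤ × Bool)) (A : Set Weights) : Prop :=
  ∀ w w' : Weights, (∀ e ∈ S, w e = w' e) → w ∈ A → w' ∈ A

/-- The set `A` is its own preimage under the map that replaces all coordinates outside `S` by zero,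
and this map is measurable for the σ-algebra of the coordinates in `S`. -/
lemma measurableSet_iSup_comap_of_dependsOnEdges {S : Set (ℕ × ℤ × Bool)} {A : Set Weights}
    (hA : MeasurableSet A) (hdep : DependsOnEdges S A) :
    MeasurableSet[⨆ e ∈ S, MeasurableSpace.comap (fun w : Weights => w e) inferInstance] A := by
  classical
  let f : Weights → Weights := fun w e => if e ∈ S then w e else 0
  have hf : Measurable[⨆ e ∈ S, MeasurableSpace.comap (fun w : Weights => w e) inferInstance] f := by
    refine @measurable_pi_lambda _ _ _ (_) _ _ fun e => ?_
    by_cases h : e ∈ S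
    · simp only [f, h, if_true]
      exact Measurable.mono (comap_measurable (fun w : Weights => w e))
        (le_iSup₂ (f := fun e (_ : e ∈ S) =>
          MeasurableSpace.comap (fun w : Weights => w e) inferInstance) e h) le_rfl
    · simp only [f, h, if_false]
      exact measurable_const
  have : A = f ⁻¹' A := by
    ext w
    exact ⟨hdep _ _ fun e he => by simp [f, he], hdep _ _ fun e he => by simp [f, he]⟩
  rw [this]
  exact hf hA

/-- Events that depend on the weights of disjoint sets of edges are independent. -/
lemma gridMeasure_inter {S T : Set (ℕ × ℤ × Bool)} (hST : Disjoint S T) {A B : Set Weights}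
    (hA : MeasurableSet A) (hB : MeasurableSet B) (hAS : DependsOnEdges S A)
    (hBT : DependsOnEdges T B) : gridMeasure (A ∩ B) = gridMeasure A * gridMeasure B := by
  have hind : iIndepFun (fun e (w : Weights) => w e) gridMeasure :=
    iIndepFun_infinitePi (X := fun _ x => x) fun _ => measurable_id
  exact (Indep_iff _ _ _).1
    (indep_iSup_of_disjoint (fun e => (measurable_pi_apply e).comap_le) hind hST) A B
    (measurableSet_iSup_comap_of_dependsOnEdges hA hAS)
    (measurableSet_iSup_comap_of_dependsOnEdges hB hBT)

lemma measurableSet_pi_killSet (n K : ℕ) (C : ℝ) (e : ℕ × ℤ × Bool) :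
    MeasurableSet (killSet n K C e) := by
  unfold killSet
  split_ifs
  exacts [measurableSet_Iic, measurableSet_Ioi]

lemma gridMeasure_inter_pi {n : ℕ} {A : Set Weights} (hA : MeasurableSet A)
    (hdep : DependsOnEdges {e | e.1 < n} A) (s : Finset (ℕ × ℤ × Bool)) (hs : ∀ e ∈ s, n ≤ e.1)
    {t : ℕ × ℤ × Bool → Set ℝ} (ht : ∀ e, MeasurableSet (t e)) :
    gridMeasure (A ∩ (s : Set (ℕ × ℤ × Bool)).pi t)
      = gridMeasure A * ∏ e ∈ s, levelExp (e.1 + 1) (t e) := by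
  have hdisj : Disjoint {e : ℕ × ℤ × Bool | e.1 < n} (s : Set (ℕ × ℤ × Bool)) :=
    Set.disjoint_left.2 fun e h1 h2 => absurd (hs e h2) (not_le.2 h1)
  rw [gridMeasure_inter hdisj hA (.pi s.countable_toSet fun e _ => ht e) hdep
    (fun w w' h hw e he => h e he ▸ hw e he), gridMeasure, Measure.infinitePi_pi _ fun e _ => ht e]

/-- A uniform lower bound for the probability of the weights in a kill box. -/
lemma exists_le_prod_killSet (K : ℕ) {C : ℝ} (hC : 0 ≤ C) :
    ∃ c : ℝ, 0 < c ∧ ∀ n, ENNReal.ofReal c ≤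
      ∏ e ∈ killBox n K, levelExp (e.1 + 1) (killSet n K C e) := by
  -- The mean of a weight in the box lies between 2^n and 2^(n+K). So `a` bounds the probability of
  -- a fast edge from below and `b` that of a slow edge, whatever `n` is.
  set a : ℝ := 1 - Real.exp (-(((2 : ℝ) ^ K)⁻¹)) with ha
  set b : ℝ := Real.exp (-(C + K + 1)) with hb
  have ha0 : 0 < a := by
    rw [ha, sub_pos, Real.exp_lt_one_iff]
    simp
  have hb0 : 0 < b := Real.exp_pos _
  refine ⟨min a b ^ (K * ((K + 2) * 2)), by positivity, fun n => ?_⟩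
  rw [ENNReal.ofReal_pow (le_min ha0.le hb0.le), ← card_killBox n K]
  refine Finset.pow_card_le_prod _ _ _ fun e he => ?_
  have hen : n ≤ e.1 ∧ e.1 + 1 ≤ n + K := by
    simp only [killBox, Finset.mem_product, Finset.mem_Ico] at he
    omega
  have h2 : (2 : ℝ) ^ n ≤ 2 ^ (e.1 + 1) := pow_le_pow_right₀ one_le_two (by omega)
  have h3 : (2 : ℝ) ^ (e.1 + 1) ≤ 2 ^ n * 2 ^ K := by
    rw [← pow_add]
    exact pow_le_pow_right₀ one_le_two (by omega)
  have hp : (0 : ℝ) < 2 ^ (e.1 + 1) := by positivity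
  have hn : (0 : ℝ) < 2 ^ n := by positivity
  unfold killSet
  split_ifs
  · rw [levelExp, expMeasure_Iic (by positivity) (by positivity)]
    refine ENNReal.ofReal_le_ofReal ((min_le_left _ _).trans ?_)
    rw [ha]
    gcongr
    rw [inv_mul_eq_div, inv_eq_one_div, div_le_div_iff₀ (by positivity) hp]
    linarith
  · rw [levelExp, expMeasure_Ioi (by positivity) (by positivity)]
    refine ENNReal.ofReal_le_ofReal ((min_le_right _ _).trans ?_)
    rw [hb]
    gcongr
    rw [inv_mul_eq_div, div_le_iff₀ hp]
    gcongr

/-- The path that always goes right is a competitor whose expected length is at most 2·2^n; then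
Markov's inequality. -/
lemma gridMeasure_gridDist_gt (n : ℕ) (i : ℤ) {C : ℝ} (hC : 0 < C) :
    gridMeasure.real {w | C * 2 ^ n < gridDist w n i} ≤ 2 / C := by
  have hmean : ∫⁻ w, ENNReal.ofReal (gridDist w n i) ∂gridMeasure ≤ ENNReal.ofReal (2 * 2 ^ n) := by
    calc ∫⁻ w, ENNReal.ofReal (gridDist w n i) ∂gridMeasure
        ≤ ∫⁻ w, ∑ m ∈ Finset.range n, ENNReal.ofReal (w (m, i, true)) ∂gridMeasure := by
          refine lintegral_mono_ae (ae_pos_gridMeasure.mono fun w hw => ?_)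
          rw [← ENNReal.ofReal_sum_of_nonneg fun m _ => (hw _).le]
          exact ENNReal.ofReal_le_ofReal (gridDist_le_sum w n i)
      _ = ∑ m ∈ Finset.range n, ENNReal.ofReal (2 ^ (m + 1)) := by
          rw [lintegral_finsetSum _ fun m _ => by fun_prop]
          refine Finset.sum_congr rfl fun m _ => ?_
          have := (measurePreserving_eval_gridMeasure (m, i, true)).lintegral_comp
            ENNReal.measurable_ofReal
          rw [this, levelExp, lintegral_ofReal_expMeasure (by positivity), inv_inv]
      _ ≤ ENNReal.ofReal (2 * 2 ^ n) := by
          rw [← ENNReal.ofReal_sum_of_nonneg fun m _ => by positivity]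
          refine ENNReal.ofReal_le_ofReal ?_
          have : ∀ n : ℕ, ∑ m ∈ Finset.range n, (2 : ℝ) ^ (m + 1) ≤ 2 * 2 ^ n - 2 := fun n => by
            induction n with
            | zero => simp
            | succ n ih => rw [Finset.sum_range_succ]; linarith [pow_succ (2 : ℝ) n, pow_succ (2 : ℝ) (n + 1)]
          linarith [this n]
  have hpos : (0 : ℝ) < C * 2 ^ n := by positivity
  have hmark := meas_ge_le_lintegral_div (μ := gridMeasure)
    (f := fun w => ENNReal.ofReal (gridDist w n i)) (by fun_prop)
    (ε := ENNReal.ofReal (C * 2 ^ n)) (by simpa using hpos) ENNReal.ofReal_ne_top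
  have hle : gridMeasure {w | C * 2 ^ n < gridDist w n i} ≤ ENNReal.ofReal (2 / C) := by
    calc gridMeasure {w | C * 2 ^ n < gridDist w n i}
        ≤ gridMeasure {w | ENNReal.ofReal (C * 2 ^ n) ≤ ENNReal.ofReal (gridDist w n i)} :=
          measure_mono fun w hw => ENNReal.ofReal_le_ofReal (le_of_lt hw)
      _ ≤ _ := hmark
      _ ≤ ENNReal.ofReal (2 * 2 ^ n) / ENNReal.ofReal (C * 2 ^ n) := by gcongr
      _ = ENNReal.ofReal (2 / C) := by
          rw [← ENNReal.ofReal_div_of_pos hpos]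
          congr 1
          field_simp
  exact ENNReal.toReal_le_of_le_ofReal (by positivity) hle

/-! ### Mass transport and decay of the survival probability -/

/-- Mass transport: summing over the positions of the left end of the tree of the root `0` amounts
to considering the tree whose left end is at a fixed position. -/
lemma gridMeasure_transport (n : ℕ) {G : Weights → ℤ → Prop}
    (hG : ∀ j, MeasurableSet {w | G w j})
    (hshift : ∀ a w j, G (shiftWeights a w) (j - a) ↔ G w j) :
    gridMeasure {w | (∃ i, gridLabel w n i = 0) ∧ G w 0}
      = gridMeasure {w | gridLabel w n (-1) ≠ gridLabel w n 0 ∧ G w (gridLabel w n 0)} := by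
  have hml : ∀ i j, MeasurableSet {w : Weights | gridLabel w n i = j} := fun i j =>
    measurable_gridLabel n i (measurableSet_singleton j)
  -- In `E i` the root is fixed and the left end of its tree is at `i`; in `D j` the left end is
  -- fixed at `0` and the root is `j`. Translation by `i` turns `E i` into `D (-i)`.
  let E : ℤ → Set Weights := fun i =>
    {w | gridLabel w n i = 0 ∧ gridLabel w n (i - 1) ≠ 0 ∧ G w 0}
  let D : ℤ → Set Weights := fun j =>
    {w | gridLabel w n 0 = j ∧ gridLabel w n (-1) ≠ j ∧ G w j}
  have hE : ∀ i, MeasurableSet (E i) := fun i =>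
    (hml _ _).inter ((hml _ _).compl.inter (hG _))
  have hD : ∀ i, MeasurableSet (D i) := fun i =>
    (hml _ _).inter ((hml _ _).compl.inter (hG _))
  have hED : ∀ i, E i = shiftWeights i ⁻¹' D (-i) := fun i => by
    ext w
    have hg : G (shiftWeights i w) (-i) ↔ G w 0 := by simpa using hshift i w 0
    have e1 : gridLabel w n i - i = -i ↔ gridLabel w n i = 0 := by omega
    have e2 : gridLabel w n (i - 1) - i = -i ↔ gridLabel w n (i - 1) = 0 := by omega
    simp only [E, D, Set.mem_ofPred_eq, Set.mem_preimage, gridLabel_shiftWeights, hg, zero_add,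
      neg_add_eq_sub, e1, e2, ne_eq]
  have h1 : {w | (∃ i, gridLabel w n i = 0) ∧ G w 0} = ⋃ i, E i := by
    ext w
    simp only [E, Set.mem_ofPred_eq, Set.mem_iUnion]
    constructor
    · rintro ⟨⟨i, hi⟩, hg⟩
      -- The cone bound on labels provides a leftmost vertex of the tree.
      have hbdd : ∃ b : ℤ, ∀ z : ℤ, gridLabel w n z = 0 → b ≤ z := ⟨-n, fun z hz => by
        have := gridLabel_le w n z
        omega⟩
      obtain ⟨l, hl, hmin⟩ := Int.exists_least_of_bdd hbdd ⟨i, hi⟩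
      exact ⟨l, hl, fun h => by have := hmin _ h; omega, hg⟩
    · rintro ⟨i, hi, -, hg⟩
      exact ⟨⟨i, hi⟩, hg⟩
  have h2 : {w | gridLabel w n (-1) ≠ gridLabel w n 0 ∧ G w (gridLabel w n 0)} = ⋃ j, D (-j) := by
    ext w
    simp only [D, Set.mem_ofPred_eq, Set.mem_iUnion]
    constructor
    · rintro ⟨hne, hg⟩
      exact ⟨-gridLabel w n 0, by simp, by simpa using hne, by simpa using hg⟩
    · rintro ⟨j, hj, hne, hg⟩
      rw [hj]
      exact ⟨hne, hg⟩
  rw [h1, h2, measure_iUnion _ hE, measure_iUnion _ fun j => hD _]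
  · exact tsum_congr fun i => by
      rw [hED, (measurePreserving_shiftWeights i).measure_preimage (hD _).nullMeasurableSet]
  · intro i j hij
    refine Set.disjoint_left.2 fun w hi hj => hij ?_
    have := hi.1.symm.trans hj.1
    omega
  · intro i j hij
    refine Set.disjoint_left.2 fun w hi hj => hij ?_
    rcases lt_trichotomy i j with h | h | h
    · have l1 := gridLabel_mono w n (show i ≤ j - 1 by omega)
      have l2 := gridLabel_mono w n (show j - 1 ≤ j by omega)
      exact absurd (le_antisymm (l2.trans hj.1.le) (hi.1.ge.trans l1)) hj.2.1
    · exact h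
    · have l1 := gridLabel_mono w n (show j ≤ i - 1 by omega)
      have l2 := gridLabel_mono w n (show i - 1 ≤ i by omega)
      exact absurd (le_antisymm (l2.trans hi.1.le) (hj.1.ge.trans l1)) hi.2.1

/-- Trees with more than `K` vertices at a level are rare. -/
lemma gridMeasure_wide_le (n K : ℕ) :
    gridMeasure.real {w | gridLabel w n (-1) ≠ gridLabel w n 0 ∧ gridLabel w n K = gridLabel w n 0}
      ≤ 1 / (K + 1) := by
  -- In `E k` a tree has its left end at `k` and contains `k + K`. Two such trees with left ends at
  -- most `K` apart would overlap, so `K + 1` consecutive events are disjoint, and they are equally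
  -- likely.
  set E : ℤ → Set Weights := fun k =>
    {w | gridLabel w n (k - 1) ≠ gridLabel w n k ∧ gridLabel w n (k + K) = gridLabel w n k} with hE
  have hm : ∀ k, MeasurableSet (E k) := fun k =>
    (measurableSet_eq_fun (measurable_gridLabel _ _) (measurable_gridLabel _ _)).compl.inter
      (measurableSet_eq_fun (measurable_gridLabel _ _) (measurable_gridLabel _ _))
  have hEk : ∀ k, E k = shiftWeights k ⁻¹' E 0 := fun k => by
    ext w
    simp only [hE, Set.mem_ofPred_eq, Set.mem_preimage, gridLabel_shiftWeights, sub_left_inj, ne_eq,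
      zero_add, zero_sub, neg_add_eq_sub, add_comm (K : ℤ)]
  have hmeas : ∀ k, gridMeasure.real (E k) = gridMeasure.real (E 0) := fun k => by
    rw [measureReal_def, hEk, (measurePreserving_shiftWeights k).measure_preimage
      (hm _).nullMeasurableSet, measureReal_def]
  have hdisj : ∀ k k' : ℤ, k < k' → k' ≤ k + K → Disjoint (E k) (E k') := fun k k' h h' => by
    refine Set.disjoint_left.2 fun w h1 h2 => h2.1 ?_
    have a1 := gridLabel_mono w n (show k ≤ k' - 1 by omega)
    have a2 := gridLabel_mono w n (show k' - 1 ≤ k' by omega)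
    have a3 := gridLabel_mono w n h'
    have := h1.2
    omega
  have hsum : gridMeasure.real (⋃ k ∈ Finset.range (K + 1), E k)
      = ∑ k ∈ Finset.range (K + 1), gridMeasure.real (E k) := by
    refine measureReal_biUnion_finset (fun i hi j hj hij => ?_) fun k _ => hm k
    simp only [Finset.coe_range, Set.mem_Iio] at hi hj
    rcases lt_or_gt_of_ne hij with h | h
    · exact hdisj _ _ (by omega) (by omega)
    · exact (hdisj _ _ (by omega) (by omega)).symm
  have h1 := measureReal_le_one (μ := gridMeasure) (s := ⋃ k ∈ Finset.range (K + 1), E k)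
  simp only [hsum, hmeas, Finset.sum_const, Finset.card_range, nsmul_eq_mul] at h1
  have h0 : {w | gridLabel w n (-1) ≠ gridLabel w n 0 ∧ gridLabel w n K = gridLabel w n 0} = E 0 := by
    simp [hE]
  rw [h0, le_div_iff₀ (by positivity)]
  push_cast at h1
  linarith

/-- The probability that the tree of a root reaches level `n`. -/
noncomputable def survival (n : ℕ) : ℝ := gridMeasure.real {w | ∃ i, gridLabel w n i = 0}

lemma measurableSet_survival (n : ℕ) : MeasurableSet {w : Weights | ∃ i, gridLabel w n i = 0} := by
  convert (measurableSet_extinct n 0).compl using 1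
  ext w
  simp [Extinct]

/-- Replaces a statement about a fixed root by one about a fixed position of level `n`, where the
weights above can be prescribed in a fixed box. -/
lemma survival_eq (n : ℕ) :
    survival n = gridMeasure.real {w | gridLabel w n (-1) ≠ gridLabel w n 0} := by
  have := gridMeasure_transport n (G := fun _ _ => True) (by simp) (by simp)
  simp only [and_true] at this
  rw [survival, measureReal_def, this, measureReal_def]

lemma survival_antitone : Antitone survival := fun _ _ hmn =>
  measureReal_mono (fun _ hw => exists_gridLabel_eq_of_le hmn hw) (measure_ne_top _ _)

/-- A positive fraction of the trees that reach level `n` does not reach level `n + K`. -/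
lemma survival_add_le (K : ℕ) {C : ℝ} (hC : 0 < C) : ∃ c : ℝ, 0 < c ∧ ∀ n,
    survival (n + K) + c * (survival n - 1 / (K + 1) - 2 * (2 / C)) ≤ survival n := by
  obtain ⟨c, hc, hprod⟩ := exists_le_prod_killSet K hC.le
  refine ⟨c, hc, fun n => ?_⟩
  let I : Set Weights := {w | gridLabel w n (-1) ≠ gridLabel w n 0}
  let W : Set Weights := {w | gridLabel w n (-1) ≠ gridLabel w n 0 ∧
    gridLabel w n K = gridLabel w n 0}
  let B : ℤ → Set Weights := fun i => {w | C * 2 ^ n < gridDist w n i}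
  -- The event on which the kill box works; it is decided below level `n`. What it lacks of `I` are
  -- wide trees, of probability at most 1/(K+1), and two distant neighbours, at most 2/C each.
  let A : Set Weights := {w | gridLabel w n (-1) ≠ gridLabel w n 0 ∧
    gridLabel w n K ≠ gridLabel w n 0 ∧ gridDist w n (-1) ≤ C * 2 ^ n ∧ gridDist w n K ≤ C * 2 ^ n}
  have hAm : MeasurableSet A :=
    (measurableSet_eq_fun (measurable_gridLabel _ _) (measurable_gridLabel _ _)).compl.inter
      ((measurableSet_eq_fun (measurable_gridLabel _ _) (measurable_gridLabel _ _)).compl.inter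
      ((measurableSet_le (measurable_gridDist _ _) measurable_const).inter
      (measurableSet_le (measurable_gridDist _ _) measurable_const)))
  have hAd : DependsOnEdges {e | e.1 < n} A := fun w w' h' hw => by
    have h : ∀ m < n, ∀ i b, w (m, i, b) = w' (m, i, b) := fun m hm i b => h' _ hm
    have h1 := gridLabel_congr h
    have h2 := gridDist_congr h
    simpa only [A, Set.mem_ofPred_eq, h1, h2] using hw
  have hIA : survival n - 1 / (K + 1) - 2 * (2 / C) ≤ gridMeasure.real A := by
    have hsub : I ⊆ A ∪ (W ∪ (B (-1) ∪ B K)) := fun w hw => by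
      simp only [A, W, B, Set.mem_union, Set.mem_ofPred_eq]
      have hw' : gridLabel w n (-1) ≠ gridLabel w n 0 := hw
      by_cases h1 : gridLabel w n K = gridLabel w n 0
      · exact .inr (.inl ⟨hw', h1⟩)
      · by_cases h2 : gridDist w n (-1) ≤ C * 2 ^ n
        · by_cases h3 : gridDist w n K ≤ C * 2 ^ n
          · exact .inl ⟨hw', h1, h2, h3⟩
          · exact .inr (.inr (.inr (not_le.1 h3)))
        · exact .inr (.inr (.inl (not_le.1 h2)))
    have t0 : gridMeasure.real I ≤ _ := measureReal_mono hsub (measure_ne_top _ _)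
    have t1 := measureReal_union_le (μ := gridMeasure) A (W ∪ (B (-1) ∪ B K))
    have t2 := measureReal_union_le (μ := gridMeasure) W (B (-1) ∪ B K)
    have t3 := measureReal_union_le (μ := gridMeasure) (B (-1)) (B K)
    have t4 : gridMeasure.real W ≤ _ := gridMeasure_wide_le n K
    have t5 : gridMeasure.real (B (-1)) ≤ _ := gridMeasure_gridDist_gt n (-1) hC
    have t6 : gridMeasure.real (B K) ≤ _ := gridMeasure_gridDist_gt n K hC
    rw [survival_eq]
    linarith
  let Q : Set Weights := {w | gridLabel w n (-1) ≠ gridLabel w n 0 ∧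
    Extinct w (n + K) (gridLabel w n 0)}
  -- The weights in the kill box lie above level `n`, hence are independent of `A`.
  have hQ : gridMeasure.real A * c ≤ gridMeasure.real Q := by
    have hle : gridMeasure (A ∩ (killBox n K : Set (ℕ × ℤ × Bool)).pi (killSet n K C))
        ≤ gridMeasure Q := by
      refine measure_mono_ae (ae_pos_gridMeasure.mono fun w hw hA => ?_)
      exact ⟨hA.1.1, extinct_of_kill (fun e => (hw e).le) hA.1.1 hA.1.2.1 hA.1.2.2.1 hA.1.2.2.2
        fun e he => hA.2 e he⟩
    rw [gridMeasure_inter_pi hAm hAd _ (fun e he => by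
      simp only [killBox, Finset.mem_product, Finset.mem_Ico] at he
      exact he.1.1) (measurableSet_pi_killSet n K C)] at hle
    have hle' := (mul_le_mul_right (hprod n) (gridMeasure A)).trans hle
    have := ENNReal.toReal_mono (measure_ne_top _ _) hle'
    rwa [ENNReal.toReal_mul, ENNReal.toReal_ofReal hc.le] at this
  -- Transport back to a fixed root: `Q` is as likely as the event that the tree of the root `0`
  -- reaches level `n` but not level `n + K`.
  have hQ' : gridMeasure.real Q = survival n - survival (n + K) := by
    have ht := gridMeasure_transport n (G := fun w j => Extinct w (n + K) j)
      (fun j => measurableSet_extinct _ j) (fun a w j => extinct_shiftWeights a w _ j)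
    rw [measureReal_def, ← ht, ← measureReal_def, survival, survival,
      ← measureReal_sdiff (s₁ := {w | ∃ i, gridLabel w n i = 0})
        (s₂ := {w | ∃ i, gridLabel w (n + K) i = 0})
        (fun w hw => exists_gridLabel_eq_of_le (Nat.le_add_right n K) hw)
        (measurableSet_survival _)]
    congr 1
    ext w
    simp [Extinct]
  nlinarith [mul_le_mul_of_nonneg_right hIA hc.le]

lemma tendsto_survival : Filter.Tendsto survival Filter.atTop (nhds 0) := by
  have hbdd : BddBelow (Set.range survival) := ⟨0, by
    rintro _ ⟨n, rfl⟩
    exact measureReal_nonneg⟩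
  have hlim := tendsto_atTop_ciInf survival_antitone hbdd
  set p := ⨅ n, survival n with hp
  have hp0 : 0 ≤ p := le_ciInf fun n => measureReal_nonneg
  rcases hp0.eq_or_lt with h | hpos
  · rwa [← h] at hlim
  exfalso
  -- With 1/(K+1) < p/4, and with C = 16/p so that 2·(2/C) = p/4, the bracket in `survival_add_le`
  -- remains at least p/4.
  obtain ⟨K, hK⟩ := exists_nat_one_div_lt (show 0 < p / 4 by positivity)
  obtain ⟨c, hc, hdrop⟩ := survival_add_le K (show 0 < 16 / p by positivity)
  have hdrop' : ∀ n, survival (n + K) + c * (p / 4) ≤ survival n := fun n => by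
    have h1 := hdrop n
    have h2 : p ≤ survival n := ciInf_le hbdd n
    have h3 : 2 / (16 / p) = p / 8 := by field_simp; norm_num
    rw [h3] at h1
    have h4 : p / 4 ≤ survival n - 1 / (K + 1) - 2 * (p / 8) := by linarith
    linarith [mul_le_mul_of_nonneg_left h4 hc.le]
  have hl := le_of_tendsto_of_tendsto' ((hlim.comp (Filter.tendsto_add_atTop_nat K)).add_const
    (c * (p / 4))) hlim hdrop'
  have : 0 < c * (p / 4) := by positivity
  linarith

/-- Almost surely no tree reaches all levels. -/
lemma ae_exists_extinct : ∀ᵐ w ∂gridMeasure, ∀ j, ∃ n, Extinct w n j := by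
  have h0 : ∀ᵐ w ∂gridMeasure, ∃ n, Extinct w n 0 := by
    rw [ae_iff]
    have hle : ∀ n, gridMeasure.real {w | ¬ ∃ n, Extinct w n 0} ≤ survival n := fun n =>
      measureReal_mono (fun w hw => by
        simp only [Extinct, Set.mem_ofPred_eq, not_exists, not_forall, not_not] at hw
        exact hw n) (measure_ne_top _ _)
    have h := ge_of_tendsto' tendsto_survival hle
    have := le_antisymm h measureReal_nonneg
    rwa [measureReal_def, ENNReal.toReal_eq_zero_iff, or_iff_left (measure_ne_top _ _)] at this
  refine ae_all_iff.2 fun j => ?_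
  filter_upwards [(measurePreserving_shiftWeights j).quasiMeasurePreserving.ae h0] with w hw
  obtain ⟨n, hn⟩ := hw
  exact ⟨n, (extinct_shiftWeights j w n j).1 (by simpa using hn)⟩

/-! ### Absence of ties -/

/-- There are almost surely no two geodesics with the same endpoint. -/
def NoTies (w : Weights) : Prop := ∀ n i,
  gridDist w n i + w (n, i, true) ≠ gridDist w n (i + 1) + w (n, i + 1, false)

/-- A tie prescribes the weight of the edge `(n, i, true)` in terms of weights independent of it;
the exponential law has no atoms, so Fubini gives probability zero. -/
lemma ae_noTies : ∀ᵐ w ∂gridMeasure, NoTies w := by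
  refine ae_all_iff.2 fun n => ae_all_iff.2 fun i => ?_
  let X : Weights → ℝ := fun w =>
    gridDist w n (i + 1) + w (n, i + 1, false) - gridDist w n i
  let Y : Weights → ℝ := fun w => w (n, i, true)
  have hX : Measurable X :=
    ((measurable_gridDist _ _).add (measurable_pi_apply _)).sub (measurable_gridDist _ _)
  have hY : Measurable Y := measurable_pi_apply _
  have hind : IndepFun X Y gridMeasure := by
    rw [indepFun_iff_measure_inter_preimage_eq_mul]
    intro s t hs ht
    refine gridMeasure_inter (S := {(n, i, true)}ᶜ) (T := {(n, i, true)}) disjoint_compl_left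
      (hX hs) (hY ht) (fun w w' h hw => ?_) fun w w' h hw => ?_
    · have h' : ∀ m < n, ∀ i b, w (m, i, b) = w' (m, i, b) := fun m hm j b => h _ (by
        simp only [Set.mem_compl_iff, Set.mem_singleton_iff, Prod.mk.injEq, not_and]
        omega)
      have : X w = X w' := by
        simp only [X, gridDist_congr h', h (n, i + 1, false) (by simp)]
      rwa [Set.mem_preimage, ← this]
    · have : Y w = Y w' := h _ rfl
      rwa [Set.mem_preimage, ← this]
  have hlaw : gridMeasure.map Y = levelExp (n + 1) :=
    (measurePreserving_eval_gridMeasure (n, i, true)).map_eq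
  have hdiag : (gridMeasure.map fun w => (X w, Y w)) {p | p.1 = p.2} = 0 := by
    rw [(indepFun_iff_map_prod_eq_prod_map_map hX.aemeasurable hY.aemeasurable).1 hind, hlaw,
      Measure.measure_prod_null (measurableSet_eq_fun measurable_fst measurable_snd)]
    refine Filter.Eventually.of_forall fun x => ?_
    have : Prod.mk x ⁻¹' {p : ℝ × ℝ | p.1 = p.2} = {x} := by
      ext y
      simp [eq_comm]
    simp only [this, Pi.zero_apply, measure_singleton]
  rw [Measure.map_apply (hX.prodMk hY) (measurableSet_eq_fun measurable_fst measurable_snd)] at hdiag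
  refine measure_mono_null (fun w hw => ?_) hdiag
  simp only [ne_eq, Set.mem_compl_iff, Set.mem_ofPred_eq, not_not] at hw
  simp only [X, Y, Set.mem_preimage, Set.mem_ofPred_eq]
  linarith

/-! ### The lattice and its grid coordinates -/

/-- The vertex with index `i` at height `n`. -/
def site (n : ℕ) (i : ℤ) : Site := ⟨(2 * i + n, n), by
  refine ⟨⟨i + n, by ring⟩, by positivity⟩⟩

lemma exists_eq_site (v : Site) : ∃ n i, v = site n i := by
  obtain ⟨⟨a, b⟩, ⟨c, hc⟩, hb⟩ := v
  lift b to ℕ using hb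
  refine ⟨b, c - b, Subtype.ext (Prod.ext ?_ rfl)⟩
  simp only [site] at hc ⊢
  omega

lemma site_inj {m n : ℕ} {i j : ℤ} : site m i = site n j ↔ m = n ∧ i = j := by
  refine ⟨fun h => ?_, by rintro ⟨rfl, rfl⟩; rfl⟩
  have h1 := congrArg (fun v : Site => v.1.1) h
  have h2 := congrArg (fun v : Site => v.1.2) h
  simp only [site] at h1 h2
  omega

lemma up_site_true (n : ℕ) (i : ℤ) : (site n i).up true = site (n + 1) i := by
  refine Subtype.ext (Prod.ext ?_ ?_) <;> simp [site, Site.up, add_assoc]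

lemma up_site_false (n : ℕ) (i : ℤ) : (site n i).up false = site (n + 1) (i - 1) := by
  refine Subtype.ext (Prod.ext ?_ ?_) <;> simp [site, Site.up]
  ring

/-- The index of the upper endpoint of an edge. -/
def stepIndex (i : ℤ) (b : Bool) : ℤ := if b then i else i - 1

lemma up_site (n : ℕ) (i : ℤ) (b : Bool) : (site n i).up b = site (n + 1) (stepIndex i b) := by
  cases b
  · exact up_site_false n i
  · exact up_site_true n i

@[simp]
lemma height_site (n : ℕ) (i : ℤ) : (site n i).height = n := rfl

/-- The root with index `i`. -/
def rootAt (i : ℤ) : Root := ⟨site 0 i, rfl⟩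

lemma rootAt_injective : Function.Injective rootAt := fun _ _ h =>
  (site_inj.1 (congrArg Subtype.val h)).2

lemma exists_eq_rootAt (x : Root) : ∃ i, x = rootAt i := by
  obtain ⟨v, hv⟩ := x
  obtain ⟨n, i, rfl⟩ := exists_eq_site v
  obtain rfl : n = 0 := by simpa using hv
  exact ⟨i, rfl⟩

/-- The edge with given coordinates. -/
def edgeAt (e : ℕ × ℤ × Bool) : Edge := (site e.1 e.2.1, e.2.2)

lemma edgeAt_injective : Function.Injective edgeAt := by
  rintro ⟨m, i, b⟩ ⟨n, j, c⟩ h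
  simp only [edgeAt, Prod.mk.injEq, site_inj] at h
  obtain ⟨⟨rfl, rfl⟩, rfl⟩ := h
  rfl

lemma exists_eq_edgeAt (e : Edge) : ∃ n i b, e = edgeAt (n, i, b) := by
  obtain ⟨v, b⟩ := e
  obtain ⟨n, i, rfl⟩ := exists_eq_site v
  exact ⟨n, i, b, rfl⟩

lemma src_edgeAt (n : ℕ) (i : ℤ) (b : Bool) : Edge.src (edgeAt (n, i, b)) = site n i := rfl

lemma tgt_edgeAt (n : ℕ) (i : ℤ) (b : Bool) :
    Edge.tgt (edgeAt (n, i, b)) = site (n + 1) (stepIndex i b) := up_site n i b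

lemma height_edgeAt (n : ℕ) (i : ℤ) (b : Bool) : Edge.height (edgeAt (n, i, b)) = n + 1 := by
  rw [Edge.height, src_edgeAt, tgt_edgeAt, height_site, height_site]
  push_cast
  omega

/-- The height of an edge is that of its upper endpoint, which explains the exponent `e.1 + 1` in
`gridMeasure`. -/
lemma IsFPP.map_eq_gridMeasure {Ω : Type*} [MeasurableSpace Ω] {P : Measure Ω}
    {ω : Edge → Ω → ℝ} (h : IsFPP P ω) :
    P.map (fun w e => ω (edgeAt e) w) = gridMeasure := by
  have hind : iIndepFun (fun e => ω (edgeAt e)) P := h.indep.precomp edgeAt_injective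
  rw [hind.map_fun_eq_infinitePi_map fun e => h.measurable _, gridMeasure]
  congr 1
  ext1 ⟨n, i, b⟩
  rw [h.law, height_edgeAt, levelExp, zpow_neg]
  norm_cast

/-! ### Monotone paths -/

lemma IsPath.append {x y : Site} {γ : List Edge} (h : IsPath x y γ) (e : Edge)
    (he : Edge.src e = y) : IsPath x (Edge.tgt e) (γ ++ [e]) := by
  induction h with
  | nil x =>
    subst he
    exact .cons e (.nil _)
  | cons e' _ ih => exact .cons e' (ih he)

lemma pathLength_nil (ω : Edge → ℝ) : pathLength ω [] = 0 := rfl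

lemma pathLength_cons (ω : Edge → ℝ) (e : Edge) (γ : List Edge) :
    pathLength ω (e :: γ) = ω e + pathLength ω γ := by simp [pathLength]

lemma pathLength_append_singleton (ω : Edge → ℝ) (γ : List Edge) (e : Edge) :
    pathLength ω (γ ++ [e]) = pathLength ω γ + ω e := by simp [pathLength]

/-- The weights `ω` in grid coordinates. -/
def gridWeights (ω : Edge → ℝ) : Weights := fun e => ω (edgeAt e)

lemma exists_geodesic (ω : Edge → ℝ) (n : ℕ) (i : ℤ) : ∃ j γ,
    IsPath (site 0 j) (site n i) γ ∧ pathLength ω γ = gridDist (gridWeights ω) n i := by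
  induction n generalizing i with
  | zero => exact ⟨i, [], .nil _, rfl⟩
  | succ n ih =>
    rcases min_choice (gridDist (gridWeights ω) n i + gridWeights ω (n, i, true))
      (gridDist (gridWeights ω) n (i + 1) + gridWeights ω (n, i + 1, false)) with h | h
    · obtain ⟨j, γ, hγ, hl⟩ := ih i
      refine ⟨j, γ ++ [edgeAt (n, i, true)], ?_, ?_⟩
      · have := hγ.append (edgeAt (n, i, true)) rfl
        rwa [tgt_edgeAt] at this
      · rw [pathLength_append_singleton, hl, gridDist, h, gridWeights]
    · obtain ⟨j, γ, hγ, hl⟩ := ih (i + 1)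
      refine ⟨j, γ ++ [edgeAt (n, i + 1, false)], ?_, ?_⟩
      · have := hγ.append (edgeAt (n, i + 1, false)) rfl
        rwa [tgt_edgeAt, show stepIndex (i + 1) false = i by simp [stepIndex]] at this
      · rw [pathLength_append_singleton, hl, gridDist, h, gridWeights]

lemma gridDist_step_le (w : Weights) (n : ℕ) (i : ℤ) (b : Bool) :
    gridDist w (n + 1) (stepIndex i b) ≤ gridDist w n i + w (n, i, b) := by
  cases b
  · have := gridDist_succ_le_right w n (i - 1)
    rwa [sub_add_cancel] at this
  · exact gridDist_succ_le_left w n i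

/-- The hypothesis says that the edge is optimal. The recursion resolves ties in favour of the right
edge, so an optimal left edge passes on its label only if ties are excluded. -/
lemma gridLabel_step_of_le {w : Weights} (hw : NoTies w) {n : ℕ} {i : ℤ} {b : Bool}
    (h : gridDist w n i + w (n, i, b) ≤ gridDist w (n + 1) (stepIndex i b)) :
    gridLabel w (n + 1) (stepIndex i b) = gridLabel w n i := by
  cases b
  · have hs : stepIndex i false = i - 1 := rfl
    rw [hs] at h ⊢
    have hr : ¬ RightWins w n (i - 1) := fun hr => by
      have h1 := hw n (i - 1)
      have h2 := gridDist_succ_le_left w n (i - 1)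
      rw [RightWins] at hr
      rw [sub_add_cancel] at hr h1
      exact h1 (le_antisymm hr (h.trans h2))
    rw [gridLabel_succ_of_not_rightWins hr, sub_add_cancel]
  · exact gridLabel_succ_of_rightWins (h.trans (gridDist_succ_le_right w n i))

lemma gridDist_le_of_isPath {ω : Edge → ℝ} {x y : Site} {γ : List Edge} (h : IsPath x y γ)
    {m n : ℕ} {i j : ℤ} (hx : x = site m j) (hy : y = site n i) :
    gridDist (gridWeights ω) n i ≤ gridDist (gridWeights ω) m j + pathLength ω γ := by
  induction h generalizing m j with
  | nil x =>
    obtain ⟨rfl, rfl⟩ := site_inj.1 (hx.symm.trans hy)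
    simp [pathLength_nil]
  | cons e h ih =>
    obtain ⟨m', j', b, rfl⟩ := exists_eq_edgeAt e
    rw [src_edgeAt, site_inj] at hx
    obtain ⟨rfl, rfl⟩ := hx
    have h1 := ih (tgt_edgeAt _ _ _) hy
    have h2 := gridDist_step_le (gridWeights ω) m' j' b
    rw [pathLength_cons]
    simp only [gridWeights] at h1 h2 ⊢
    linarith

/-- Equality in `gridDist_le_of_isPath` forces equality in every step, so each edge of the path is
optimal and the label is handed on. -/
lemma gridLabel_eq_of_isPath {ω : Edge → ℝ} (hω : NoTies (gridWeights ω)) {x y : Site}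
    {γ : List Edge} (h : IsPath x y γ) {m n : ℕ} {i j : ℤ} (hx : x = site m j) (hy : y = site n i)
    (hle : gridDist (gridWeights ω) m j + pathLength ω γ ≤ gridDist (gridWeights ω) n i) :
    gridLabel (gridWeights ω) m j = gridLabel (gridWeights ω) n i := by
  induction h generalizing m j with
  | nil x =>
    obtain ⟨rfl, rfl⟩ := site_inj.1 (hx.symm.trans hy)
    rfl
  | cons e h ih =>
    obtain ⟨m', j', b, rfl⟩ := exists_eq_edgeAt e
    rw [src_edgeAt, site_inj] at hx
    obtain ⟨rfl, rfl⟩ := hx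
    have h1 := gridDist_le_of_isPath (ω := ω) h (tgt_edgeAt _ _ _) hy
    have h2 := gridDist_step_le (gridWeights ω) m' j' b
    rw [pathLength_cons] at hle
    have h3 : gridWeights ω (m', j', b) = ω (edgeAt (m', j', b)) := rfl
    rw [← ih (tgt_edgeAt _ _ _) hy (by linarith)]
    exact (gridLabel_step_of_le hω (by linarith)).symm

/-- The vertices on a monotone path from a root lie in a cone. -/
lemma exists_mem_cone_of_isPath {x y : Site} {γ : List Edge} (h : IsPath x y γ) {m : ℕ} {j : ℤ}
    (hx : x = site m j) : (∃ n i, y = site n i ∧ m ≤ n) ∧ ∀ e ∈ γ, ∃ k i b, e = edgeAt (k, i, b) ∧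
      (∃ n i', y = site n i' ∧ k < n) ∧ i ≤ j ∧ j - (k - m : ℤ) ≤ i := by
  induction h generalizing m j with
  | nil x => exact ⟨⟨m, j, hx, le_rfl⟩, by simp⟩
  | @cons e y γ h ih =>
    obtain ⟨m', j', b, rfl⟩ := exists_eq_edgeAt e
    rw [src_edgeAt, site_inj] at hx
    obtain ⟨rfl, rfl⟩ := hx
    obtain ⟨⟨n, i, hy, hn⟩, h2⟩ := ih (tgt_edgeAt _ _ _)
    refine ⟨⟨n, i, hy, by omega⟩, fun e he => ?_⟩
    rcases List.mem_cons.1 he with rfl | he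
    · exact ⟨m', j', b, rfl, ⟨n, i, hy, hn⟩, le_rfl, by omega⟩
    · obtain ⟨k, i, b', rfl, hk, hi1, hi2⟩ := h2 e he
      have hs : stepIndex j' b = j' ∨ stepIndex j' b = j' - 1 := by cases b <;> simp [stepIndex]
      exact ⟨k, i, b', rfl, hk, by omega, by push_cast at hi2; omega⟩

/-- This inequality suffices: a path that realizes `distBoundary` is then at most as long as
`gridDist`, which is what `gridLabel_eq_of_isPath` asks for. -/
lemma distBoundary_le_gridDist (ω : Edge → ℝ) (n : ℕ) (i : ℤ) :
    distBoundary ω (site n i) ≤ (gridDist (gridWeights ω) n i : EReal) := by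
  obtain ⟨j, γ, hγ, hl⟩ := exists_geodesic ω n i
  rw [← hl]
  exact iInf_le_of_le (rootAt j) (iInf₂_le_of_le γ (.inr hγ) le_rfl)

lemma finite_treeVertices {E : Set Edge} (hE : E.Finite) (x : Root) : (treeVertices x E).Finite := by
  have : treeVertices x E = {x.1} ∪ (Edge.src '' E ∪ Edge.tgt '' E) := by
    ext v
    simp only [treeVertices, Set.mem_ofPred_eq, Set.mem_union, Set.mem_singleton_iff, Set.mem_image]
    grind
  rw [this]
  exact (Set.finite_singleton _).union ((hE.image _).union (hE.image _))

/-- There are finitely many edges in a bounded part of the cone above a root. -/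
lemma finite_of_forall_mem_cone {E : Set Edge} {N : ℕ} {j : ℤ}
    (h : ∀ e ∈ E, ∃ k i b, e = edgeAt (k, i, b) ∧ k < N ∧ i ≤ j ∧ j - k ≤ i) : E.Finite := by
  refine ((Finset.range N ×ˢ Finset.Icc (j - N) j ×ˢ Finset.univ).finite_toSet.image edgeAt).subset ?_
  intro e he
  obtain ⟨k, i, b, rfl, hk, h1, h2⟩ := h e he
  refine ⟨(k, i, b), ?_, rfl⟩
  simp only [Finset.coe_product, Set.mem_prod, Finset.coe_range, Set.mem_Iio, Finset.coe_Icc,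
    Set.mem_Icc, Finset.coe_univ, Set.mem_univ, and_true]
  omega

/-- The endpoint of a geodesic from `j` carries the label `j`, hence lies below level `N`; the cone
above `j` contains finitely many edges below that level. -/
lemma finite_geodesicTree {ω : Edge → ℝ} (hω : NoTies (gridWeights ω)) {N : ℕ} {j : ℤ}
    (hN : Extinct (gridWeights ω) N j) : (geodesicTree ω (rootAt j)).Finite := by
  refine finite_of_forall_mem_cone (N := N) (j := j) fun e he => ?_
  obtain ⟨y, γ, hγ, hl, heγ⟩ := he
  obtain ⟨k, i, b, rfl, ⟨n, i', rfl, hk⟩, h1, h2⟩ :=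
    (exists_mem_cone_of_isPath hγ (m := 0) (j := j) rfl).2 e heγ
  refine ⟨k, i, b, rfl, ?_, h1, by simpa using h2⟩
  have hd := distBoundary_le_gridDist ω n i'
  rw [← hl, EReal.coe_le_coe_iff] at hd
  have hlab := gridLabel_eq_of_isPath hω hγ (m := 0) (j := j) rfl rfl (by simpa [gridDist] using hd)
  by_contra hcon
  exact hN.mono (show N ≤ n by omega) i' hlab.symm

/-- All trees of first passage percolation are almost surely finite. -/
lemma IsFPP.ae_finite {Ω : Type*} [MeasurableSpace Ω] {P : Measure Ω} {ω : Edge → Ω → ℝ}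
    (h : IsFPP P ω) : ∀ᵐ w ∂P, ∀ x : Root,
      (treeVertices x (geodesicTree (fun e => ω e w) x)).Finite := by
  have hm : AEMeasurable (fun w e => ω (edgeAt e) w) P :=
    (measurable_pi_iff.2 fun e => h.measurable _).aemeasurable
  have h1 := ae_noTies
  have h2 := ae_exists_extinct
  rw [← h.map_eq_gridMeasure] at h1 h2
  filter_upwards [ae_of_ae_map hm h1, ae_of_ae_map hm h2] with w hw1 hw2 x
  obtain ⟨j, rfl⟩ := exists_eq_rootAt x
  obtain ⟨N, hN⟩ := hw2 j
  exact finite_treeVertices (finite_geodesicTree (ω := fun e => ω e w) hw1 hN) _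

/-! ### Sequences of independent identically distributed random variables -/

section Sequences

variable {X : Type*}

/-- The sequence `x, s 0, s 1, …`. -/
def consSeq (x : X) (s : ℕ → X) : ℕ → X
  | 0 => x
  | n + 1 => s n

/-- The sequence `s 1, s 2, …`. -/
def tailSeq (s : ℕ → X) : ℕ → X := fun n => s (n + 1)

@[simp] lemma consSeq_zero (x : X) (s : ℕ → X) : consSeq x s 0 = x := rfl
@[simp] lemma consSeq_succ (x : X) (s : ℕ → X) (n : ℕ) : consSeq x s (n + 1) = s n := rfl
@[simp] lemma tailSeq_consSeq (x : X) (s : ℕ → X) : tailSeq (consSeq x s) = s := rfl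

@[simp] lemma consSeq_tailSeq (s : ℕ → X) : consSeq (s 0) (tailSeq s) = s := by
  ext n
  cases n <;> rfl

end Sequences

section IID

variable {X Y : Type*} [MeasurableSpace X] [MeasurableSpace Y]

/-- The law of a family of independent random variables with distribution `ρ`. -/
noncomputable def iid (ι : Type*) (ρ : Measure X) : Measure (ι → X) :=
  Measure.infinitePi fun _ => ρ

instance (ι : Type*) (ρ : Measure X) [IsProbabilityMeasure ρ] : IsProbabilityMeasure (iid ι ρ) :=
  inferInstanceAs (IsProbabilityMeasure (Measure.infinitePi _))

lemma measurePreserving_eval_iid {ι : Type*} (ρ : Measure X) [IsProbabilityMeasure ρ] (i : ι) :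
    MeasurePreserving (fun f : ι → X => f i) (iid ι ρ) ρ :=
  measurePreserving_eval_infinitePi _ i

lemma iid_nat_box (ρ : Measure X) [IsProbabilityMeasure ρ] (n : ℕ) {t : ℕ → Set X}
    (ht : ∀ i, MeasurableSet (t i)) :
    iid ℕ ρ {f | ∀ k < n, f k ∈ t k} = ∏ k ∈ Finset.range n, ρ (t k) := by
  rw [← Measure.infinitePi_pi (fun _ : ℕ => ρ) fun i _ => ht i, iid]
  congr 1
  ext f
  simp

/-- Every finite set of coordinates extends to an initial segment, the additional factors being
`Set.univ`. -/
lemma eq_iid_nat {ρ : Measure X} [IsProbabilityMeasure ρ] {ν : Measure (ℕ → X)}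
    (h : ∀ (n : ℕ) (t : ℕ → Set X), (∀ i, MeasurableSet (t i)) →
      ν {f | ∀ k < n, f k ∈ t k} = ∏ k ∈ Finset.range n, ρ (t k)) : ν = iid ℕ ρ := by
  classical
  refine Measure.eq_infinitePi _ fun s t ht => ?_
  let t' : ℕ → Set X := fun k => if k ∈ s then t k else Set.univ
  have hs : ∀ k ∈ s, k < s.sup id + 1 := fun k hk => Nat.lt_succ_of_le (Finset.le_sup (f := id) hk)
  have h1 : Set.pi (s : Set ℕ) t = {f | ∀ k < s.sup id + 1, f k ∈ t' k} := by
    ext f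
    simp only [Set.mem_pi, Finset.mem_coe, Set.mem_ofPred_eq, t']
    constructor
    · intro hf k _
      split_ifs with hk
      exacts [hf k hk, trivial]
    · intro hf k hk
      simpa [hk] using hf k (hs k hk)
  rw [h1, h _ t' fun i => by simp only [t']; split_ifs; exacts [ht i, .univ]]
  have hsub : s ⊆ Finset.range (s.sup id + 1) := fun k hk => Finset.mem_range.2 (hs k hk)
  rw [← Finset.prod_subset hsub fun k _ hk => by simp [t', hk]]
  exact Finset.prod_congr rfl fun k hk => by simp [t', hk]

@[fun_prop]
lemma measurable_consSeq : Measurable fun p : X × (ℕ → X) => consSeq p.1 p.2 := by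
  refine measurable_pi_iff.2 fun n => ?_
  cases n with
  | zero => exact measurable_fst
  | succ n => exact (measurable_pi_apply n).comp measurable_snd

@[fun_prop]
lemma measurable_tailSeq : Measurable (tailSeq : (ℕ → X) → ℕ → X) :=
  measurable_pi_iff.2 fun n => measurable_pi_apply (n + 1)

lemma measurePreserving_consSeq (ρ : Measure X) [IsProbabilityMeasure ρ] :
    MeasurePreserving (fun p : X × (ℕ → X) => consSeq p.1 p.2) (ρ.prod (iid ℕ ρ)) (iid ℕ ρ) := by
  refine ⟨measurable_consSeq, eq_iid_nat fun n t ht => ?_⟩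
  have hbox : ∀ (n : ℕ) (t : ℕ → Set X), (∀ i, MeasurableSet (t i)) →
      MeasurableSet {f : ℕ → X | ∀ k < n, f k ∈ t k} := fun n t ht => by
    simp only [Set.ofPred_forall]
    exact .iInter fun k => .iInter fun _ => measurable_pi_apply k (ht k)
  rw [Measure.map_apply measurable_consSeq (hbox n t ht)]
  cases n with
  | zero => simp
  | succ n =>
    have : (fun p : X × (ℕ → X) => consSeq p.1 p.2) ⁻¹' {f | ∀ k < n + 1, f k ∈ t k}
        = t 0 ×ˢ {f | ∀ k < n, f k ∈ t (k + 1)} := by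
      ext p
      simp only [Set.mem_preimage, Set.mem_ofPred_eq, Set.mem_prod]
      constructor
      · exact fun h => ⟨h 0 (by omega), fun k hk => h (k + 1) (by omega)⟩
      · rintro ⟨h0, h⟩ (_ | k) hk
        exacts [h0, h k (by omega)]
    rw [this, Measure.prod_prod, iid_nat_box ρ n fun i => ht (i + 1), Finset.prod_range_succ',
      mul_comm]

lemma measurePreserving_headTail (ρ : Measure X) [IsProbabilityMeasure ρ] :
    MeasurePreserving (fun s : ℕ → X => (s 0, tailSeq s)) (iid ℕ ρ) (ρ.prod (iid ℕ ρ)) := by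
  refine ⟨by fun_prop, ?_⟩
  conv_lhs => rw [← (measurePreserving_consSeq ρ).map_eq, Measure.map_map (by fun_prop) measurable_consSeq]
  exact Measure.map_id

/-- A family of independent pairs with independent components is a pair of independent families. -/
lemma measurePreserving_unzip (ι : Type*) (μ : Measure X) (ν : Measure Y) [IsProbabilityMeasure μ]
    [IsProbabilityMeasure ν] :
    MeasurePreserving (fun f : ι → X × Y => ((fun i => (f i).1, fun i => (f i).2) : (ι → X) × (ι → Y)))
      (iid ι (μ.prod ν)) ((iid ι μ).prod (iid ι ν)) := by
  classical
  have hm : Measurable fun f : ι → X × Y =>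
      ((fun i => (f i).1, fun i => (f i).2) : (ι → X) × (ι → Y)) := by fun_prop
  refine ⟨hm, (Measure.prod_eq_generateFrom generateFrom_squareCylinders
    generateFrom_squareCylinders (isPiSystem_squareCylinders (fun _ => MeasurableSpace.isPiSystem_measurableSet)
      (by simp)) (isPiSystem_squareCylinders (fun _ => MeasurableSpace.isPiSystem_measurableSet)
      (by simp)) ⟨fun _ => Set.univ, fun _ => ⟨∅, fun _ => Set.univ, by simp, by simp⟩, by simp,
      Set.iUnion_const _⟩ ⟨fun _ => Set.univ, fun _ => ⟨∅, fun _ => Set.univ, by simp, by simp⟩,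
      by simp, Set.iUnion_const _⟩ ?_).symm⟩
  rintro _ ⟨S, u, hu, rfl⟩ _ ⟨T, v, hv, rfl⟩
  have hu' : ∀ i, MeasurableSet (u i) := fun i => hu i trivial
  have hv' : ∀ i, MeasurableSet (v i) := fun i => hv i trivial
  -- Padding with `Set.univ` puts both cylinders over the common index set `S ∪ T`.
  let u' : ι → Set X := fun i => if i ∈ S then u i else Set.univ
  let v' : ι → Set Y := fun i => if i ∈ T then v i else Set.univ
  have hum : ∀ i, MeasurableSet (u' i) := fun i => by
    simp only [u']; split_ifs; exacts [hu' i, .univ]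
  have hvm : ∀ i, MeasurableSet (v' i) := fun i => by
    simp only [v']; split_ifs; exacts [hv' i, .univ]
  have h1 : (S : Set ι).pi u = ((S ∪ T : Finset ι) : Set ι).pi u' := by
    ext f
    simp only [Set.mem_pi, u']
    exact ⟨fun h i _ => by split_ifs with hi; exacts [h i hi, trivial],
      fun h i hi => by simpa [Finset.mem_coe.1 hi] using h i (by simp [Finset.mem_coe.1 hi])⟩
  have h2 : (T : Set ι).pi v = ((S ∪ T : Finset ι) : Set ι).pi v' := by
    ext f
    simp only [Set.mem_pi, v']
    exact ⟨fun h i _ => by split_ifs with hi; exacts [h i hi, trivial],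
      fun h i hi => by simpa [Finset.mem_coe.1 hi] using h i (by simp [Finset.mem_coe.1 hi])⟩
  have hm1 : MeasurableSet (((S ∪ T : Finset ι) : Set ι).pi u') :=
    .pi (Finset.countable_toSet _) fun i _ => hum i
  have hm2 : MeasurableSet (((S ∪ T : Finset ι) : Set ι).pi v') :=
    .pi (Finset.countable_toSet _) fun i _ => hvm i
  rw [h1, h2, Measure.map_apply hm (hm1.prod hm2)]
  have h3 : (fun f : ι → X × Y => ((fun i => (f i).1, fun i => (f i).2) : (ι → X) × (ι → Y))) ⁻¹'
      ((((S ∪ T : Finset ι) : Set ι).pi u') ×ˢ (((S ∪ T : Finset ι) : Set ι).pi v'))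
      = ((S ∪ T : Finset ι) : Set ι).pi fun i => u' i ×ˢ v' i := by
    ext f
    simp only [Set.mem_preimage, Set.mem_prod, Set.mem_pi]
    exact ⟨fun h i hi => ⟨h.1 i hi, h.2 i hi⟩, fun h => ⟨fun i hi => (h i hi).1, fun i hi => (h i hi).2⟩⟩
  rw [h3]
  simp only [iid]
  rw [Measure.infinitePi_pi _ fun i _ => (hum i).prod (hvm i),
    Measure.infinitePi_pi _ fun i _ => hum i, Measure.infinitePi_pi _ fun i _ => hvm i,
    ← Finset.prod_mul_distrib]
  exact Finset.prod_congr rfl fun i _ => Measure.prod_prod _ _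

lemma measurePreserving_zip (ι : Type*) (μ : Measure X) (ν : Measure Y) [IsProbabilityMeasure μ]
    [IsProbabilityMeasure ν] :
    MeasurePreserving (fun (p : (ι → X) × (ι → Y)) i => (p.1 i, p.2 i))
      ((iid ι μ).prod (iid ι ν)) (iid ι (μ.prod ν)) := by
  have hm : Measurable fun (p : (ι → X) × (ι → Y)) i => (p.1 i, p.2 i) := by fun_prop
  refine ⟨hm, ?_⟩
  rw [← (measurePreserving_unzip ι μ ν).map_eq,
    Measure.map_map hm (measurePreserving_unzip ι μ ν).measurable]
  exact Measure.map_id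

lemma measurePreserving_iid_pi (ι : Type*) {μ : Measure X} {ν : Measure Y} [IsProbabilityMeasure μ]
    [IsProbabilityMeasure ν] {f : X → Y} (hf : MeasurePreserving f μ ν) :
    MeasurePreserving (fun (s : ι → X) i => f (s i)) (iid ι μ) (iid ι ν) := by
  refine ⟨measurable_pi_iff.2 fun i => hf.measurable.comp (measurable_pi_apply i), ?_⟩
  rw [iid, Measure.infinitePi_map_pi _ fun _ => hf.measurable, hf.map_eq, iid]

lemma measurePreserving_iid_comp {ι κ : Type*} (μ : Measure X) [IsProbabilityMeasure μ] {g : κ → ι}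
    (hg : Function.Injective g) :
    MeasurePreserving (fun (s : ι → X) k => s (g k)) (iid ι μ) (iid κ μ) :=
  ⟨measurable_pi_iff.2 fun _ => measurable_pi_apply _,
    Measure.map_infinitePi_infinitePi_of_inj (P := fun _ => μ) hg⟩

lemma measurePreserving_iid_uncurry (ι κ : Type*) (μ : Measure X) [IsProbabilityMeasure μ] :
    MeasurePreserving (fun (s : ι → κ → X) (p : ι × κ) => s p.1 p.2) (iid ι (iid κ μ))
      (iid (ι × κ) μ) :=
  ⟨by fun_prop, Measure.infinitePi_map_curry_symm fun _ _ => μ⟩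

lemma measurePreserving_iid_curry (ι κ : Type*) (μ : Measure X) [IsProbabilityMeasure μ] :
    MeasurePreserving (fun (s : ι × κ → X) i j => s (i, j)) (iid (ι × κ) μ) (iid ι (iid κ μ)) :=
  ⟨by fun_prop, Measure.infinitePi_map_curry fun _ _ => μ⟩

/-- Choosing one member of an iid family for each index, without repetition and depending on
independent randomness, gives an iid family. -/
lemma measurePreserving_iid_select {Z ι κ : Type*} [MeasurableSpace Z] [Countable ι]
    [MeasurableSpace ι] [MeasurableSingletonClass ι] (ν : Measure Z) [IsProbabilityMeasure ν]
    (μ : Measure X) [IsProbabilityMeasure μ] {g : Z → κ → ι} (hg : ∀ k, Measurable fun z => g z k)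
    (hinj : ∀ z, Function.Injective (g z)) :
    MeasurePreserving (fun (p : Z × (ι → X)) => (p.1, fun k => p.2 (g p.1 k)))
      (ν.prod (iid ι μ)) (ν.prod (iid κ μ)) := by
  -- For fixed `z` the selection is an injective reindexing, which preserves the iid law; the skew
  -- product glues these fibre maps together.
  refine MeasurePreserving.skew_product (f := id) (g := fun (z : Z) (s : ι → X) (k : κ) => s (g z k)) (.id ν) ?_
    (Filter.Eventually.of_forall fun z => (measurePreserving_iid_comp μ (hinj z)).map_eq)
  refine measurable_pi_iff.2 fun k => ?_
  have h1 : Measurable fun p : ι × (ι → X) => p.2 p.1 :=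
    measurable_from_prod_countable_right fun i => measurable_pi_apply i
  exact h1.comp (((hg k).comp measurable_fst).prodMk measurable_snd)

/-! ### Machines with independent outputs -/

/-- The outputs of a machine with internal state. -/
def outputs {S O : Type*} (f : S → O × S) (s : S) (k : ℕ) : O := (f ((fun s => (f s).2)^[k] s)).1

lemma outputs_zero {S O : Type*} (f : S → O × S) (s : S) : outputs f s 0 = (f s).1 := rfl

lemma outputs_succ {S O : Type*} (f : S → O × S) (s : S) (k : ℕ) :
    outputs f s (k + 1) = outputs f (f s).2 k := by
  simp only [outputs, Function.iterate_succ_apply]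

/-- If the output is independent of the new state, which has the same law as the old one, then
the outputs are independent and identically distributed. -/
lemma measurePreserving_outputs {S O : Type*} [MeasurableSpace S] [MeasurableSpace O]
    {σ : Measure S} [IsProbabilityMeasure σ] {o : Measure O} [IsProbabilityMeasure o]
    {f : S → O × S} (hf : MeasurePreserving f σ (o.prod σ)) :
    MeasurePreserving (outputs f) σ (iid ℕ o) := by
  have hm : Measurable (outputs f) := measurable_pi_iff.2 fun k =>
    (hf.measurable.comp ((hf.measurable.snd).iterate k)).fst
  have hbox : ∀ (n : ℕ) (t : ℕ → Set O), (∀ i, MeasurableSet (t i)) →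
      MeasurableSet {f : ℕ → O | ∀ k < n, f k ∈ t k} := fun n t ht => by
    simp only [Set.ofPred_forall]
    exact .iInter fun k => .iInter fun _ => measurable_pi_apply k (ht k)
  refine ⟨hm, eq_iid_nat fun n t ht => ?_⟩
  rw [Measure.map_apply hm (hbox n t ht)]
  induction n generalizing t with
  | zero => simp
  | succ n ih =>
    have : outputs f ⁻¹' {g | ∀ k < n + 1, g k ∈ t k}
        = f ⁻¹' (t 0 ×ˢ (outputs f ⁻¹' {g | ∀ k < n, g k ∈ t (k + 1)})) := by
      ext s
      simp only [Set.mem_preimage, Set.mem_ofPred_eq, Set.mem_prod]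
      constructor
      · exact fun h => ⟨h 0 (by omega), fun k hk => outputs_succ f s k ▸ h (k + 1) (by omega)⟩
      · rintro ⟨h0, h⟩ (_ | k) hk
        exacts [h0, outputs_succ f s k ▸ h k (by omega)]
    rw [this, hf.measure_preimage ((ht 0).prod (hm (hbox n _ fun i => ht (i + 1)))).nullMeasurableSet,
      Measure.prod_prod, ih _ fun i => ht (i + 1), Finset.prod_range_succ', mul_comm]

end IID

/-! ### Splitting a marked Poisson process -/

lemma lintegral_expMeasure {r : ℝ} {f : ℝ → ENNReal} (hf : Measurable f) :
    ∫⁻ x, f x ∂expMeasure r = ∫⁻ x, exponentialPDF r x * f x := by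
  rw [expMeasure_eq_withDensity, lintegral_withDensity_eq_lintegral_mul _ ?_ hf]
  · rfl
  · exact ENNReal.measurable_ofReal.comp (measurable_exponentialPDFReal r)

@[fun_prop]
lemma measurable_exponentialPDF (r : ℝ) : Measurable (exponentialPDF r) :=
  ENNReal.measurable_ofReal.comp (measurable_exponentialPDFReal r)

/-- Memorylessness at the level of densities: both sides are 2 r² exp(-2rx - rs). -/
lemma two_mul_exponentialPDF_mul {r : ℝ} (hr : 0 < r) {x s : ℝ} (hx : 0 ≤ x) (hs : 0 ≤ s) :
    2 * (exponentialPDF r x * exponentialPDF r (x + s))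
      = exponentialPDF (2 * r) x * exponentialPDF r s := by
  rw [exponentialPDF_of_nonneg hx, exponentialPDF_of_nonneg hx, exponentialPDF_of_nonneg hs,
    exponentialPDF_of_nonneg (add_nonneg hx hs), ← ENNReal.ofReal_mul (by positivity),
    ← ENNReal.ofReal_mul (by positivity), ← ENNReal.ofReal_ofNat 2,
    ← ENNReal.ofReal_mul (by positivity)]
  congr 1
  have : Real.exp (-(r * (x + s))) = Real.exp (-(r * x)) * Real.exp (-(r * s)) := by
    rw [← Real.exp_add]; ring_nf
  have h2 : Real.exp (-(2 * r * x)) = Real.exp (-(r * x)) * Real.exp (-(r * x)) := by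
    rw [← Real.exp_add]; ring_nf
  rw [this, h2]
  ring

/-- Substitution y = x + s on the half-plane y ≥ x: if the first of two clocks rings first, the
minimum has rate 2r and the remainder has rate r. -/
lemma lintegral_exp_add {r : ℝ} (hr : 0 < r) {φ : ℝ → ℝ → ENNReal}
    (hφ : Measurable (Function.uncurry φ)) :
    ∫⁻ x, ∫⁻ s, φ x (x + s) ∂expMeasure r ∂expMeasure (2 * r)
      = 2 * ∫⁻ x, ∫⁻ y in Set.Ici x, φ x y ∂expMeasure r ∂expMeasure r := by
  have hp := isProbabilityMeasure_expMeasure hr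
  have hp2 := isProbabilityMeasure_expMeasure (show 0 < 2 * r by positivity)
  have m1 : Measurable fun p : ℝ × ℝ => φ p.1 (p.1 + p.2) :=
    hφ.comp (measurable_fst.prodMk (measurable_fst.add measurable_snd))
  have m2 : Measurable fun p : ℝ × ℝ => (Set.Ici p.1).indicator (φ p.1) p.2 := by
    have : (fun p : ℝ × ℝ => (Set.Ici p.1).indicator (φ p.1) p.2)
        = {p : ℝ × ℝ | p.1 ≤ p.2}.indicator (Function.uncurry φ) := by
      ext p; simp [Set.indicator, Function.uncurry]
    rw [this]
    exact hφ.indicator (measurableSet_le measurable_fst measurable_snd)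
  have e1 : ∀ x, ∫⁻ y in Set.Ici x, φ x y ∂expMeasure r
      = ∫⁻ y, (Set.Ici x).indicator (φ x) y ∂expMeasure r := fun x =>
    (lintegral_indicator measurableSet_Ici _).symm
  simp only [e1]
  rw [← lintegral_const_mul _ m2.lintegral_prod_right', lintegral_expMeasure m1.lintegral_prod_right',
    lintegral_expMeasure (m2.lintegral_prod_right'.const_mul _)]
  refine lintegral_congr fun x => ?_
  rcases lt_or_ge x 0 with hx | hx
  · rw [exponentialPDF_of_neg hx, exponentialPDF_of_neg hx, zero_mul, zero_mul]
  have mx1 : Measurable fun s => φ x (x + s) := m1.comp measurable_prodMk_left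
  have mx2 : Measurable fun y => (Set.Ici x).indicator (φ x) y :=
    m2.comp measurable_prodMk_left
  rw [lintegral_expMeasure mx1, lintegral_expMeasure mx2,
    ← lintegral_add_left_eq_self (fun y => exponentialPDF r y * (Set.Ici x).indicator (φ x) y) x,
    ← lintegral_const_mul _ (by fun_prop), ← lintegral_const_mul _ (by fun_prop),
    ← lintegral_const_mul _ (by fun_prop)]
  refine lintegral_congr fun s => ?_
  rcases lt_or_ge s 0 with hs | hs
  · rw [exponentialPDF_of_neg hs, Set.indicator_of_notMem (by simpa using hs)]
    simp
  · rw [Set.indicator_of_mem (by simpa using hs), ← mul_assoc,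
      ← two_mul_exponentialPDF_mul hr hx hs]
    ring

/-- Memorylessness: the minimum of two exponential times, which of the two it is, and the remaining
waiting time for the other one are independent. -/
lemma lintegral_exp_exp {r : ℝ} (hr : 0 < r) {φ : ℝ → ℝ → ENNReal}
    (hφ : Measurable (Function.uncurry φ)) :
    2⁻¹ * (∫⁻ x, ∫⁻ s, φ x (x + s) ∂expMeasure r ∂expMeasure (2 * r)
      + ∫⁻ x, ∫⁻ s, φ (x + s) x ∂expMeasure r ∂expMeasure (2 * r))
      = ∫⁻ x, ∫⁻ y, φ x y ∂expMeasure r ∂expMeasure r := by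
  have hp := isProbabilityMeasure_expMeasure hr
  have hφ' : Measurable (Function.uncurry fun x y => φ y x) := hφ.comp measurable_swap
  rw [lintegral_exp_add hr hφ, lintegral_exp_add hr hφ', ← mul_add, ← mul_assoc,
    ENNReal.inv_mul_cancel two_ne_zero ENNReal.ofNat_ne_top, one_mul]
  have m2 : Measurable fun p : ℝ × ℝ => (Set.Ici p.1).indicator (φ p.1) p.2 := by
    have : (fun p : ℝ × ℝ => (Set.Ici p.1).indicator (φ p.1) p.2)
        = {p : ℝ × ℝ | p.1 ≤ p.2}.indicator (Function.uncurry φ) := by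
      ext p; simp [Set.indicator, Function.uncurry]
    rw [this]
    exact hφ.indicator (measurableSet_le measurable_fst measurable_snd)
  have m3 : Measurable fun p : ℝ × ℝ => (Set.Ioi p.1).indicator (fun y => φ y p.1) p.2 := by
    have : (fun p : ℝ × ℝ => (Set.Ioi p.1).indicator (fun y => φ y p.1) p.2)
        = {p : ℝ × ℝ | p.1 < p.2}.indicator (Function.uncurry fun x y => φ y x) := by
      ext p; simp [Set.indicator, Function.uncurry]
    rw [this]
    exact hφ'.indicator (measurableSet_lt measurable_fst measurable_snd)
  have e1 : ∀ x, ∫⁻ y in Set.Ici x, φ x y ∂expMeasure r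
      = ∫⁻ y, (Set.Ici x).indicator (φ x) y ∂expMeasure r := fun x =>
    (lintegral_indicator measurableSet_Ici _).symm
  -- The diagonal is a null set; removing it from one of the half-planes makes the two a partition
  -- of the plane.
  have e2 : ∀ x, ∫⁻ y in Set.Ici x, φ y x ∂expMeasure r
      = ∫⁻ y, (Set.Ioi x).indicator (fun y => φ y x) y ∂expMeasure r := fun x => by
    rw [lintegral_indicator measurableSet_Ioi]
    exact (setLIntegral_congr Ioi_ae_eq_Ici).symm
  simp only [e1, e2]
  rw [lintegral_lintegral_swap (f := fun x y => (Set.Ioi x).indicator (fun y => φ y x) y)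
    m3.aemeasurable, ← lintegral_add_left m2.lintegral_prod_right']
  refine lintegral_congr fun x => ?_
  have mx2 : Measurable fun y => (Set.Ici x).indicator (φ x) y :=
    m2.comp measurable_prodMk_left
  rw [← lintegral_add_left mx2]
  refine lintegral_congr fun y => ?_
  rcases le_or_gt x y with h | h
  · simp [Set.indicator, h, not_lt.2 h]
  · simp [Set.indicator, h, not_le.2 h]

/-- The law of a fair coin. -/
noncomputable def fairCoin : Measure Bool :=
  (2⁻¹ : ENNReal) • (Measure.dirac true + Measure.dirac false)

instance : IsProbabilityMeasure fairCoin := ⟨by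
  simp [fairCoin, ENNReal.inv_two_add_inv_two]⟩

lemma lintegral_fairCoin (f : Bool → ENNReal) :
    ∫⁻ b, f b ∂fairCoin = 2⁻¹ * (f true + f false) := by
  simp [fairCoin, lintegral_add_measure, mul_add]

/-! ### Superposition of two marked Poisson processes, point by point -/

section Split

variable {M : Type*}

/-- Delay all points of a marked point process, given by its waiting times and marks. -/
def delay (x : ℝ) (s : ℕ → ℝ × M) : ℕ → ℝ × M := consSeq (x + (s 0).1, (s 0).2) (tailSeq s)

/-- Undo one step of the superposition of two marked point processes. -/
def unstep (p : (ℝ × Bool × M) × ((ℕ → ℝ × M) × (ℕ → ℝ × M))) : (ℕ → ℝ × M) × (ℕ → ℝ × M) :=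
  if p.1.2.1 then (consSeq (p.1.1, p.1.2.2) p.2.1, delay p.1.1 p.2.2)
  else (delay p.1.1 p.2.1, consSeq (p.1.1, p.1.2.2) p.2.2)

/-- The first point of the superposition of two marked point processes, and what remains of them. -/
noncomputable def step (s : (ℕ → ℝ × M) × (ℕ → ℝ × M)) :
    (ℝ × Bool × M) × ((ℕ → ℝ × M) × (ℕ → ℝ × M)) :=
  if (s.1 0).1 ≤ (s.2 0).1 then
    (((s.1 0).1, true, (s.1 0).2), (tailSeq s.1, delay (-(s.1 0).1) s.2))
  else (((s.2 0).1, false, (s.2 0).2), (delay (-(s.2 0).1) s.1, tailSeq s.2))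

lemma delay_delay_neg (x : ℝ) (s : ℕ → ℝ × M) : delay x (delay (-x) s) = s := by
  simp [delay]

lemma delay_neg_delay (x : ℝ) (s : ℕ → ℝ × M) : delay (-x) (delay x s) = s := by
  simp [delay]

lemma delay_zero_fst (x : ℝ) (s : ℕ → ℝ × M) : (delay x s 0).1 = x + (s 0).1 := rfl

lemma unstep_step (s : (ℕ → ℝ × M) × (ℕ → ℝ × M)) : unstep (step s) = s := by
  unfold step
  split_ifs with h
  · simp [unstep, delay_delay_neg]
  · simp [unstep, delay_delay_neg]

lemma step_unstep {p : (ℝ × Bool × M) × ((ℕ → ℝ × M) × (ℕ → ℝ × M))} (h1 : 0 < (p.2.1 0).1)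
    (h2 : 0 < (p.2.2 0).1) : step (unstep p) = p := by
  obtain ⟨⟨x, b, μ⟩, A, B⟩ := p
  simp only at h1 h2
  cases b
  · have : ¬ (delay x A 0).1 ≤ x := by rw [delay_zero_fst]; linarith
    simp [unstep, step, this, delay_neg_delay]
  · have : x ≤ (delay x B 0).1 := by rw [delay_zero_fst]; linarith
    simp [unstep, step, this, delay_neg_delay]

variable [MeasurableSpace M]

lemma measurable_delay : Measurable fun p : ℝ × (ℕ → ℝ × M) => delay p.1 p.2 := by
  unfold delay
  exact measurable_consSeq.comp (by fun_prop :
    Measurable fun p : ℝ × (ℕ → ℝ × M) => ((p.1 + (p.2 0).1, (p.2 0).2), tailSeq p.2))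

lemma measurable_unstep : Measurable (unstep (M := M)) := by
  refine Measurable.ite (measurable_fst.snd.fst (measurableSet_singleton true)) ?_ ?_
  · exact (measurable_consSeq.comp (by fun_prop : Measurable
      fun p : (ℝ × Bool × M) × ((ℕ → ℝ × M) × (ℕ → ℝ × M)) => ((p.1.1, p.1.2.2), p.2.1))).prodMk
      (measurable_delay.comp (by fun_prop : Measurable
      fun p : (ℝ × Bool × M) × ((ℕ → ℝ × M) × (ℕ → ℝ × M)) => (p.1.1, p.2.2)))
  · exact (measurable_delay.comp (by fun_prop : Measurable
      fun p : (ℝ × Bool × M) × ((ℕ → ℝ × M) × (ℕ → ℝ × M)) => (p.1.1, p.2.1))).prodMk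
      (measurable_consSeq.comp (by fun_prop : Measurable
      fun p : (ℝ × Bool × M) × ((ℕ → ℝ × M) × (ℕ → ℝ × M)) => ((p.1.1, p.1.2.2), p.2.2)))

lemma measurable_step : Measurable (step (M := M)) := by
  have hS : MeasurableSet {s : (ℕ → ℝ × M) × (ℕ → ℝ × M) | (s.1 0).1 ≤ (s.2 0).1} :=
    measurableSet_le (by fun_prop) (by fun_prop)
  refine Measurable.ite hS ?_ ?_
  · exact Measurable.prodMk (by fun_prop) (Measurable.prodMk (by fun_prop)
      (measurable_delay.comp (by fun_prop : Measurable
        fun s : (ℕ → ℝ × M) × (ℕ → ℝ × M) => (-(s.1 0).1, s.2))))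
  · exact Measurable.prodMk (by fun_prop) (Measurable.prodMk (measurable_delay.comp (by fun_prop :
      Measurable fun s : (ℕ → ℝ × M) × (ℕ → ℝ × M) => (-(s.2 0).1, s.1))) (by fun_prop))

/-- The law of a marked Poisson process of rate `r`. -/
noncomputable def poissonLaw (r : ℝ) (ρ : Measure M) : Measure (ℕ → ℝ × M) :=
  iid ℕ ((expMeasure r).prod ρ)

instance (r : ℝ) (ρ : Measure M) [IsProbabilityMeasure (expMeasure r)] [IsProbabilityMeasure ρ] :
    IsProbabilityMeasure (poissonLaw r ρ) := inferInstanceAs (IsProbabilityMeasure (iid _ _))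

lemma lintegral_poissonLaw {r : ℝ} (hr : 0 < r) (ρ : Measure M) [IsProbabilityMeasure ρ]
    {f : (ℕ → ℝ × M) → ENNReal} (hf : Measurable f) :
    ∫⁻ s, f s ∂poissonLaw r ρ = ∫⁻ x, ∫⁻ z, f (consSeq (x, z.1) z.2)
      ∂(ρ.prod (poissonLaw r ρ)) ∂expMeasure r := by
  have hp := isProbabilityMeasure_expMeasure hr
  have hm : Measurable fun q : (ℝ × M) × (ℕ → ℝ × M) => f (consSeq q.1 q.2) :=
    hf.comp measurable_consSeq
  have hm' : Measurable fun q : ℝ × M × (ℕ → ℝ × M) => f (consSeq (q.1, q.2.1) q.2.2) :=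
    hm.comp (by fun_prop : Measurable fun q : ℝ × M × (ℕ → ℝ × M) => ((q.1, q.2.1), q.2.2))
  rw [← lintegral_prod _ hm'.aemeasurable, ← (measurePreserving_prodAssoc (expMeasure r) ρ
      (poissonLaw r ρ)).lintegral_comp hm']
  exact ((measurePreserving_consSeq ((expMeasure r).prod ρ)).lintegral_comp hf).symm

/-- Only the two first waiting times interact, and `lintegral_exp_exp` treats them. Marks and later
points are integrated out first, which leaves the function `φ` of two times. -/
lemma measurePreserving_unstep {r : ℝ} (hr : 0 < r) (ρ : Measure M) [IsProbabilityMeasure ρ] :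
    MeasurePreserving unstep
      (((expMeasure (2 * r)).prod (fairCoin.prod ρ)).prod ((poissonLaw r ρ).prod (poissonLaw r ρ)))
      ((poissonLaw r ρ).prod (poissonLaw r ρ)) := by
  have hp := isProbabilityMeasure_expMeasure hr
  have hp2 := isProbabilityMeasure_expMeasure (show 0 < 2 * r by positivity)
  refine ⟨measurable_unstep, Measure.ext_of_lintegral _ fun f hf => ?_⟩
  set Λ := poissonLaw r ρ with hΛ
  let κ : Measure (M × (ℕ → ℝ × M)) := ρ.prod Λ
  let Φ : ℝ → ℝ → (M × (ℕ → ℝ × M)) → (M × (ℕ → ℝ × M)) → ENNReal := fun x y z z' =>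
    f (consSeq (x, z.1) z.2, consSeq (y, z'.1) z'.2)
  have hΦ : Measurable fun p : (ℝ × ℝ) × (M × (ℕ → ℝ × M)) × (M × (ℕ → ℝ × M)) =>
      Φ p.1.1 p.1.2 p.2.1 p.2.2 :=
    hf.comp ((measurable_consSeq.comp (by fun_prop : Measurable
      fun p : (ℝ × ℝ) × (M × (ℕ → ℝ × M)) × (M × (ℕ → ℝ × M)) => ((p.1.1, p.2.1.1), p.2.1.2))).prodMk
      (measurable_consSeq.comp (by fun_prop : Measurable
      fun p : (ℝ × ℝ) × (M × (ℕ → ℝ × M)) × (M × (ℕ → ℝ × M)) => ((p.1.2, p.2.2.1), p.2.2.2))))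
  have hΦ' : Measurable fun q : (ℝ × ℝ) × (M × (ℕ → ℝ × M)) =>
      ∫⁻ z', Φ q.1.1 q.1.2 q.2 z' ∂κ :=
    Measurable.lintegral_prod_right' (f := fun q : ((ℝ × ℝ) × (M × (ℕ → ℝ × M))) ×
      (M × (ℕ → ℝ × M)) => Φ q.1.1.1 q.1.1.2 q.1.2 q.2) (hΦ.comp (by fun_prop : Measurable
      fun q : ((ℝ × ℝ) × (M × (ℕ → ℝ × M))) × (M × (ℕ → ℝ × M)) => (q.1.1, (q.1.2, q.2))))
  let φ : ℝ → ℝ → ENNReal := fun x y => ∫⁻ z, ∫⁻ z', Φ x y z z' ∂κ ∂κ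
  have hφ : Measurable (Function.uncurry φ) := hΦ'.lintegral_prod_right'
  have hcons : ∀ x, Measurable fun z : M × (ℕ → ℝ × M) => consSeq (x, z.1) z.2 := fun x =>
    measurable_consSeq.comp (by fun_prop : Measurable
      fun z : M × (ℕ → ℝ × M) => ((x, z.1), z.2))
  have hdel : ∀ x, Measurable fun s : ℕ → ℝ × M => delay x s := fun x =>
    measurable_delay.comp measurable_prodMk_left
  have hRHS : ∫⁻ s, f s ∂(Λ.prod Λ) = ∫⁻ x, ∫⁻ y, φ x y ∂expMeasure r ∂expMeasure r := by
    rw [lintegral_prod _ hf.aemeasurable, lintegral_poissonLaw hr ρ hf.lintegral_prod_right']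
    refine lintegral_congr fun x => ?_
    have hsw : Measurable (Function.uncurry fun (z : M × (ℕ → ℝ × M)) (y : ℝ) =>
        ∫⁻ z', Φ x y z z' ∂κ) := hΦ'.comp (by fun_prop : Measurable
      fun q : (M × (ℕ → ℝ × M)) × ℝ => ((x, q.2), q.1))
    rw [← lintegral_lintegral_swap hsw.aemeasurable]
    refine lintegral_congr fun z => ?_
    exact lintegral_poissonLaw hr ρ (hf.comp measurable_prodMk_left)
  have hfu : Measurable fun p => f (unstep p) := hf.comp measurable_unstep
  rw [lintegral_map hf measurable_unstep, hRHS, ← lintegral_exp_exp hr hφ,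
    lintegral_prod _ hfu.aemeasurable, lintegral_prod _ hfu.lintegral_prod_right'.aemeasurable]
  have htrue : ∀ x, ∫⁻ m, ∫⁻ s, f (unstep ((x, true, m), s)) ∂(Λ.prod Λ) ∂ρ
      = ∫⁻ y, φ x (x + y) ∂expMeasure r := fun x => by
    have hmz : Measurable fun p : (M × (ℕ → ℝ × M)) × (ℕ → ℝ × M) =>
        f (consSeq (x, p.1.1) p.1.2, delay x p.2) :=
      hf.comp (((hcons x).comp measurable_fst).prodMk ((hdel x).comp measurable_snd))
    have hsw : Measurable (Function.uncurry fun (z : M × (ℕ → ℝ × M)) (y : ℝ) =>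
        ∫⁻ z', Φ x (x + y) z z' ∂κ) := hΦ'.comp (by fun_prop : Measurable
      fun q : (M × (ℕ → ℝ × M)) × ℝ => ((x, x + q.2), q.1))
    calc ∫⁻ m, ∫⁻ s, f (unstep ((x, true, m), s)) ∂(Λ.prod Λ) ∂ρ
        = ∫⁻ m, ∫⁻ A, ∫⁻ B, f (consSeq (x, m) A, delay x B) ∂Λ ∂Λ ∂ρ :=
          lintegral_congr fun m => lintegral_prod _ (hfu.comp measurable_prodMk_left).aemeasurable
      _ = ∫⁻ z, ∫⁻ B, f (consSeq (x, z.1) z.2, delay x B) ∂Λ ∂κ :=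
          (lintegral_prod _ hmz.lintegral_prod_right'.aemeasurable).symm
      _ = ∫⁻ z, ∫⁻ y, ∫⁻ z', Φ x (x + y) z z' ∂κ ∂expMeasure r ∂κ :=
          lintegral_congr fun z => lintegral_poissonLaw hr ρ (hmz.comp measurable_prodMk_left)
      _ = _ := lintegral_lintegral_swap hsw.aemeasurable
  have hfalse : ∀ x, ∫⁻ m, ∫⁻ s, f (unstep ((x, false, m), s)) ∂(Λ.prod Λ) ∂ρ
      = ∫⁻ y, φ (x + y) x ∂expMeasure r := fun x => by
    have hmz : Measurable fun p : (ℕ → ℝ × M) × (M × (ℕ → ℝ × M)) =>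
        f (delay x p.1, consSeq (x, p.2.1) p.2.2) :=
      hf.comp (((hdel x).comp measurable_fst).prodMk ((hcons x).comp measurable_snd))
    have hsw : Measurable (Function.uncurry fun (m : M) (A : ℕ → ℝ × M) =>
        ∫⁻ B, f (delay x A, consSeq (x, m) B) ∂Λ) :=
      Measurable.lintegral_prod_right' (f := fun q : (M × (ℕ → ℝ × M)) × (ℕ → ℝ × M) =>
        f (delay x q.1.2, consSeq (x, q.1.1) q.2)) (hmz.comp (by fun_prop : Measurable
        fun q : (M × (ℕ → ℝ × M)) × (ℕ → ℝ × M) => (q.1.2, (q.1.1, q.2))))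
    calc ∫⁻ m, ∫⁻ s, f (unstep ((x, false, m), s)) ∂(Λ.prod Λ) ∂ρ
        = ∫⁻ m, ∫⁻ A, ∫⁻ B, f (delay x A, consSeq (x, m) B) ∂Λ ∂Λ ∂ρ :=
          lintegral_congr fun m => lintegral_prod _ (hfu.comp measurable_prodMk_left).aemeasurable
      _ = ∫⁻ A, ∫⁻ m, ∫⁻ B, f (delay x A, consSeq (x, m) B) ∂Λ ∂ρ ∂Λ :=
          lintegral_lintegral_swap hsw.aemeasurable
      _ = ∫⁻ A, ∫⁻ z', f (delay x A, consSeq (x, z'.1) z'.2) ∂κ ∂Λ :=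
          lintegral_congr fun A => (lintegral_prod _
            (hmz.comp measurable_prodMk_left).aemeasurable).symm
      _ = _ := lintegral_poissonLaw hr ρ hmz.lintegral_prod_right'
  have hx : ∀ x, ∫⁻ p, ∫⁻ s, f (unstep ((x, p), s)) ∂(Λ.prod Λ) ∂(fairCoin.prod ρ)
      = 2⁻¹ * (∫⁻ y, φ x (x + y) ∂expMeasure r + ∫⁻ y, φ (x + y) x ∂expMeasure r) := fun x => by
    have hm : Measurable fun p : Bool × M => ∫⁻ s, f (unstep ((x, p), s)) ∂(Λ.prod Λ) :=
      hfu.lintegral_prod_right'.comp measurable_prodMk_left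
    rw [lintegral_prod _ hm.aemeasurable,
      lintegral_fairCoin, htrue, hfalse]
  have hm1 : Measurable fun x => ∫⁻ y, φ x (x + y) ∂expMeasure r :=
    Measurable.lintegral_prod_right' (f := fun p : ℝ × ℝ => φ p.1 (p.1 + p.2))
      (hφ.comp (by fun_prop : Measurable fun p : ℝ × ℝ => (p.1, p.1 + p.2)))
  have hm2 : Measurable fun x => ∫⁻ y, φ (x + y) x ∂expMeasure r :=
    Measurable.lintegral_prod_right' (f := fun p : ℝ × ℝ => φ (p.1 + p.2) p.1)
      (hφ.comp (by fun_prop : Measurable fun p : ℝ × ℝ => (p.1 + p.2, p.1)))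
  simp only [hx]
  rw [← lintegral_add_left hm1, ← lintegral_const_mul _ (by exact hm1.add hm2)]

end Split

/-! ### Splitting a marked Poisson process -/

section Split

/-- The index of the first point with label `b`. -/
noncomputable def firstIdx {M : Type*} (b : Bool) (s : ℕ → ℝ × Bool × M) : ℕ :=
  sInf {k | (s k).2.1 = b}

/-- The waiting time for the first point with label `b`, and its mark. -/
noncomputable def splitHead {M : Type*} (b : Bool) (s : ℕ → ℝ × Bool × M) : ℝ × M :=
  (∑ i ∈ Finset.range (firstIdx b s + 1), (s i).1, (s (firstIdx b s)).2.2)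

/-- What follows after the first point with label `b`. -/
noncomputable def splitRest {M : Type*} (b : Bool) (s : ℕ → ℝ × Bool × M) : ℕ → ℝ × Bool × M :=
  fun k => s (k + (firstIdx b s + 1))

/-- The point process that consists of the points with label `b`. -/
noncomputable def splitOff {M : Type*} (b : Bool) : (ℕ → ℝ × Bool × M) → ℕ → ℝ × M :=
  outputs fun s => (splitHead b s, splitRest b s)

variable {M : Type*}

lemma firstIdx_spec {b : Bool} {s : ℕ → ℝ × Bool × M} (h : ∃ k, (s k).2.1 = b) :
    (s (firstIdx b s)).2.1 = b := Nat.sInf_mem (s := {k | (s k).2.1 = b}) h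

lemma firstIdx_le {b : Bool} {s : ℕ → ℝ × Bool × M} {k : ℕ} (h : (s k).2.1 = b) :
    firstIdx b s ≤ k := Nat.sInf_le (s := {k | (s k).2.1 = b}) h

lemma firstIdx_eq_zero {b : Bool} {s : ℕ → ℝ × Bool × M} (h : (s 0).2.1 = b) :
    firstIdx b s = 0 := Nat.le_zero.1 (firstIdx_le h)

lemma firstIdx_eq_succ {b : Bool} {s : ℕ → ℝ × Bool × M} (h0 : (s 0).2.1 ≠ b)
    (h : ∃ k, (s k).2.1 = b) : firstIdx b s = firstIdx b (tailSeq s) + 1 := by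
  have h' : ∃ k, (tailSeq s k).2.1 = b := by
    obtain ⟨k, hk⟩ := h
    cases k with
    | zero => exact absurd hk h0
    | succ k => exact ⟨k, hk⟩
  refine le_antisymm (firstIdx_le (firstIdx_spec h')) ?_
  have hs := firstIdx_spec h
  cases hf : firstIdx b s with
  | zero => rw [hf] at hs; exact absurd hs h0
  | succ k =>
    rw [hf] at hs
    exact Nat.succ_le_succ (firstIdx_le (s := tailSeq s) hs)

lemma splitOff_of_eq {b : Bool} {s : ℕ → ℝ × Bool × M} (h : (s 0).2.1 = b) :
    splitOff b s = consSeq ((s 0).1, (s 0).2.2) (splitOff b (tailSeq s)) := by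
  have h0 := firstIdx_eq_zero h
  have hr : splitRest b s = tailSeq s := by
    ext1 k
    simp [splitRest, h0, tailSeq]
  ext1 k
  cases k with
  | zero => simp [splitOff, outputs_zero, splitHead, h0]
  | succ k => rw [consSeq_succ, splitOff, outputs_succ, hr]

/-- The existence of a later point labelled `b` excludes the default value `0` of `firstIdx`, for
which the identity breaks down. -/
lemma splitOff_of_ne {b : Bool} {s : ℕ → ℝ × Bool × M} (h0 : (s 0).2.1 ≠ b)
    (h : ∃ k, (s k).2.1 = b) : splitOff b s = delay (s 0).1 (splitOff b (tailSeq s)) := by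
  have h1 := firstIdx_eq_succ h0 h
  have hr : splitRest b s = splitRest b (tailSeq s) := by
    ext1 k
    simp only [splitRest, h1, tailSeq]
    congr 1
  ext1 k
  cases k with
  | zero =>
    simp only [splitOff, outputs_zero, splitHead, h1, delay, consSeq_zero]
    rw [Finset.sum_range_succ', add_comm]
    rfl
  | succ k => rw [delay, consSeq_succ, splitOff, outputs_succ, hr, tailSeq, outputs_succ]

/-- Both labels occur infinitely often. -/
def BothLabels (s : ℕ → ℝ × Bool × M) : Prop := ∀ b n, ∃ k, (s (n + k)).2.1 = b

/-- A point process is determined by its superposition with another one. -/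
lemma eq_of_unstep {o : ℕ → ℝ × Bool × M} (ho : BothLabels o) {b : Bool}
    {A A' : ℕ → ℕ → ℝ × M}
    (h1 : ∀ n, (o n).2.1 = b → A n = consSeq ((o n).1, (o n).2.2) (A (n + 1)))
    (h2 : ∀ n, (o n).2.1 ≠ b → A n = delay (o n).1 (A (n + 1)))
    (h1' : ∀ n, (o n).2.1 = b → A' n = consSeq ((o n).1, (o n).2.2) (A' (n + 1)))
    (h2' : ∀ n, (o n).2.1 ≠ b → A' n = delay (o n).1 (A' (n + 1))) (n : ℕ) : A n = A' n := by
  -- Induction on the index `j` of the point and on the distance `g` to a label `b`. A delay alters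
  -- only the first waiting time, so the recursion can be followed upwards in `n` until a point
  -- labelled `b` fixes the value.
  have key : ∀ j n g, (o (n + g)).2.1 = b → A n j = A' n j := by
    intro j
    induction j with
    | zero =>
      intro n g
      induction g generalizing n with
      | zero => intro hg; rw [h1 n hg, h1' n hg]; rfl
      | succ g ih =>
        intro hg
        by_cases hn : (o n).2.1 = b
        · rw [h1 n hn, h1' n hn]; rfl
        · rw [h2 n hn, h2' n hn, delay, delay, consSeq_zero, consSeq_zero,
            ih (n + 1) (by rwa [add_assoc, add_comm 1])]
    | succ j ihj =>
      intro n g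
      induction g generalizing n with
      | zero =>
        intro hg
        obtain ⟨k, hk⟩ := ho b (n + 1)
        rw [h1 n hg, h1' n hg, consSeq_succ, consSeq_succ, ihj _ k hk]
      | succ g ih =>
        intro hg
        by_cases hn : (o n).2.1 = b
        · obtain ⟨k, hk⟩ := ho b (n + 1)
          rw [h1 n hn, h1' n hn, consSeq_succ, consSeq_succ, ihj _ k hk]
        · rw [h2 n hn, h2' n hn, delay, delay, consSeq_succ, consSeq_succ, tailSeq, tailSeq,
            ih (n + 1) (by rwa [add_assoc, add_comm 1])]
  ext1 j
  obtain ⟨k, hk⟩ := ho b n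
  exact key j n k hk

lemma splitOff_recursion {o : ℕ → ℝ × Bool × M} (ho : BothLabels o) (b : Bool) (n : ℕ) :
    ((o n).2.1 = b → splitOff b (fun k => o (k + n))
      = consSeq ((o n).1, (o n).2.2) (splitOff b (fun k => o (k + (n + 1))))) ∧
    ((o n).2.1 ≠ b → splitOff b (fun k => o (k + n))
      = delay (o n).1 (splitOff b (fun k => o (k + (n + 1))))) := by
  have ht : tailSeq (fun k => o (k + n)) = fun k => o (k + (n + 1)) := by
    ext1 k
    simp only [tailSeq]
    congr 1
    ring
  have h0 : o (0 + n) = o n := by rw [zero_add]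
  constructor
  · intro h
    rw [splitOff_of_eq (s := fun k => o (k + n)) (by rwa [h0]), ht, h0]
  · intro h
    obtain ⟨k, hk⟩ := ho b n
    rw [splitOff_of_ne (s := fun k => o (k + n)) (by rwa [h0]) ⟨k, by rwa [add_comm]⟩, ht, h0]

/-- Splitting the superposition of two point processes recovers them. -/
lemma splitOff_outputs_step {s : (ℕ → ℝ × M) × (ℕ → ℝ × M)} (ho : BothLabels (outputs step s)) :
    (splitOff true (outputs step s), splitOff false (outputs step s)) = s := by
  set o := outputs step s with hdef
  -- The successive states of the machine. As `unstep` undoes `step`, their components obey the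
  -- recursion that determines the split-off processes.
  let σ : ℕ → (ℕ → ℝ × M) × (ℕ → ℝ × M) := fun n => (fun s => (step s).2)^[n] s
  have hσ : ∀ n, σ n = unstep (o n, σ (n + 1)) := fun n => by
    have h1 : σ (n + 1) = (step (σ n)).2 := Function.iterate_succ_apply' _ _ _
    have h2 : o n = (step (σ n)).1 := rfl
    rw [h1, h2, Prod.mk.eta, unstep_step]
  refine Prod.ext ?_ ?_
  · refine (eq_of_unstep ho (A := fun n => (σ n).1) (b := true) ?_ ?_
      (fun n => (splitOff_recursion ho true n).1) (fun n => (splitOff_recursion ho true n).2) 0).symm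
    · intro n hn; simp [hσ n, unstep, hn]
    · intro n hn; simp [hσ n, unstep, hn]
  · refine (eq_of_unstep ho (A := fun n => (σ n).2) (b := false) ?_ ?_
      (fun n => (splitOff_recursion ho false n).1) (fun n => (splitOff_recursion ho false n).2) 0).symm
    · intro n hn; simp [hσ n, unstep, hn]
    · intro n hn
      rw [ne_eq, Bool.not_eq_false] at hn
      simp [hσ n, unstep, hn]

variable [MeasurableSpace M]

lemma measurable_firstIdx (b : Bool) : Measurable (firstIdx (M := M) b) := by
  have hA : ∀ k, MeasurableSet {s : ℕ → ℝ × Bool × M | (s k).2.1 = b} := fun k =>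
    (by fun_prop : Measurable fun s : ℕ → ℝ × Bool × M => (s k).2.1) (measurableSet_singleton b)
  refine measurable_of_Iic fun n => ?_
  -- The last set is due to `sInf ∅ = 0`: without any label `b` the index is zero.
  have : firstIdx (M := M) b ⁻¹' Set.Iic n = (⋃ k ∈ Set.Iic n, {s | (s k).2.1 = b}) ∪
      ⋂ k, {s | (s k).2.1 = b}ᶜ := by
    ext s
    simp only [Set.mem_preimage, Set.mem_Iic, Set.mem_union, Set.mem_iUnion, Set.mem_ofPred_eq,
      Set.mem_iInter, Set.mem_compl_iff, exists_prop]
    constructor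
    · intro h
      by_cases hex : ∃ k, (s k).2.1 = b
      · exact .inl ⟨_, h, firstIdx_spec hex⟩
      · exact .inr (not_exists.1 hex)
    · rintro (⟨k, hk, h⟩ | h)
      · exact (firstIdx_le h).trans hk
      · have : {k | (s k).2.1 = b} = ∅ := Set.eq_empty_of_forall_notMem h
        simp [firstIdx, this]
  rw [this]
  exact (MeasurableSet.biUnion (Set.to_countable _) fun k _ => hA k).union
    (.iInter fun k => (hA k).compl)

lemma measurable_splitOff (b : Bool) : Measurable (splitOff (M := M) b) := by
  have h1 : Measurable (splitHead (M := M) b) := by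
    have : Measurable fun p : ℕ × (ℕ → ℝ × Bool × M) =>
        ((∑ i ∈ Finset.range (p.1 + 1), (p.2 i).1, (p.2 p.1).2.2) : ℝ × M) :=
      measurable_from_prod_countable_right fun n =>
        (Finset.measurable_fun_sum (s := Finset.range (n + 1))
          (f := fun i (s : ℕ → ℝ × Bool × M) => (s i).1) fun i _ => by fun_prop).prodMk
          (by fun_prop : Measurable fun s : ℕ → ℝ × Bool × M => (s n).2.2)
    exact this.comp ((measurable_firstIdx b).prodMk measurable_id)
  have h2 : Measurable (splitRest (M := M) b) := by
    have : Measurable fun p : ℕ × (ℕ → ℝ × Bool × M) => fun k => p.2 (k + (p.1 + 1)) :=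
      measurable_from_prod_countable_right fun n => measurable_pi_iff.2 fun k =>
        measurable_pi_apply (k + (n + 1))
    exact this.comp ((measurable_firstIdx b).prodMk measurable_id)
  exact measurable_pi_iff.2 fun k => h1.comp (h2.iterate k)

/-- After index `n`, the next `m` entries all miss `A` with probability `ρ Aᶜ ^ m`, which tends to
zero. -/
lemma ae_frequently_iid {X : Type*} [MeasurableSpace X] (ρ : Measure X) [IsProbabilityMeasure ρ]
    {A : Set X} (hA : MeasurableSet A) (h : ρ A ≠ 0) : ∀ᵐ s ∂iid ℕ ρ, ∀ n, ∃ k, s (n + k) ∈ A := by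
  refine ae_all_iff.2 fun n => ?_
  rw [ae_iff]
  have hlt : ρ Aᶜ < 1 := by
    rw [prob_compl_eq_one_sub hA]
    exact ENNReal.sub_lt_self ENNReal.one_ne_top one_ne_zero h
  refine le_antisymm (ge_of_tendsto' (ENNReal.tendsto_pow_atTop_nhds_zero_of_lt_one hlt) fun m => ?_)
    zero_le
  let t : ℕ → Set X := fun k => if k < n then Set.univ else Aᶜ
  calc iid ℕ ρ {s | ¬ ∃ k, s (n + k) ∈ A} ≤ iid ℕ ρ {s | ∀ k < n + m, s k ∈ t k} := by
        refine measure_mono fun s hs k _ => ?_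
        simp only [t]
        split_ifs with hk
        · trivial
        · intro hmem
          exact hs ⟨k - n, by rwa [Nat.add_sub_cancel' (not_lt.1 hk)]⟩
    _ = ∏ k ∈ Finset.range (n + m), ρ (t k) := iid_nat_box ρ _ fun k => by
        simp only [t]; split_ifs; exacts [.univ, hA.compl]
    _ = ρ Aᶜ ^ m := by
        rw [Finset.prod_range_add, Finset.prod_eq_one fun k hk => by
          simp [t, Finset.mem_range.1 hk], one_mul]
        simp [t]

lemma fairCoin_singleton (b : Bool) : fairCoin {b} = 2⁻¹ := by
  cases b <;> simp [fairCoin]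

lemma ae_bothLabels (μ : Measure ℝ) [IsProbabilityMeasure μ] (ρ : Measure M)
    [IsProbabilityMeasure ρ] : ∀ᵐ s ∂iid ℕ (μ.prod (fairCoin.prod ρ)), BothLabels s := by
  refine ae_all_iff.2 fun b => ?_
  have hA : (Set.univ ×ˢ ({b} ×ˢ Set.univ) : Set (ℝ × Bool × M))
      = {p | p.2.1 = b} := by ext p; simp
  refine ae_frequently_iid _ (A := {p : ℝ × Bool × M | p.2.1 = b}) (hA ▸
    MeasurableSet.univ.prod ((measurableSet_singleton b).prod .univ)) ?_
  rw [← hA, Measure.prod_prod, Measure.prod_prod, fairCoin_singleton]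
  simp

lemma ae_pos_poissonLaw {r : ℝ} (hr : 0 < r) (ρ : Measure M) [IsProbabilityMeasure ρ] :
    ∀ᵐ s ∂poissonLaw r ρ, ∀ k, 0 < (s k).1 := by
  have hp := isProbabilityMeasure_expMeasure hr
  refine ae_all_iff.2 fun k => ?_
  exact (measurePreserving_eval_iid ((expMeasure r).prod ρ) k).quasiMeasurePreserving.ae
    (p := fun x => 0 < x.1) (measurePreserving_fst.quasiMeasurePreserving.ae (ae_pos_expMeasure hr))

/-- Almost surely `step` inverts `unstep`: if the remaining waiting times are positive, the point
just inserted is the first one. -/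
lemma measurePreserving_step {r : ℝ} (hr : 0 < r) (ρ : Measure M) [IsProbabilityMeasure ρ] :
    MeasurePreserving step ((poissonLaw r ρ).prod (poissonLaw r ρ))
      (((expMeasure (2 * r)).prod (fairCoin.prod ρ)).prod
        ((poissonLaw r ρ).prod (poissonLaw r ρ))) := by
  have hp := isProbabilityMeasure_expMeasure hr
  have hp2 := isProbabilityMeasure_expMeasure (show 0 < 2 * r by positivity)
  refine ⟨measurable_step, ?_⟩
  conv_lhs => rw [← (measurePreserving_unstep hr ρ).map_eq,
    Measure.map_map measurable_step measurable_unstep]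
  have hae := ae_pos_poissonLaw hr ρ
  rw [Measure.map_congr (g := id), Measure.map_id]
  have hsnd := (measurePreserving_snd (μ := (expMeasure (2 * r)).prod (fairCoin.prod ρ))
    (ν := (poissonLaw r ρ).prod (poissonLaw r ρ))).quasiMeasurePreserving
  filter_upwards [hsnd.ae (measurePreserving_fst.quasiMeasurePreserving.ae hae),
    hsnd.ae (measurePreserving_snd.quasiMeasurePreserving.ae hae)] with p h1 h2
  exact step_unstep (h1 0) (h2 0)

/-- Splitting a Poisson process according to independent fair labels gives two independent Poisson
processes of half the rate. -/
lemma measurePreserving_splitOff {r : ℝ} (hr : 0 < r) (ρ : Measure M) [IsProbabilityMeasure ρ] :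
    MeasurePreserving (fun s : ℕ → ℝ × Bool × M => (splitOff true s, splitOff false s))
      (poissonLaw (2 * r) (fairCoin.prod ρ)) ((poissonLaw r ρ).prod (poissonLaw r ρ)) := by
  have hp := isProbabilityMeasure_expMeasure hr
  have hp2 := isProbabilityMeasure_expMeasure (show 0 < 2 * r by positivity)
  have hm := (measurable_splitOff (M := M) true).prodMk (measurable_splitOff (M := M) false)
  have hout := measurePreserving_outputs (measurePreserving_step hr ρ)
  refine ⟨hm, ?_⟩
  -- The labelled process of rate 2r is realized as the superposition of two independent processes
  -- of rate r; splitting it gives these back.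
  rw [poissonLaw, ← hout.map_eq, Measure.map_map hm hout.measurable, Measure.map_congr (g := id),
    Measure.map_id]
  filter_upwards [hout.quasiMeasurePreserving.ae (ae_bothLabels _ ρ)] with s hs
  exact splitOff_outputs_step hs

end Split

/-! ### The weights that the driving randomness of Stretch IDLA generates -/

/-- A marked point process on the half-line: waiting times and, for each point, the choices that
the particle will make. -/
abbrev Stream : Type := ℕ → ℝ × (ℕ → Bool)

/-- The law of the particles that arrive at a vertex at height `n`. -/
noncomputable def streamLaw (n : ℕ) : Measure Stream :=
  poissonLaw ((2 : ℝ) ^ n)⁻¹ (iid ℕ fairCoin)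

instance (n : ℕ) : IsProbabilityMeasure (expMeasure ((2 : ℝ) ^ n)⁻¹) :=
  isProbabilityMeasure_expMeasure (by positivity)

instance (n : ℕ) : IsProbabilityMeasure (streamLaw n) :=
  inferInstanceAs (IsProbabilityMeasure (poissonLaw _ _))

/-- The points of a stream labelled by the next choices of the particles. -/
def labelled (S : Stream) : ℕ → ℝ × Bool × (ℕ → Bool) :=
  fun k => ((S k).1, (S k).2 0, tailSeq (S k).2)

/-- The particles of a stream whose next choice is `b`. -/
noncomputable def splitStream (S : Stream) (b : Bool) : Stream := splitOff b (labelled S)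

lemma measurePreserving_labelled (n : ℕ) :
    MeasurePreserving labelled (streamLaw n)
      (poissonLaw ((2 : ℝ) ^ n)⁻¹ (fairCoin.prod (iid ℕ fairCoin))) :=
  measurePreserving_iid_pi ℕ ((MeasurePreserving.id _).prod (measurePreserving_headTail fairCoin))

lemma measurePreserving_bool {X : Type*} [MeasurableSpace X] (μ : Measure X)
    [IsProbabilityMeasure μ] :
    MeasurePreserving (fun (p : X × X) (b : Bool) => if b then p.1 else p.2) (μ.prod μ)
      (iid Bool μ) := by
  have hm : Measurable fun (p : X × X) (b : Bool) => if b then p.1 else p.2 :=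
    measurable_pi_iff.2 fun b => by cases b <;> simp <;> fun_prop
  refine ⟨hm, ?_⟩
  have h := Measure.infinitePi_map_eval_prod (P := fun _ : Bool => μ) (i := true) (j := false)
    (by simp)
  rw [← h, Measure.map_map hm (by fun_prop)]
  convert Measure.map_id using 2
  · ext f b
    cases b <;> rfl
  · rfl

/-- The next choice serves as label and the remaining choices as mark. Halving the rate at each
level is what doubles the mean of the weights. -/
lemma measurePreserving_splitStream (n : ℕ) :
    MeasurePreserving splitStream (streamLaw n) (iid Bool (streamLaw (n + 1))) := by
  have h2 : ((2 : ℝ) ^ n)⁻¹ = 2 * ((2 : ℝ) ^ (n + 1))⁻¹ := by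
    rw [pow_succ]
    field_simp
  have h := (measurePreserving_bool (streamLaw (n + 1))).comp
    ((measurePreserving_splitOff (r := ((2 : ℝ) ^ (n + 1))⁻¹) (by positivity)
      (iid ℕ fairCoin)).comp (h2 ▸ measurePreserving_labelled n))
  convert h using 1
  ext1 S
  ext1 b
  cases b <;> rfl

/-- The waiting times for the first crossings of the edges above a level, and the particles that
cross later. -/
noncomputable def levelStep (S : ℤ → Stream) : (ℤ × Bool → ℝ) × (ℤ × Bool → Stream) :=
  (fun e => (splitStream (S e.1) e.2 0).1, fun e => tailSeq (splitStream (S e.1) e.2))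

lemma measurePreserving_levelStep (n : ℕ) :
    MeasurePreserving levelStep (iid ℤ (streamLaw n))
      ((iid (ℤ × Bool) (levelExp (n + 1))).prod (iid (ℤ × Bool) (streamLaw (n + 1)))) := by
  have h1 := measurePreserving_iid_pi ℤ (measurePreserving_splitStream n)
  have h2 := measurePreserving_iid_uncurry ℤ Bool (streamLaw (n + 1))
  have h3 : MeasurePreserving (fun S : Stream => ((S 0).1, tailSeq S)) (streamLaw (n + 1))
      ((levelExp (n + 1)).prod (streamLaw (n + 1))) :=
    (measurePreserving_fst.prod (MeasurePreserving.id _)).comp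
      (measurePreserving_headTail ((expMeasure ((2 : ℝ) ^ (n + 1))⁻¹).prod (iid ℕ fairCoin)))
  exact (measurePreserving_unzip _ _ _).comp ((measurePreserving_iid_pi _ h3).comp (h2.comp h1))

/-! ### Revealing the weights level by level -/

/-- The last edge of a geodesic to `(n + 1, i)`. -/
noncomputable def winner (w : Weights) (n : ℕ) (i : ℤ) : ℤ × Bool := by
  classical exact if RightWins w n i then (i, true) else (i + 1, false)

lemma winner_injective (w : Weights) (n : ℕ) : Function.Injective (winner w n) := by
  intro i j h
  unfold winner at h
  split_ifs at h <;> simp_all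

lemma measurable_winner (n : ℕ) (i : ℤ) : Measurable fun w : Weights => winner w n i := by
  classical
  exact Measurable.ite (measurableSet_rightWins n i) measurable_const measurable_const

/-- Insert the weights of the edges above level `n`. -/
def insertLevel (n : ℕ) (w : Weights) (x : ℤ × Bool → ℝ) : Weights :=
  fun e => if e.1 = n then x e.2 else w e

/-- The weights of the edges below level `n`, and the particles that arrive at the vertices of
level `n` later on. -/
noncomputable def explore (S : ℤ → Stream) : ℕ → Weights × (ℤ → Stream)
  | 0 => (0, S)
  | n + 1 =>
    (insertLevel n (explore S n).1 (levelStep (explore S n).2).1, fun i =>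
      (levelStep (explore S n).2).2
        (winner (insertLevel n (explore S n).1 (levelStep (explore S n).2).1) n i))

open Classical in
/-- The law of the weights below level `n`, the others being zero. -/
noncomputable def gridMeasureBelow (n : ℕ) : Measure Weights :=
  Measure.infinitePi fun e => if e.1 < n then levelExp (e.1 + 1) else Measure.dirac 0

instance (n : ℕ) (e : ℕ × ℤ × Bool) :
    IsProbabilityMeasure (if e.1 < n then levelExp (e.1 + 1) else Measure.dirac 0) := by
  split_ifs <;> infer_instance

instance (n : ℕ) : IsProbabilityMeasure (gridMeasureBelow n) :=
  inferInstanceAs (IsProbabilityMeasure (Measure.infinitePi _))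

lemma measurePreserving_insertLevel (n : ℕ) :
    MeasurePreserving (fun p : Weights × (ℤ × Bool → ℝ) => insertLevel n p.1 p.2)
      ((gridMeasureBelow n).prod (iid (ℤ × Bool) (levelExp (n + 1))))
      (gridMeasureBelow (n + 1)) := by
  classical
  have hm : Measurable fun p : Weights × (ℤ × Bool → ℝ) => insertLevel n p.1 p.2 := by
    refine measurable_pi_iff.2 fun e => ?_
    unfold insertLevel
    split_ifs <;> fun_prop
  refine ⟨hm, Measure.eq_infinitePi _ fun s t ht => ?_⟩
  rw [Measure.map_apply hm (.pi s.countable_toSet fun e _ => ht e)]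
  have hpre : (fun p : Weights × (ℤ × Bool → ℝ) => insertLevel n p.1 p.2) ⁻¹' (s : Set _).pi t
      = ((s.filter fun e => e.1 ≠ n : Finset (ℕ × ℤ × Bool)) : Set (ℕ × ℤ × Bool)).pi t ×ˢ
        (((s.filter fun e => e.1 = n).image Prod.snd : Finset (ℤ × Bool)) :
          Set (ℤ × Bool)).pi fun q => t (n, q) := by
    ext p
    simp only [Set.mem_preimage, Set.mem_pi, Finset.mem_coe, Set.mem_prod, Finset.mem_filter,
      Finset.mem_image, insertLevel]
    constructor
    · refine fun h => ⟨fun e he => by simpa [he.2] using h e he.1, ?_⟩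
      rintro _ ⟨e, he, rfl⟩
      have := h e he.1
      rw [if_pos he.2] at this
      rwa [← he.2]
    · rintro ⟨h1, h2⟩ e he
      split_ifs with hn
      · have := h2 e.2 ⟨e, ⟨he, hn⟩, rfl⟩
        rwa [← hn] at this
      · exact h1 e ⟨he, hn⟩
  rw [hpre, Measure.prod_prod, gridMeasureBelow, iid, Measure.infinitePi_pi _ fun e _ => ht e,
    Measure.infinitePi_pi _ fun q _ => ht (n, q), ← Finset.prod_filter_not_mul_prod_filter s
      (fun e => e.1 = n)]
  congr 1
  · refine Finset.prod_congr rfl fun e he => ?_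
    have hne := (Finset.mem_filter.1 he).2
    have : e.1 < n + 1 ↔ e.1 < n := by omega
    simp only [this]
  · rw [Finset.prod_image]
    · refine Finset.prod_congr rfl fun e he => ?_
      obtain ⟨-, hn⟩ := Finset.mem_filter.1 he
      obtain ⟨m, q⟩ := e
      simp only at hn
      subst hn
      simp
    · intro e he e' he' h
      have h1 := (Finset.mem_filter.1 he).2
      have h2 := (Finset.mem_filter.1 he').2
      exact Prod.ext (h1.trans h2.symm) h

/-- The first crossing times of a level are independent of the later particles. The winners depend
on revealed weights only, and no edge wins twice, so the streams passed on are again iid and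
independent of these weights. -/
lemma measurePreserving_explore (n : ℕ) :
    MeasurePreserving (fun S => explore S n) (iid ℤ (streamLaw 0))
      ((gridMeasureBelow n).prod (iid ℤ (streamLaw n))) := by
  induction n with
  | zero =>
    have h0 : gridMeasureBelow 0 = Measure.dirac 0 := by
      simp [gridMeasureBelow]
      rfl
    rw [h0]
    refine ⟨measurable_const.prodMk measurable_id, ?_⟩
    rw [Measure.dirac_prod]
    rfl
  | succ n ih =>
    have h1 := ((MeasurePreserving.id (gridMeasureBelow n)).prod (measurePreserving_levelStep n)).comp ih
    have h2 := (measurePreserving_prodAssoc (gridMeasureBelow n) (iid (ℤ × Bool) (levelExp (n + 1)))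
      (iid (ℤ × Bool) (streamLaw (n + 1)))).symm.comp h1
    have h3 := ((measurePreserving_insertLevel n).prod
      (MeasurePreserving.id (iid (ℤ × Bool) (streamLaw (n + 1))))).comp h2
    exact (measurePreserving_iid_select (gridMeasureBelow (n + 1)) (streamLaw (n + 1))
      (measurable_winner n) (fun w => winner_injective w n)).comp h3

/-- The weights of all edges. -/
noncomputable def exploredWeights (S : ℤ → Stream) : Weights := fun e => (explore S (e.1 + 1)).1 e

lemma explore_fst_eq (S : ℤ → Stream) {n : ℕ} {e : ℕ × ℤ × Bool} (h : e.1 < n) :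
    (explore S n).1 e = exploredWeights S e := by
  induction n, Nat.succ_le_of_lt h using Nat.le_induction with
  | base => rfl
  | succ n hn ih =>
    rw [← ih (by omega)]
    simp only [explore, insertLevel]
    rw [if_neg (by omega)]

lemma measurePreserving_exploredWeights :
    MeasurePreserving exploredWeights (iid ℤ (streamLaw 0)) gridMeasure := by
  have hm : Measurable exploredWeights := measurable_pi_iff.2 fun e =>
    (measurable_pi_apply e).comp (measurePreserving_explore (e.1 + 1)).measurable.fst
  refine ⟨hm, Measure.eq_infinitePi _ fun s t ht => ?_⟩
  have hmeas : MeasurableSet ((s : Set (ℕ × ℤ × Bool)).pi t) := .pi s.countable_toSet fun e _ => ht e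
  let N := s.sup Prod.fst + 1
  have hN : ∀ e ∈ s, e.1 < N := fun e he => Nat.lt_succ_of_le (Finset.le_sup (f := Prod.fst) he)
  have hlaw := measurePreserving_fst.comp (measurePreserving_explore N)
  rw [Measure.map_apply hm hmeas]
  have : exploredWeights ⁻¹' (s : Set (ℕ × ℤ × Bool)).pi t
      = (Prod.fst ∘ fun S => explore S N) ⁻¹' (s : Set (ℕ × ℤ × Bool)).pi t := by
    ext S
    simp only [Set.mem_preimage, Set.mem_pi, Function.comp_apply]
    exact forall₂_congr fun e he => by rw [explore_fst_eq S (hN e he)]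
  rw [this, hlaw.measure_preimage hmeas.nullMeasurableSet, gridMeasureBelow,
    Measure.infinitePi_pi _ fun e _ => ht e]
  exact Finset.prod_congr rfl fun e he => by rw [if_pos (hN e he)]

/-- The waiting times are positive and particles go in both directions at all times. -/
def GoodStream (S : Stream) : Prop := (∀ k, 0 < (S k).1) ∧ BothLabels (labelled S)

lemma ae_goodStream (n : ℕ) : ∀ᵐ S ∂streamLaw n, GoodStream S :=
  (ae_pos_poissonLaw (by positivity) _).and
    ((measurePreserving_labelled n).quasiMeasurePreserving.ae (ae_bothLabels _ _))

lemma ae_goodStream_explore :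
    ∀ᵐ S ∂iid ℤ (streamLaw 0), ∀ n i, GoodStream ((explore S n).2 i) := by
  refine ae_all_iff.2 fun n => ae_all_iff.2 fun i => ?_
  exact (measurePreserving_explore n).quasiMeasurePreserving.ae
    (measurePreserving_snd.quasiMeasurePreserving.ae
      ((measurePreserving_eval_iid (streamLaw n) i).quasiMeasurePreserving.ae (ae_goodStream n)))

/-! ### Uniqueness of the evolution -/

lemma height_walk (x : Root) (c : ℕ → Bool) (n : ℕ) : (walk x.1 c n).height = n := by
  induction n with
  | zero => exact x.2
  | succ n ih =>
    change (walk x.1 c n).height + 1 = _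
    rw [ih]
    push_cast
    rfl

lemma height_src_walkEdge (x : Root) (c : ℕ → Bool) (n : ℕ) :
    (Edge.src (walkEdge x.1 c n)).height = n := height_walk x c n

lemma height_tgt (e : Edge) : (Edge.tgt e).height = (Edge.src e).height + 1 := rfl

/-- The rings of a clock come one after the other, and only finitely many in bounded time. -/
structure IsClock (r : ℕ → ℝ) : Prop where
  pos : ∀ k, 0 < r k
  strictMono : StrictMono r
  unbounded : ∀ t, ∃ k, t < r k

lemma IsClock.exists_last {r : ℕ → ℝ} (h : IsClock r) (s t : ℝ) :
    (∀ k, ¬ (s < r k ∧ r k ≤ t)) ∨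
      ∃ k, s < r k ∧ r k ≤ t ∧ ∀ k', ¬ (r k < r k' ∧ r k' ≤ t) := by
  by_cases hn : ∀ k, ¬ (s < r k ∧ r k ≤ t)
  · exact .inl hn
  right
  push Not at hn
  obtain ⟨k, hk, hkt⟩ := hn
  obtain ⟨K, hK⟩ := h.unbounded t
  have hbd : ∀ j, r j ≤ t → j ≤ K := fun j hj =>
    (h.strictMono.lt_iff_lt.1 (hj.trans_lt hK)).le
  classical
  let m := Nat.findGreatest (fun j => r j ≤ t) K
  have hm : r m ≤ t := Nat.findGreatest_spec (P := fun j => r j ≤ t) (hbd k hkt) hkt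
  have hkm : k ≤ m := Nat.le_findGreatest (hbd k hkt) hkt
  refine ⟨m, hk.trans_le (h.strictMono.monotone hkm), hm, fun j hj => ?_⟩
  have : j ≤ m := Nat.le_findGreatest (hbd j hj.2) hj.2
  exact absurd (h.strictMono.monotone this) (not_le.2 hj.1)

section Uniqueness

variable {ring : Root → ℕ → ℝ} {coin : Root → ℕ → ℕ → Bool} {T T' : Root → ℝ≥0 → Set Edge}

lemma mem_before {t : ℝ≥0} {x : Root} {e : Edge} : e ∈ before T t x ↔ ∃ s < t, e ∈ T x s := by
  simp [before]

lemma IsEvolution.mono (hT : IsEvolution ring coin T) (hr : ∀ x, IsClock (ring x)) (x : Root) :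
    Monotone (T x) := by
  intro s t hst
  rcases (hr x).exists_last s t with h | ⟨k, hsk, hkt, hlast⟩
  · rw [hT.const x s t hst h]
  · lift ring x k to ℝ≥0 using ((hr x).pos k).le with u hu
    rw [hT.const x u t (by exact_mod_cast hkt) hlast, hT.jump x k u hu]
    exact fun e he => .inl (mem_before.2 ⟨s, by exact_mod_cast hsk, he⟩)

/-- An edge not adjoined at a ring was there at some earlier time, and the last ring up to that time
has a smaller number; induction ends at the empty tree of time zero. -/
lemma IsEvolution.exists_adjoins (hT : IsEvolution ring coin T) (hr : ∀ x, IsClock (ring x))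
    {x : Root} {t : ℝ≥0} {e : Edge} (he : e ∈ T x t) :
    ∃ (k : ℕ) (u : ℝ≥0), (u : ℝ) = ring x k ∧ u ≤ t ∧ Adjoins (before T u) x (coin x k) e := by
  have key : ∀ (k : ℕ) (u : ℝ≥0), (u : ℝ) = ring x k → e ∈ T x u →
      ∃ (k : ℕ) (u' : ℝ≥0), (u' : ℝ) = ring x k ∧ u' ≤ u ∧
        Adjoins (before T u') x (coin x k) e := by
    intro k
    induction k using Nat.strong_induction_on with
    | _ k ih =>
      intro u hu heu
      rw [hT.jump x k u hu] at heu
      rcases heu with heu | heu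
      · obtain ⟨s, hs, hes⟩ := mem_before.1 heu
        rcases (hr x).exists_last (0 : ℝ≥0) s with h | ⟨j, -, hjs, hlast⟩
        · rw [hT.const x 0 s zero_le h, hT.init] at hes
          exact hes.elim
        · have hjk : j < k := (hr x).strictMono.lt_iff_lt.1 (by
            rw [← hu]
            exact hjs.trans_lt (by exact_mod_cast hs))
          lift ring x j to ℝ≥0 using ((hr x).pos j).le with v hv
          have hvs : v ≤ s := by exact_mod_cast hjs
          rw [hT.const x v s hvs hlast] at hes
          obtain ⟨k', u', h1, h2, h3⟩ := ih j hjk v hv hes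
          exact ⟨k', u', h1, h2.trans (hvs.trans hs.le), h3⟩
      · exact ⟨k, u, hu, le_rfl, heu⟩
  rcases (hr x).exists_last (0 : ℝ≥0) t with h | ⟨j, -, hjt, hlast⟩
  · rw [hT.const x 0 t zero_le h, hT.init] at he
    exact he.elim
  · lift ring x j to ℝ≥0 using ((hr x).pos j).le with v hv
    have hvt : v ≤ t := by exact_mod_cast hjt
    rw [hT.const x v t hvt hlast] at he
    obtain ⟨k', u', h1, h2, h3⟩ := key j v hv he
    exact ⟨k', u', h1, h2.trans hvt, h3⟩

lemma IsEvolution.mem_of_adjoins (hT : IsEvolution ring coin T) (hr : ∀ x, IsClock (ring x))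
    {x : Root} {t u : ℝ≥0} {e : Edge} {k : ℕ} (hu : (u : ℝ) = ring x k) (hut : u ≤ t)
    (h : Adjoins (before T u) x (coin x k) e) : e ∈ T x t :=
  hT.mono hr x hut (by rw [hT.jump x k u hu]; exact .inr h)

/-- A vertex that has been reached is the upper endpoint of an edge of a tree. -/
lemma IsEvolution.mem_treeVertices_before (hT : IsEvolution ring coin T)
    (hr : ∀ x, IsClock (ring x)) {x : Root} {t : ℝ≥0} {a : Site} (ha : 0 < a.height) :
    a ∈ treeVertices x (before T t x) ↔ ∃ e ∈ before T t x, Edge.tgt e = a := by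
  constructor
  · rintro (rfl | ⟨e, he, rfl | rfl⟩)
    · exact absurd x.2 ha.ne'
    · obtain ⟨s, hs, hes⟩ := mem_before.1 he
      obtain ⟨k, u, hu, hus, n, rfl, hw, -⟩ := hT.exists_adjoins hr hes
      rw [height_src_walkEdge] at ha
      obtain ⟨n, rfl⟩ : ∃ m, n = m + 1 := ⟨n - 1, by omega⟩
      refine ⟨walkEdge x.1 (coin x k) n, ?_, rfl⟩
      obtain ⟨s', hs', hes'⟩ := mem_before.1 (hw n n.lt_succ_self)
      exact mem_before.2 ⟨s', hs'.trans_le (hus.trans hs.le), hes'⟩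
    · exact ⟨e, he, rfl⟩
  · rintro ⟨e, he, rfl⟩
    exact .inr ⟨e, he, .inr rfl⟩

/-- The particle that adjoins `e` in `T` crosses the same lower edges in `T'`. If its target were
already taken in `T'`, by `e'` at an earlier ring, then the particle of that ring would reach the
target in `T` as well and find it free, since it is still free later: a contradiction. -/
lemma IsEvolution.subset_of_agree (hT : IsEvolution ring coin T) (hT' : IsEvolution ring coin T')
    (hr : ∀ x, IsClock (ring x)) {n : ℕ}
    (ih : ∀ e : Edge, (Edge.src e).height < n → ∀ x t, e ∈ T x t ↔ e ∈ T' x t) {e : Edge}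
    (hn : (Edge.src e).height = n) {x : Root} {t : ℝ≥0} (he : e ∈ T x t) : e ∈ T' x t := by
  have hbefore : ∀ e : Edge, (Edge.src e).height < n → ∀ x t, e ∈ before T t x → e ∈ before T' t x :=
    fun e he x t h => by
      obtain ⟨s, hs, h⟩ := mem_before.1 h
      exact mem_before.2 ⟨s, hs, (ih e he x s).1 h⟩
  have hbefore' : ∀ e : Edge, (Edge.src e).height < n → ∀ x t, e ∈ before T' t x → e ∈ before T t x :=
    fun e he x t h => by
      obtain ⟨s, hs, h⟩ := mem_before.1 h
      exact mem_before.2 ⟨s, hs, (ih e he x s).2 h⟩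
  have ha : 0 < (Edge.tgt e).height := by rw [height_tgt]; omega
  obtain ⟨k, u, hu, hut, m, hm, hw, hfree⟩ := hT.exists_adjoins hr he
  obtain rfl : m = n := by
    rw [hm, height_src_walkEdge] at hn
    exact_mod_cast hn
  refine hT'.mem_of_adjoins hr hu hut ⟨m, hm, fun j hj => hbefore _ (by
    rw [height_src_walkEdge]; exact_mod_cast hj) _ _ (hw j hj), fun x' hx' => ?_⟩
  obtain ⟨e', he', htgt⟩ := (hT'.mem_treeVertices_before hr ha).1 hx'
  obtain ⟨s, hs, hes⟩ := mem_before.1 he'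
  obtain ⟨k', u', hu', hus', m', hm', hw', hfree'⟩ := hT'.exists_adjoins hr hes
  obtain rfl : m' = m := by
    have h1 := congrArg Site.height htgt
    rw [height_tgt, height_tgt, hm', height_src_walkEdge, hn] at h1
    exact_mod_cast add_right_cancel h1
  have hmem : e' ∈ T x' u' := by
    refine hT.mem_of_adjoins hr hu' le_rfl ⟨m', hm', fun j hj => hbefore' _ (by
      rw [height_src_walkEdge]; exact_mod_cast hj) _ _ (hw' j hj), fun y hy => ?_⟩
    rw [htgt] at hy
    obtain ⟨e₂, he₂, htgt₂⟩ := (hT.mem_treeVertices_before hr ha).1 hy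
    obtain ⟨s₂, hs₂, hes₂⟩ := mem_before.1 he₂
    exact hfree y ((hT.mem_treeVertices_before hr ha).2
      ⟨e₂, mem_before.2 ⟨s₂, hs₂.trans_le (hus'.trans hs.le), hes₂⟩, htgt₂⟩)
  exact hfree x' ((hT.mem_treeVertices_before hr ha).2
    ⟨e', mem_before.2 ⟨u', hus'.trans_lt hs, hmem⟩, htgt⟩)

/-- Clocks and choices determine the evolution. -/
theorem IsEvolution.unique (hT : IsEvolution ring coin T) (hT' : IsEvolution ring coin T')
    (hr : ∀ x, IsClock (ring x)) : T = T' := by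
  -- Induction on height instead of time: among infinitely many clocks there need not be a first
  -- ring.
  have key : ∀ (n : ℕ) (e : Edge), (Edge.src e).height = n → ∀ x t, e ∈ T x t ↔ e ∈ T' x t := by
    intro n
    induction n using Nat.strong_induction_on with
    | _ n ih =>
      have ih' : ∀ e : Edge, (Edge.src e).height < n → ∀ x t, e ∈ T x t ↔ e ∈ T' x t := by
        intro e he
        obtain ⟨m, hm⟩ := Int.eq_ofNat_of_zero_le (a := (Edge.src e).height) (Edge.src e).2.2
        exact ih m (by omega) e hm
      exact fun e he x t => ⟨hT.subset_of_agree hT' hr ih' he,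
        hT'.subset_of_agree hT hr (fun e he x t => (ih' e he x t).symm) he⟩
  ext x t e
  obtain ⟨m, hm⟩ := Int.eq_ofNat_of_zero_le (a := (Edge.src e).height) (Edge.src e).2.2
  exact key m e hm x t

end Uniqueness

/-! ### The points of a stream -/

section Points

variable {M : Type*}

/-- The points of a marked point process with given waiting times. -/
def points (s : ℕ → ℝ × M) : Set (ℝ × M) :=
  {p | ∃ k, ringTime (fun j => (s j).1) k = p.1 ∧ (s k).2 = p.2}

lemma ringTime_zero (τ : ℕ → ℝ) : ringTime τ 0 = τ 0 := by simp [ringTime]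

lemma ringTime_succ (τ : ℕ → ℝ) (k : ℕ) : ringTime τ (k + 1) = ringTime τ k + τ (k + 1) :=
  Finset.sum_range_succ _ _

lemma ringTime_succ' (τ : ℕ → ℝ) (k : ℕ) :
    ringTime τ (k + 1) = τ 0 + ringTime (fun j => τ (j + 1)) k := by
  rw [ringTime, Finset.sum_range_succ', add_comm]
  rfl

lemma strictMono_ringTime {τ : ℕ → ℝ} (h : ∀ k, 0 < τ k) : StrictMono (ringTime τ) :=
  strictMono_nat_of_lt_succ fun k => by
    rw [ringTime_succ]
    exact lt_add_of_pos_right _ (h _)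

lemma ringTime_pos {τ : ℕ → ℝ} (h : ∀ k, 0 < τ k) (k : ℕ) : 0 < ringTime τ k :=
  Finset.sum_pos (fun j _ => h j) ⟨0, by simp⟩

lemma le_of_mem_points {s : ℕ → ℝ × M} (h : ∀ k, 0 < (s k).1) {p : ℝ × M} (hp : p ∈ points s) :
    (s 0).1 ≤ p.1 := by
  obtain ⟨k, hk, -⟩ := hp
  rw [← hk, ← ringTime_zero fun j => (s j).1]
  exact (strictMono_ringTime h).monotone k.zero_le

lemma mem_points_iff {s : ℕ → ℝ × M} {t : ℝ} {c : M} :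
    (t, c) ∈ points s ↔ s 0 = (t, c) ∨ (t - (s 0).1, c) ∈ points (tailSeq s) := by
  constructor
  · rintro ⟨k, hk, hc⟩
    simp only at hk hc
    cases k with
    | zero =>
      rw [ringTime_zero] at hk
      exact .inl (Prod.ext hk hc)
    | succ k =>
      rw [ringTime_succ'] at hk
      refine .inr ⟨k, ?_, hc⟩
      simp only [tailSeq]
      linarith
  · rintro (h | ⟨k, hk, hc⟩)
    · exact ⟨0, by rw [ringTime_zero, h], by rw [h]⟩
    · refine ⟨k + 1, ?_, hc⟩
      simp only [tailSeq] at hk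
      rw [ringTime_succ', hk]
      ring

lemma mem_points_tailSeq {s : ℕ → ℝ × M} (h : ∀ k, 0 < (tailSeq s k).1) {t : ℝ} {c : M} :
    (t, c) ∈ points (tailSeq s) ↔ 0 < t ∧ (t + (s 0).1, c) ∈ points s := by
  constructor
  · intro hp
    exact ⟨(h 0).trans_le (le_of_mem_points h hp), mem_points_iff.2 (.inr (by
      rwa [add_sub_cancel_right]))⟩
  · rintro ⟨ht, hp⟩
    rcases mem_points_iff.1 hp with h0 | h0
    · have := congrArg Prod.fst h0
      simp only at this
      linarith
    · rwa [add_sub_cancel_right] at h0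

lemma mem_points_delay {x : ℝ} {s : ℕ → ℝ × M} {t : ℝ} {c : M} :
    (t, c) ∈ points (delay x s) ↔ (t - x, c) ∈ points s := by
  rw [mem_points_iff, mem_points_iff (s := s), delay, consSeq_zero, tailSeq_consSeq, sub_sub]
  refine or_congr ?_ Iff.rfl
  rw [Prod.ext_iff, Prod.ext_iff]
  simp only [eq_sub_iff_add_eq, add_comm x]

lemma BothLabels.drop {s : ℕ → ℝ × Bool × M} (h : BothLabels s) (m : ℕ) :
    BothLabels fun k => s (k + m) := fun b n => by
  obtain ⟨k, hk⟩ := h b (n + m)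
  exact ⟨k, by simpa only [add_right_comm] using hk⟩

/-- Splitting off keeps exactly the points with the given label. -/
lemma mem_points_splitOff {s : ℕ → ℝ × Bool × M} (h : BothLabels s) {b : Bool} {t : ℝ} {c : M} :
    (t, c) ∈ points (splitOff b s) ↔ (t, b, c) ∈ points s := by
  constructor
  · rintro ⟨k, hk, hc⟩
    induction k generalizing s t with
    | zero =>
      obtain ⟨k, hk'⟩ := h b 0
      refine ⟨firstIdx b s, ?_, Prod.ext (firstIdx_spec ⟨_, hk'⟩) hc⟩
      rw [ringTime_zero] at hk
      exact hk
    | succ k ih =>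
      have hr := h.drop (firstIdx b s + 1)
      have htail : ∀ k, splitOff b s (k + 1) = splitOff b (splitRest b s) k :=
        fun k => outputs_succ _ _ _
      rw [ringTime_succ'] at hk
      simp only [htail] at hk hc
      obtain ⟨m, hm, hmc⟩ := ih (s := splitRest b s) (t := t - (splitOff b s 0).1) hr
        (eq_sub_of_add_eq' hk) hc
      refine ⟨firstIdx b s + 1 + m, ?_, by rw [add_comm]; exact hmc⟩
      simp only [splitRest] at hm
      rw [ringTime, add_assoc _ m, Finset.sum_range_add]
      have h0 : (splitOff b s 0).1 = ∑ i ∈ Finset.range (firstIdx b s + 1), (s i).1 := rfl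
      have h1 : ringTime (fun j => (s (j + (firstIdx b s + 1))).1) m
          = ∑ i ∈ Finset.range (m + 1), (s (firstIdx b s + 1 + i)).1 :=
        Finset.sum_congr rfl fun i _ => by simp only [add_comm i]
      rw [← h0, ← h1, hm]
      ring
  · rintro ⟨k, hk, hc⟩
    induction k generalizing s t with
    | zero =>
      rw [ringTime_zero] at hk
      have h1 : (s 0).2.1 = b := congrArg Prod.fst hc
      have h2 : (s 0).2.2 = c := congrArg Prod.snd hc
      rw [splitOff_of_eq h1, mem_points_iff, consSeq_zero]
      exact .inl (Prod.ext hk h2)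
    | succ k ih =>
      rw [ringTime_succ'] at hk
      have htail : BothLabels (tailSeq s) := h.drop 1
      have := ih (t := t - (s 0).1) htail (eq_sub_of_add_eq' hk) hc
      by_cases h0 : (s 0).2.1 = b
      · rw [splitOff_of_eq h0, mem_points_iff, consSeq_zero, tailSeq_consSeq]
        exact .inr this
      · obtain ⟨j, hj⟩ := h b 0
        rw [splitOff_of_ne h0 ⟨_, hj⟩, mem_points_delay]
        exact this

lemma pos_splitOff {b : Bool} {s : ℕ → ℝ × Bool × M} (h : ∀ k, 0 < (s k).1) (k : ℕ) :
    0 < (splitOff b s k).1 := by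
  induction k generalizing s with
  | zero => exact Finset.sum_pos (fun j _ => h j) ⟨0, Finset.mem_range.2 (Nat.succ_pos _)⟩
  | succ k ih => exact ih (s := splitRest b s) fun j => h _

end Points

lemma mem_points_labelled {S : Stream} {t : ℝ} {b : Bool} {c : ℕ → Bool} :
    (t, b, c) ∈ points (labelled S) ↔ (t, consSeq b c) ∈ points S := by
  refine exists_congr fun k => and_congr Iff.rfl ?_
  simp only [labelled, Prod.mk.injEq]
  constructor
  · rintro ⟨rfl, rfl⟩
    exact (consSeq_tailSeq _).symm
  · intro h
    rw [h]
    exact ⟨rfl, rfl⟩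

lemma mem_points_splitStream {S : Stream} (h : GoodStream S) {t : ℝ} {b : Bool} {c : ℕ → Bool} :
    (t, c) ∈ points (splitStream S b) ↔ (t, consSeq b c) ∈ points S := by
  rw [splitStream, mem_points_splitOff h.2, mem_points_labelled]

/-! ### The particles that arrive at a vertex -/

/-- The choices `c` lead from the root to `(n, i)` along the geodesic. -/
def Follows (w : Weights) : ℕ → ℤ → (ℕ → Bool) → Prop
  | 0, _, _ => True
  | n + 1, i, c => Follows w n (winner w n i).1 c ∧ c n = (winner w n i).2

lemma winner_congr {w w' : Weights} {n : ℕ} (h : ∀ m < n + 1, ∀ i b, w (m, i, b) = w' (m, i, b))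
    (i : ℤ) : winner w n i = winner w' n i := by
  have hd := gridDist_congr (n := n) fun m hm => h m (by omega)
  have hr : RightWins w n i ↔ RightWins w' n i := by
    simp only [RightWins, hd, h n n.lt_succ_self]
  by_cases h : RightWins w n i <;> simp [winner, h, ← hr]

lemma gridLabel_succ_eq (w : Weights) (n : ℕ) (i : ℤ) :
    gridLabel w (n + 1) i = gridLabel w n (winner w n i).1 := by
  by_cases h : RightWins w n i <;> simp [gridLabel, winner, h]

lemma gridDist_succ_eq (w : Weights) (n : ℕ) (i : ℤ) :
    gridDist w (n + 1) i = gridDist w n (winner w n i).1 + w (n, winner w n i) := by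
  by_cases h : RightWins w n i
  · simp [winner, h, gridDist, min_eq_left (show _ ≤ _ from h)]
  · simp [winner, h, gridDist, min_eq_right (not_le.1 h).le]

lemma stepIndex_winner (w : Weights) (n : ℕ) (i : ℤ) :
    stepIndex (winner w n i).1 (winner w n i).2 = i := by
  by_cases h : RightWins w n i <;> simp [winner, h, stepIndex]

/-- Winners at level `n` depend only on weights of levels up to `n`, so the partially revealed
weights may be replaced by the final ones. -/
lemma explore_snd_succ (S : ℤ → Stream) (n : ℕ) (i : ℤ) : (explore S (n + 1)).2 i
    = tailSeq (splitStream ((explore S n).2 (winner (exploredWeights S) n i).1)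
      (winner (exploredWeights S) n i).2) := by
  have h : winner (explore S (n + 1)).1 n i = winner (exploredWeights S) n i :=
    winner_congr (fun m hm j b => explore_fst_eq S (e := (m, j, b)) hm) i
  rw [← h]
  rfl

lemma exploredWeights_eq (S : ℤ → Stream) (n : ℕ) (i : ℤ) (b : Bool) :
    exploredWeights S (n, i, b) = (splitStream ((explore S n).2 i) b 0).1 := by
  simp [exploredWeights, explore, insertLevel, levelStep]

section Explore

variable {S : ℤ → Stream}

lemma exploredWeights_pos (hS : ∀ n i, GoodStream ((explore S n).2 i)) (e : ℕ × ℤ × Bool) : 0 < exploredWeights S e := by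
  obtain ⟨n, i, b⟩ := e
  rw [exploredWeights_eq]
  exact pos_splitOff (hS n i).1 0

/-- The stream at a vertex consists of the particles that arrive after the vertex has been
occupied. -/
lemma mem_points_explore (hS : ∀ n i, GoodStream ((explore S n).2 i)) (n : ℕ) (i : ℤ)
    (t : ℝ) (c : ℕ → Bool) :
    (t, c) ∈ points ((explore S n).2 i) ↔
      0 < t ∧ ∃ p ∈ points (S (gridLabel (exploredWeights S) n i)),
      p.1 = gridDist (exploredWeights S) n i + t ∧ Follows (exploredWeights S) n i p.2 ∧
        c = fun m => p.2 (n + m) := by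
  induction n generalizing i t c with
  | zero =>
    simp only [explore, gridLabel, gridDist, zero_add, Follows, true_and]
    constructor
    · intro h
      exact ⟨((hS 0 i).1 0).trans_le (le_of_mem_points (hS 0 i).1 h), _, h, rfl, rfl⟩
    · rintro ⟨-, p, hp, rfl, rfl⟩
      exact hp
  | succ n ih =>
    have hpos := (hS (n + 1) i).1
    rw [explore_snd_succ] at hpos ⊢
    rw [mem_points_tailSeq hpos, ← exploredWeights_eq, mem_points_splitStream (hS _ _), ih,
      gridLabel_succ_eq, gridDist_succ_eq, Prod.mk.eta]
    have hw := exploredWeights_pos hS (n, winner (exploredWeights S) n i)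
    refine and_congr_right fun ht => ?_
    rw [and_iff_right (by positivity)]
    refine exists_congr fun p => and_congr_right fun _ => ?_
    rw [add_right_comm, ← add_assoc, Follows, and_assoc]
    refine and_congr_right fun _ => and_congr_right fun _ => ?_
    constructor
    · intro h
      have h0 := congrFun h 0
      simp only [consSeq_zero, add_zero] at h0
      refine ⟨h0.symm, ?_⟩
      ext m
      have := congrFun h (m + 1)
      simp only [consSeq_succ] at this
      rw [this, show n + 1 + m = n + (m + 1) by ring]
    · rintro ⟨h0, rfl⟩
      ext m
      cases m with
      | zero => exact h0.symm
      | succ m => rw [consSeq_succ, show n + 1 + m = n + (m + 1) by ring]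

/-- The weight of an edge is the time between the occupation of its lower endpoint and the first
crossing of the edge: it is attained. -/
lemma exists_first_crossing (hS : ∀ n i, GoodStream ((explore S n).2 i)) (n : ℕ) (i : ℤ)
    (b : Bool) :
    ∃ p ∈ points (S (gridLabel (exploredWeights S) n i)),
      p.1 = gridDist (exploredWeights S) n i + exploredWeights S (n, i, b) ∧
      Follows (exploredWeights S) n i p.2 ∧ p.2 n = b := by
  have h : splitStream ((explore S n).2 i) b 0 ∈ points (splitStream ((explore S n).2 i) b) :=
    ⟨0, ringTime_zero _, rfl⟩
  obtain ⟨-, p, hp, h1, h2, h3⟩ :=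
    (mem_points_explore hS _ _ _ _).1 ((mem_points_splitStream (hS n i)).1 h)
  exact ⟨p, hp, by rw [h1, exploredWeights_eq]; rfl, h2, (congrFun h3 0).symm⟩

/-- The weight of an edge is the time between the occupation of its lower endpoint and the first
crossing of the edge: no particle crosses earlier. -/
lemma le_of_crossing (hS : ∀ n i, GoodStream ((explore S n).2 i)) {n : ℕ} {i : ℤ}
    {p : ℝ × (ℕ → Bool)}
    (hp : p ∈ points (S (gridLabel (exploredWeights S) n i)))
    (hd : gridDist (exploredWeights S) n i < p.1) (hf : Follows (exploredWeights S) n i p.2) :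
    gridDist (exploredWeights S) n i + exploredWeights S (n, i, p.2 n) ≤ p.1 := by
  have h : (p.1 - gridDist (exploredWeights S) n i, fun m => p.2 (n + m)) ∈
      points ((explore S n).2 i) :=
    (mem_points_explore hS _ _ _ _).2 ⟨sub_pos.2 hd, p, hp, by ring, hf, rfl⟩
  have hc : (fun m => p.2 (n + m)) = consSeq (p.2 n) fun m => p.2 (n + (m + 1)) := by
    ext m
    cases m <;> rfl
  rw [hc, ← mem_points_splitStream (hS n i)] at h
  have := le_of_mem_points (pos_splitOff (hS n i).1) h
  rw [← splitStream, ← exploredWeights_eq] at this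
  linarith

end Explore

/-! ### Existence of the evolution -/

/-- The last edge of the geodesic to `(n + 1, i)`. -/
noncomputable def lastEdge (w : Weights) (n : ℕ) (i : ℤ) : Edge := edgeAt (n, winner w n i)

/-- The geodesic trees, each vertex being present from the time on that equals its distance to the
boundary. -/
def gridForest (w : Weights) (x : Root) (t : ℝ≥0) : Set Edge :=
  {e | ∃ n i, e = lastEdge w n i ∧ x = rootAt (gridLabel w (n + 1) i) ∧ gridDist w (n + 1) i ≤ t}

lemma src_lastEdge (w : Weights) (n : ℕ) (i : ℤ) :
    Edge.src (lastEdge w n i) = site n (winner w n i).1 := rfl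

lemma tgt_lastEdge (w : Weights) (n : ℕ) (i : ℤ) :
    Edge.tgt (lastEdge w n i) = site (n + 1) i := by
  rw [lastEdge, ← Prod.mk.eta (p := winner w n i), tgt_edgeAt, stepIndex_winner]

section Forest

variable {w : Weights}

lemma gridDist_winner_lt (hw : ∀ e, 0 < w e) (n : ℕ) (i : ℤ) :
    gridDist w n (winner w n i).1 < gridDist w (n + 1) i := by
  rw [gridDist_succ_eq]
  exact lt_add_of_pos_right _ (hw _)

lemma mem_before_gridForest (hw : ∀ e, 0 < w e) {x : Root} {t : ℝ≥0} {e : Edge} :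
    e ∈ before (gridForest w) t x ↔ ∃ n i, e = lastEdge w n i ∧
      x = rootAt (gridLabel w (n + 1) i) ∧ gridDist w (n + 1) i < t := by
  rw [mem_before]
  constructor
  · rintro ⟨s, hs, n, i, he, hx, hd⟩
    exact ⟨n, i, he, hx, hd.trans_lt (by exact_mod_cast hs)⟩
  · rintro ⟨n, i, he, hx, hd⟩
    exact ⟨⟨_, gridDist_nonneg (fun e => (hw e).le) (n + 1) i⟩, by exact_mod_cast hd, n, i, he, hx,
      le_rfl⟩

lemma Follows.walk_eq {n : ℕ} {i : ℤ} {c : ℕ → Bool} (h : Follows w n i c) :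
    walk (rootAt (gridLabel w n i)).1 c n = site n i := by
  induction n generalizing i with
  | zero => rfl
  | succ n ih => rw [gridLabel_succ_eq, walk, ih h.1, h.2, up_site, stepIndex_winner]

lemma Follows.walkEdge_eq {n : ℕ} {i : ℤ} {c : ℕ → Bool} (h : Follows w n i c) :
    walkEdge (rootAt (gridLabel w n i)).1 c n = edgeAt (n, i, c n) := by
  rw [walkEdge, h.walk_eq]
  rfl

/-- Distances increase along a geodesic, so its edges have been added before its endpoint is passed.
-/
lemma Follows.walkEdge_mem_before (hw : ∀ e, 0 < w e) {n : ℕ} {i : ℤ} {c : ℕ → Bool}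
    (h : Follows w n i c) {t : ℝ≥0} (ht : gridDist w n i < t) {j : ℕ} (hj : j < n) :
    walkEdge (rootAt (gridLabel w n i)).1 c j
      ∈ before (gridForest w) t (rootAt (gridLabel w n i)) := by
  induction n generalizing i with
  | zero => omega
  | succ n ih =>
    rcases (Nat.le_of_lt_succ hj).lt_or_eq with hj | rfl
    · rw [gridLabel_succ_eq]
      exact ih h.1 ((gridDist_winner_lt hw n i).trans ht) hj
    · refine (mem_before_gridForest hw).2 ⟨j, i, ?_, rfl, ht⟩
      rw [gridLabel_succ_eq, h.1.walkEdge_eq, h.2]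
      rfl

/-- A particle that has only crossed edges of the tree has followed the geodesic. -/
lemma follows_of_walkEdge_mem (hw : ∀ e, 0 < w e) {j : ℤ} {c : ℕ → Bool} {t : ℝ≥0} (ht : 0 < t)
    {n : ℕ} (h : ∀ m < n, walkEdge (rootAt j).1 c m ∈ before (gridForest w) t (rootAt j)) :
    ∃ i, gridLabel w n i = j ∧ Follows w n i c ∧ gridDist w n i < t := by
  induction n with
  | zero => exact ⟨j, rfl, trivial, by exact_mod_cast ht⟩
  | succ n ih =>
    obtain ⟨i, rfl, hf, -⟩ := ih fun m hm => h m (by omega)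
    obtain ⟨m, i', he, hx, hd⟩ := (mem_before_gridForest hw).1 (h n n.lt_succ_self)
    have he' := he
    rw [hf.walkEdge_eq, lastEdge] at he'
    obtain ⟨rfl, hq⟩ := Prod.ext_iff.1 (edgeAt_injective he')
    obtain ⟨h1, h2⟩ := Prod.ext_iff.1 hq
    simp only at h1 h2
    exact ⟨i', (rootAt_injective hx).symm, ⟨h1 ▸ hf, h2⟩, hd⟩

/-- A vertex has been reached before time `t` if and only if its distance is less than `t`. -/
lemma site_mem_treeVertices (hw : ∀ e, 0 < w e) {n : ℕ} {i : ℤ} {t : ℝ≥0} :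
    (∃ x, site (n + 1) i ∈ treeVertices x (before (gridForest w) t x)) ↔
      gridDist w (n + 1) i < t := by
  constructor
  · rintro ⟨x, h | ⟨e, he, h⟩⟩
    · have h1 := congrArg Site.height h
      rw [x.2, height_site] at h1
      omega
    · obtain ⟨m, i', rfl, -, hd⟩ := (mem_before_gridForest hw).1 he
      rw [src_lastEdge, tgt_lastEdge, site_inj, site_inj] at h
      rcases h with ⟨rfl, rfl⟩ | ⟨hm, rfl⟩
      · exact (gridDist_winner_lt hw _ i').trans hd
      · obtain rfl : n = m := by omega
        exact hd
  · intro h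
    exact ⟨_, .inr ⟨lastEdge w n i, (mem_before_gridForest hw).2 ⟨n, i, rfl, rfl, h⟩,
      .inr (tgt_lastEdge w n i).symm⟩⟩

lemma winner_eq_of_gridDist_eq (hw : NoTies w) {n : ℕ} {i : ℤ} {b : Bool}
    (h : gridDist w n i + w (n, i, b) ≤ gridDist w (n + 1) (stepIndex i b)) :
    winner w n (stepIndex i b) = (i, b) := by
  cases b
  · have hs : stepIndex i false = i - 1 := rfl
    rw [hs] at h ⊢
    have hr : ¬ RightWins w n (i - 1) := fun hr => by
      have h1 := hw n (i - 1)
      have h2 := gridDist_succ_le_left w n (i - 1)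
      rw [RightWins] at hr
      rw [sub_add_cancel] at h1 hr
      exact h1 (le_antisymm hr (h.trans h2))
    simp [winner, hr]
  · have hs : stepIndex i true = i := rfl
    rw [hs] at h ⊢
    have hr : RightWins w n i := h.trans (gridDist_succ_le_right w n i)
    simp [winner, hr]

/-- The trees are finite if they do not reach arbitrarily high levels. -/
lemma finite_finalTree_gridForest (h : ∀ j, ∃ n, Extinct w n j) (x : Root) :
    (treeVertices x (finalTree (gridForest w) x)).Finite := by
  refine finite_treeVertices ?_ x
  obtain ⟨j, rfl⟩ := exists_eq_rootAt x
  obtain ⟨N, hN⟩ := h j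
  refine finite_of_forall_mem_cone (N := N) (j := j) fun e he => ?_
  obtain ⟨t, n, i, rfl, hx, -⟩ := Set.mem_iUnion.1 he
  have hl : gridLabel w n (winner w n i).1 = j := by
    rw [← gridLabel_succ_eq, rootAt_injective hx]
  have h1 := le_gridLabel w n (winner w n i).1
  have h2 := gridLabel_le w n (winner w n i).1
  refine ⟨n, (winner w n i).1, (winner w n i).2, rfl, ?_, by omega, by omega⟩
  by_contra hn
  exact hN.mono (not_lt.1 hn) _ hl

end Forest

/-- Every vertex is occupied at a ring of its own root, by a particle that follows the geodesic.
Conversely, a particle that adjoins an edge at time `t` has followed a geodesic; its crossing time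
is at least the distance of the target, and the target being free makes it at most that distance. -/
lemma isEvolution_gridForest {S : ℤ → Stream} (hS : ∀ n i, GoodStream ((explore S n).2 i))
    (hties : NoTies (exploredWeights S)) {ring : Root → ℕ → ℝ} {coin : Root → ℕ → ℕ → Bool}
    (hring : ∀ i, ring (rootAt i) = ringTime fun k => (S i k).1)
    (hcoin : ∀ i k, coin (rootAt i) k = (S i k).2) :
    IsEvolution ring coin (gridForest (exploredWeights S)) := by
  set w := exploredWeights S with hwdef
  have hw : ∀ e, 0 < w e := exploredWeights_pos hS
  have hpoint : ∀ i p, p ∈ points (S i) ↔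
      ∃ k, ring (rootAt i) k = p.1 ∧ coin (rootAt i) k = p.2 := fun i p => by
    simp only [points, Set.mem_ofPred_eq, hring, hcoin]
  have hpos : ∀ i k, 0 < (S i k).1 := fun i => (hS 0 i).1
  have hcross : ∀ n i, ∃ k, ring (rootAt (gridLabel w (n + 1) i)) k = gridDist w (n + 1) i ∧
      Follows w (n + 1) i (coin (rootAt (gridLabel w (n + 1) i)) k) := fun n i => by
    obtain ⟨p, hp, h1, h2, h3⟩ := exists_first_crossing hS n (winner w n i).1 (winner w n i).2
    obtain ⟨k, hk1, hk2⟩ := (hpoint _ _).1 hp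
    rw [gridLabel_succ_eq, gridDist_succ_eq]
    refine ⟨k, hk1.trans h1, ?_⟩
    rw [hk2]
    exact ⟨h2, h3⟩
  refine ⟨fun x => ?_, fun x s t hst hno => ?_, fun x k t ht => ?_⟩
  · refine Set.eq_empty_of_forall_notMem ?_
    rintro _ ⟨n, i, -, -, hd⟩
    have h0 := gridDist_winner_lt hw n i
    have h1 := gridDist_nonneg (fun e => (hw e).le) n (winner w n i).1
    exact absurd hd (not_le.2 (by simpa using h1.trans_lt h0))
  · refine Set.Subset.antisymm ?_ ?_
    · rintro _ ⟨n, i, rfl, rfl, hd⟩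
      obtain ⟨k, hk, -⟩ := hcross n i
      refine ⟨n, i, rfl, rfl, ?_⟩
      by_contra hs
      exact hno k (by rw [hk]; exact ⟨not_le.1 hs, hd⟩)
    · rintro _ ⟨n, i, rfl, rfl, hd⟩
      exact ⟨n, i, rfl, rfl, hd.trans (by exact_mod_cast hst)⟩
  · refine Set.Subset.antisymm ?_ (Set.union_subset ?_ ?_)
    · rintro _ ⟨n, i, rfl, rfl, hd⟩
      rcases hd.lt_or_eq with hd | hd
      · exact .inl ((mem_before_gridForest hw).2 ⟨n, i, rfl, rfl, hd⟩)
      · obtain ⟨k', hk', hf⟩ := hcross n i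
        -- The ring that occupies the vertex happens at the same time as ring `k`, and the rings of
        -- one clock are distinct.
        obtain rfl : k' = k := by
          refine ((hring _).symm ▸ strictMono_ringTime (hpos _) :
            StrictMono (ring (rootAt (gridLabel w (n + 1) i)))).injective ?_
          rw [hk', ← ht, hd]
        have hlt : gridDist w n (winner w n i).1 < t := hd ▸ gridDist_winner_lt hw n i
        have he := hf.1.walkEdge_eq
        have hb := fun j hj => hf.1.walkEdge_mem_before hw (j := j) hlt hj
        rw [← gridLabel_succ_eq] at he hb
        refine .inr ⟨n, ?_, hb, fun x' hx' => ?_⟩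
        · rw [he, hf.2]
          rfl
        · rw [tgt_lastEdge] at hx'
          exact absurd hd ((site_mem_treeVertices hw).1 ⟨x', hx'⟩).ne
    · intro e he
      obtain ⟨n, i, rfl, rfl, hd⟩ := (mem_before_gridForest hw).1 he
      exact ⟨n, i, rfl, rfl, hd.le⟩
    · rintro _ ⟨n, rfl, hmem, hfree⟩
      obtain ⟨j, rfl⟩ := exists_eq_rootAt x
      have ht0 : 0 < t := by
        have : (0 : ℝ) < t := by
          rw [ht, hring]
          exact ringTime_pos (hpos j) k
        exact_mod_cast this
      obtain ⟨i, rfl, hf, hd⟩ := follows_of_walkEdge_mem hw ht0 hmem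
      have hle := le_of_crossing hS (n := n) (i := i) (p := (ring _ k, coin _ k))
        ((hpoint _ _).2 ⟨k, rfl, rfl⟩) (by rw [← ht]; exact hd) hf
      simp only at hle
      rw [← ht, ← hwdef] at hle
      rw [hf.walkEdge_eq, tgt_edgeAt] at hfree
      -- A free target has not been reached before `t`. With `hle` the edge is optimal, and in the
      -- absence of ties it is the winner.
      have hge : (t : ℝ) ≤ gridDist w (n + 1) (stepIndex i (coin (rootAt (gridLabel w n i)) k n)) := by
        by_contra hlt
        obtain ⟨x', hx'⟩ := (site_mem_treeVertices hw).2 (not_le.1 hlt)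
        exact hfree x' hx'
      have hwin := winner_eq_of_gridDist_eq hties (hle.trans hge)
      refine ⟨n, stepIndex i (coin (rootAt (gridLabel w n i)) k n), ?_, ?_, (gridDist_step_le w n i _).trans hle⟩
      · rw [hf.walkEdge_eq, lastEdge, hwin]
      · rw [gridLabel_succ_eq, hwin]

/-! ### The law of the driving randomness -/

lemma map_eq_fairCoin {Ω : Type*} [MeasurableSpace Ω] {P : Measure Ω} {X : Ω → Bool}
    (hX : Measurable X) (h : ∀ b, P {w | X w = b} = 1 / 2) : P.map X = fairCoin := by
  refine Measure.ext_of_singleton fun b => ?_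
  rw [Measure.map_apply hX (measurableSet_singleton b), fairCoin_singleton, ← one_div]
  exact h b

/-- The particles that start at the roots. -/
def drivingStreams {Ω : Type*} (τ : Root × ℕ → Ω → ℝ) (ξ : Root × ℕ × ℕ → Ω → Bool) (w : Ω) :
    ℤ → Stream :=
  fun i k => (τ (rootAt i, k) w, fun n => ξ (rootAt i, k, n) w)

lemma streamLaw_zero : streamLaw 0 = iid ℕ ((expMeasure 1).prod (iid ℕ fairCoin)) := by
  simp [streamLaw, poissonLaw]

lemma IsDriving.measurePreserving_drivingStreams {Ω : Type*} [MeasurableSpace Ω] {P : Measure Ω}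
    [IsProbabilityMeasure P] {τ : Root × ℕ → Ω → ℝ} {ξ : Root × ℕ × ℕ → Ω → Bool}
    (h : IsDriving P τ ξ) :
    MeasurePreserving (drivingStreams τ ξ) P (iid ℤ (streamLaw 0)) := by
  have hexp : IsProbabilityMeasure (expMeasure 1) := isProbabilityMeasure_expMeasure one_pos
  have hinj : Function.Injective fun p : ℤ × ℕ => (rootAt p.1, p.2) :=
    rootAt_injective.prodMap Function.injective_id
  have hinj' : Function.Injective fun p : (ℤ × ℕ) × ℕ => (rootAt p.1.1, p.1.2, p.2) := by
    rintro ⟨⟨i, k⟩, n⟩ ⟨⟨i', k'⟩, n'⟩ h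
    simp only [Prod.mk.injEq] at h
    obtain ⟨h1, rfl, rfl⟩ := h
    rw [rootAt_injective h1]
  have hmτ : Measurable fun w (p : ℤ × ℕ) => τ (rootAt p.1, p.2) w :=
    measurable_pi_iff.2 fun _ => h.measurable_clock _
  have hmξ : Measurable fun w (p : (ℤ × ℕ) × ℕ) => ξ (rootAt p.1.1, p.1.2, p.2) w :=
    measurable_pi_iff.2 fun _ => h.measurable_coin _
  have hτ : MeasurePreserving (fun w (p : ℤ × ℕ) => τ (rootAt p.1, p.2) w) P
      (iid (ℤ × ℕ) (expMeasure 1)) := by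
    refine ⟨hmτ, ?_⟩
    have hi : iIndepFun (fun p : ℤ × ℕ => τ (rootAt p.1, p.2)) P := h.indep_clock.precomp hinj
    rw [hi.map_fun_eq_infinitePi_map fun _ => h.measurable_clock _, iid]
    simp only [h.law_clock]
  have hξ : MeasurePreserving (fun w (p : (ℤ × ℕ) × ℕ) => ξ (rootAt p.1.1, p.1.2, p.2) w) P
      (iid ((ℤ × ℕ) × ℕ) fairCoin) := by
    refine ⟨hmξ, ?_⟩
    have hi : iIndepFun (fun p : (ℤ × ℕ) × ℕ => ξ (rootAt p.1.1, p.1.2, p.2)) P :=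
      h.indep_coin.precomp hinj'
    rw [hi.map_fun_eq_infinitePi_map fun _ => h.measurable_coin _, iid]
    simp only [map_eq_fairCoin (h.measurable_coin _) (h.law_coin _)]
  have hind : IndepFun (fun w (p : ℤ × ℕ) => τ (rootAt p.1, p.2) w)
      (fun w (p : (ℤ × ℕ) × ℕ) => ξ (rootAt p.1.1, p.1.2, p.2) w) P :=
    h.indep_clock_coin.comp
      (φ := fun (f : Root × ℕ → ℝ) (p : ℤ × ℕ) => f (rootAt p.1, p.2))
      (ψ := fun (f : Root × ℕ × ℕ → Bool) (p : (ℤ × ℕ) × ℕ) => f (rootAt p.1.1, p.1.2, p.2))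
      (by fun_prop) (by fun_prop)
  have hjoint : MeasurePreserving (fun w => ((fun p : ℤ × ℕ => τ (rootAt p.1, p.2) w),
      fun p : (ℤ × ℕ) × ℕ => ξ (rootAt p.1.1, p.1.2, p.2) w)) P
      ((iid (ℤ × ℕ) (expMeasure 1)).prod (iid ((ℤ × ℕ) × ℕ) fairCoin)) := by
    refine ⟨hmτ.prodMk hmξ, ?_⟩
    rw [(indepFun_iff_map_prod_eq_prod_map_map hmτ.aemeasurable hmξ.aemeasurable).1 hind,
      hτ.map_eq, hξ.map_eq]
  rw [streamLaw_zero]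
  exact (measurePreserving_iid_curry ℤ ℕ _).comp ((measurePreserving_zip (ℤ × ℕ) _ _).comp
    (((MeasurePreserving.id _).prod (measurePreserving_iid_curry (ℤ × ℕ) ℕ fairCoin)).comp hjoint))

/-- The waiting times of a clock do not add up to a finite time. -/
lemma ae_isClock : ∀ᵐ s ∂streamLaw 0, IsClock (ringTime fun k => (s k).1) := by
  have hexp : IsProbabilityMeasure (expMeasure 1) := isProbabilityMeasure_expMeasure one_pos
  have h1 : ∀ᵐ s ∂streamLaw 0, ∀ k, 0 < (s k).1 := ae_pos_poissonLaw (by positivity) _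
  -- Infinitely many waiting times exceed 1, so the ring times pass every natural number.
  have h2 : ∀ᵐ s ∂streamLaw 0, ∀ n, ∃ k, s (n + k) ∈ Set.Ioi (1 : ℝ) ×ˢ (Set.univ : Set (ℕ → Bool)) := by
    rw [streamLaw_zero]
    refine ae_frequently_iid _ (measurableSet_Ioi.prod .univ) ?_
    rw [Measure.prod_prod, measure_univ, mul_one, expMeasure_Ioi one_pos zero_le_one]
    simp [Real.exp_pos]
  filter_upwards [h1, h2] with s hpos hlong
  have hmono := strictMono_ringTime hpos
  refine ⟨ringTime_pos hpos, hmono, fun t => ?_⟩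
  have key : ∀ m : ℕ, ∃ k, (m : ℝ) < ringTime (fun k => (s k).1) k := by
    intro m
    induction m with
    | zero => exact ⟨0, by simpa using ringTime_pos hpos 0⟩
    | succ m ih =>
      obtain ⟨k, hk⟩ := ih
      obtain ⟨l, hl⟩ := hlong (k + 1)
      have h3 : 1 < (s (k + l + 1)).1 := by
        have := hl.1
        rwa [add_right_comm] at this
      refine ⟨k + l + 1, ?_⟩
      rw [ringTime_succ]
      have := hmono.monotone (show k ≤ k + l by omega)
      push_cast
      linarith
  obtain ⟨m, hm⟩ := exists_nat_gt t
  obtain ⟨k, hk⟩ := key m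
  exact ⟨k, hm.trans hk⟩

theorem IsDriving.ae_existsUnique {Ω : Type*} [MeasurableSpace Ω] {P : Measure Ω}
    [IsProbabilityMeasure P] {τ : Root × ℕ → Ω → ℝ} {ξ : Root × ℕ × ℕ → Ω → Bool}
    (h : IsDriving P τ ξ) : ∀ᵐ w ∂P,
      (∃! T : Root → ℝ≥0 → Set Edge, IsEvolution (fun x => ringTime (fun k => τ (x, k) w))
        (fun x k n => ξ (x, k, n) w) T) ∧
      ∀ T : Root → ℝ≥0 → Set Edge, IsEvolution (fun x => ringTime (fun k => τ (x, k) w))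
        (fun x k n => ξ (x, k, n) w) T → ∀ x : Root, (treeVertices x (finalTree T x)).Finite := by
  have hq := h.measurePreserving_drivingStreams.quasiMeasurePreserving
  have hq' := (measurePreserving_exploredWeights.comp
    h.measurePreserving_drivingStreams).quasiMeasurePreserving
  have hclock : ∀ᵐ S ∂iid ℤ (streamLaw 0), ∀ i, IsClock (ringTime fun k => (S i k).1) :=
    ae_all_iff.2 fun i =>
      (measurePreserving_eval_iid (streamLaw 0) i).quasiMeasurePreserving.ae ae_isClock
  filter_upwards [hq.ae ae_goodStream_explore, hq.ae hclock, hq'.ae ae_noTies,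
    hq'.ae ae_exists_extinct] with w hS hr hties hext
  have hT := isEvolution_gridForest hS hties
    (ring := fun x => ringTime (fun k => τ (x, k) w)) (coin := fun x k n => ξ (x, k, n) w)
    (fun _ => rfl) (fun _ _ => rfl)
  have hr' : ∀ x, IsClock (ringTime fun k => τ (x, k) w) := fun x => by
    obtain ⟨i, rfl⟩ := exists_eq_rootAt x
    exact hr i
  refine ⟨⟨_, hT, fun T' hT' => hT'.unique hT hr'⟩, fun T' hT' x => ?_⟩
  rw [hT'.unique hT hr']
  exact finite_finalTree_gridForest hext x

end StretchIDLA

theorem mainTheorem1 :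
    -- first passage percolation: the tree of the origin, and all trees, are finite
    (∀ (Ω : Type*) [MeasurableSpace Ω] (P : Measure Ω) [IsProbabilityMeasure P]
      (ω : StretchIDLA.Edge → Ω → ℝ), StretchIDLA.IsFPP P ω →
        P {w | (StretchIDLA.treeVertices StretchIDLA.origin
          (StretchIDLA.geodesicTree (fun e => ω e w) StretchIDLA.origin)).Finite} = 1 ∧
        ∀ᵐ w ∂P, ∀ x : StretchIDLA.Root,
          (StretchIDLA.treeVertices x
            (StretchIDLA.geodesicTree (fun e => ω e w) x)).Finite) ∧
    -- Stretch IDLA: the evolution exists, is unique, and all its trees are finite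
    (∀ (Ω : Type*) [MeasurableSpace Ω] (P : Measure Ω) [IsProbabilityMeasure P]
      (τ : StretchIDLA.Root × ℕ → Ω → ℝ) (ξ : StretchIDLA.Root × ℕ × ℕ → Ω → Bool),
      StretchIDLA.IsDriving P τ ξ →
        ∀ᵐ w ∂P,
          (∃! T : StretchIDLA.Root → ℝ≥0 → Set StretchIDLA.Edge,
            StretchIDLA.IsEvolution
              (fun x => StretchIDLA.ringTime (fun k => τ (x, k) w))
              (fun x k n => ξ (x, k, n) w) T) ∧
          ∀ T : StretchIDLA.Root → ℝ≥0 → Set StretchIDLA.Edge,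
            StretchIDLA.IsEvolution
              (fun x => StretchIDLA.ringTime (fun k => τ (x, k) w))
              (fun x k n => ξ (x, k, n) w) T →
            ∀ x : StretchIDLA.Root,
              (StretchIDLA.treeVertices x (StretchIDLA.finalTree T x)).Finite) := by
  refine ⟨fun Ω _ P _ ω h => ⟨?_, h.ae_finite⟩, fun Ω _ P _ τ ξ h => h.ae_existsUnique⟩
  have hae := h.ae_finite.mono fun w hw => hw StretchIDLA.origin
  rw [measure_congr (Filter.eventuallyEq_univ.2 hae), measure_univ]
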